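/- Let $(M,\omega)$ be a closed connected symplectic manifold, $n\ge 1$, and let $T^n=(\mathbb R/\mathbb Z)^n$. Let $X\subset M$ be a compact subset that is \emph{$n$-stably non-displaceable}: writing $T^*T^n=\mathbb R^n\times T^n$ with the form $\omega_0=\sum_i dp_i\wedge dq_i$, there is no smooth compactly supported Hamiltonian $F\colon S^1\times M\times T^*T^n\to\mathbb R$ whose time-one map $\phi_F^1$ satisfies $(X\times T^n)\cap\phi_F^1(X\times T^n)=\emptyset$, where $T^n=\{0\}\times T^n$ is the zero section and $M\times T^*T^n$ carries $\mathrm{pr}_1^*\omega+\mathrm{pr}_2^*\omega_0$. For a symplectic manifold $(N,\Omega)$ and a compactly supported smooth function $H$ on $N$, let $X_H$ be the vector field with $\Omega(X_H,\cdot)=-dH$. For a Borel probability measure $\mu$ with compact support that is invariant under the flow of a smooth vector field $V$ on $N$, let the rotation vector $\rho(\mu,V)\in H_1(N;\mathbb R)$ be defined by $\langle[\lambda],\rho(\mu,V)\rangle=\int_N\lambda(V)\,d\mu$ for closed $1$-forms $\lambda$. For a compact subset $Y\subset N$, a free homotopy class $\alpha$ of loops in $N$ and $l\in H^1(N;\mathbb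 R)$, let $C^P_{BPS}(N,Y;l,\alpha)\in[0,\infty]$ be the infimum of all $K>0$ such that for every compactly supported smooth $H\colon N\to\mathbb R$ with $H|_Y\ge K$ there is a compactly supported invariant Borel probability measure $\mu$ of the flow of $X_H$ with $|\langle l,\rho(\mu,X_H)\rangle|\ge l(\alpha)$; and let $C^P_{BPS}(N,Y;\alpha)=\sup_{l\in H^1(N;\mathbb R)}C^P_{BPS}(N,Y;l,\alpha)$. For $R\in(\mathbb R_{>0})^n$ and $e\in\mathbb Z^n$ put $I_R^n=\{p\in\mathbb R^n: |p_i|<R_i \text{ for all } i\}$ and $$C^P(M,X,R;e)=C^P_{BPS}\bigl(M\times I_R^n\times T^n,\;X\times T^n;\;(0_M,e)\bigr),$$ where $M\times I_R^n\times T^n$ carries $\mathrm{pr}_1^*\omega+\mathrm{pr}_2^*\omega_0$, $X\times T^n=X\times\{0\}\times T^n$, and $(0_M,e)$ is the class of the loops $t\mapsto(x_0,0,te)$, $x_0\in M$. Then for all $e=(e_1,\dots,e_n)\in\mathbb Z^n$ and $R=(R_1,\dots,R_n)\in(\mathbb R_{>0})^n$, $$C^P(M,X,R;e)=\sum_{i=1}^n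 R_i\,|e_i| .$$ -/

import Mathlib

open scoped Manifold ContDiff Topology

noncomputable section

open MeasureTheory Set Bundle

namespace Symp

section Forms

variable {E : Type*} [NormedAddCommGroup E] [NormedSpace ℝ E]
  {H : Type*} [TopologicalSpace H] (I : ModelWithCorners ℝ E H)
  (N : Type*) [TopologicalSpace N] [ChartedSpace H N]

/-- Differential 1-forms on `N` (not necessarily smooth). -/
abbrev OneForm := ∀ x : N, TangentSpace I x →L[ℝ] ℝ
/-- Bilinear forms on the tangent spaces of `N` (not necessarily smooth or alternating). -/
abbrev TwoForm := ∀ x : N, TangentSpace I x →L[ℝ] TangentSpace I x →L[ℝ] ℝ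
/-- Vector fields on `N` (not necessarily smooth). -/
abbrev VectorField := ∀ x : N, TangentSpace I x

instance : AddCommGroup (OneForm I N) := Pi.addCommGroup
instance : Module ℝ (OneForm I N) := Pi.module _ _ _

variable {N} {I}

/-- The pull-back of a 1-form to the chart domain in `E` of the chart centred at `x₀`, at the point `y`
and the vector `v`. -/
def OneForm.inChart (lam : OneForm I N) (x₀ : N) (y : E) (v : E) : ℝ :=
  lam ((extChartAt I x₀).symm y) (mfderiv 𝓘(ℝ, E) I (extChartAt I x₀).symm y v)

/-- `dλ = 0`: in every chart, `(D_u λ)(v) = (D_v λ)(u)`. -/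
def OneForm.IsClosed (lam : OneForm I N) : Prop :=
  ∀ x₀ : N, ∀ y ∈ (extChartAt I x₀).target, ∀ u v : E,
    fderiv ℝ (fun z => OneForm.inChart lam x₀ z v) y u =
      fderiv ℝ (fun z => OneForm.inChart lam x₀ z u) y v

variable [IsManifold I ∞ N]

/-- The 1-form is a smooth section of the cotangent bundle. -/
def OneForm.IsSmooth (lam : OneForm I N) : Prop :=
  ContMDiff I (I.prod 𝓘(ℝ, E →L[ℝ] ℝ)) ∞
    (fun x => TotalSpace.mk' (E →L[ℝ] ℝ)
      (E := fun x : N => TangentSpace I x →L[ℝ] Trivial N ℝ x) x (lam x))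

/-- The 2-form is a smooth section of the bundle of bilinear forms. -/
def TwoForm.IsSmooth (om : TwoForm I N) : Prop :=
  ContMDiff I (I.prod 𝓘(ℝ, E →L[ℝ] E →L[ℝ] ℝ)) ∞
    (fun x => TotalSpace.mk' (E →L[ℝ] E →L[ℝ] ℝ)
      (E := fun x : N => TangentSpace I x →L[ℝ] TangentSpace I x →L[ℝ] Trivial N ℝ x) x (om x))

/-- The vector field is a smooth section of the tangent bundle. -/
def VectorField.IsSmooth (X : VectorField I N) : Prop :=
  ContMDiff I I.tangent ∞ (fun x => (⟨x, X x⟩ : TangentBundle I N))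

theorem OneForm.IsSmooth.apply {E' : Type*} [NormedAddCommGroup E'] [NormedSpace ℝ E']
    {H' : Type*} [TopologicalSpace H'] {J : ModelWithCorners ℝ E' H'} {P : Type*}
    [TopologicalSpace P] [ChartedSpace H' P] {lam : OneForm I N} (hl : OneForm.IsSmooth lam)
    {b : P → N} {s : Set P} (hb : ContMDiffOn J I ∞ b s) {V : ∀ p : P, TangentSpace I (b p)}
    (hV : ContMDiffOn J I.tangent ∞ (fun p => (⟨b p, V p⟩ : TangentBundle I N)) s) :
    ContMDiffOn J 𝓘(ℝ, ℝ) ∞ (fun p => lam (b p) (V p)) s := by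
  have h0 : ContMDiffOn J (I.prod 𝓘(ℝ, E →L[ℝ] ℝ)) ∞
      (fun p => TotalSpace.mk' (E →L[ℝ] ℝ)
        (E := fun x : N => TangentSpace I x →L[ℝ] Trivial N ℝ x) (b p) (lam (b p))) s :=
    ContMDiff.comp_contMDiffOn hl hb
  have h1 := ContMDiffOn.clm_bundle_apply (F₁ := E) (F₂ := ℝ) (E₁ := fun x : N => TangentSpace I x)
    (E₂ := Trivial N ℝ) h0 hV
  intro p hp
  exact ((contMDiffWithinAt_totalSpace).1 (h1 p hp)).2

theorem OneForm.IsSmooth.differentiableAt_inChart [I.Boundaryless] {lam : OneForm I N}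
    (hl : OneForm.IsSmooth lam) (x₀ : N) {y : E} (hy : y ∈ (extChartAt I x₀).target) (v : E) :
    DifferentiableAt ℝ (fun z => OneForm.inChart lam x₀ z v) y := by
  set e := trivializationAt E (TangentSpace I : N → Type _) x₀
  have h1 := e.contMDiffOn_symmL (IB := I) (n := ∞)
  have h2 := h1.clm_bundle_apply (E₁ := Trivial N E) (v := fun _ : N => v) (b := id)
    (fun x _ => (contMDiffAt_section x).2 contMDiffAt_const |>.contMDiffWithinAt)
  have h3 := hl.apply (b := id) contMDiffOn_id h2
  have h4 : ContMDiffOn 𝓘(ℝ, E) 𝓘(ℝ, ℝ) ∞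
      (fun z => lam ((extChartAt I x₀).symm z) (e.symmL ℝ ((extChartAt I x₀).symm z) v))
      (extChartAt I x₀).target :=
    h3.comp (contMDiffOn_extChartAt_symm x₀) (fun z hz => by
      have := (extChartAt I x₀).map_target hz
      simpa [e] using this)
  have h5 := (h4.contDiffOn.differentiableOn (by simp)).differentiableAt
    ((isOpen_extChartAt_target x₀).mem_nhds hy)
  refine h5.congr_of_eventuallyEq ?_
  filter_upwards [(isOpen_extChartAt_target x₀).mem_nhds hy] with z hz
  have hz' := (extChartAt I x₀).map_target hz
  rw [extChartAt_source] at hz'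
  simp only [OneForm.inChart]
  rw [TangentBundle.symmL_trivializationAt hz', (extChartAt I x₀).right_inv hz]
  rw [I.range_eq_univ, mfderivWithin_univ]
  rfl

variable (I N) in
/-- Smooth closed 1-forms. -/
def closedOneForms [I.Boundaryless] : Submodule ℝ (OneForm I N) where
  carrier := {lam | OneForm.IsSmooth lam ∧ OneForm.IsClosed lam}
  zero_mem' := ⟨contMDiff_zeroSection ℝ (fun x : N => TangentSpace I x →L[ℝ] Trivial N ℝ x), by
    intro x₀ y _ u v
    have h : ∀ w : E, (fun z => OneForm.inChart (0 : OneForm I N) x₀ z w) = fun _ => (0 : ℝ) :=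
      fun w => rfl
    rw [h, h]
    simp⟩
  add_mem' := by
    intro a b ha hb
    refine ⟨ContMDiff.add_section ha.1 hb.1, fun x₀ y hy u v => ?_⟩
    have h : ∀ w : E, (fun z => OneForm.inChart (a + b) x₀ z w) =
        (fun z => OneForm.inChart a x₀ z w) + (fun z => OneForm.inChart b x₀ z w) :=
      fun w => rfl
    rw [h, h, fderiv_add (ha.1.differentiableAt_inChart x₀ hy v)
      (hb.1.differentiableAt_inChart x₀ hy v), fderiv_add (ha.1.differentiableAt_inChart x₀ hy u)
      (hb.1.differentiableAt_inChart x₀ hy u)]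
    simp only [add_apply]
    rw [ha.2 x₀ y hy u v, hb.2 x₀ y hy u v]
  smul_mem' := by
    intro c a ha
    refine ⟨ContMDiff.const_smul_section ha.1, fun x₀ y hy u v => ?_⟩
    have h : ∀ w : E, (fun z => OneForm.inChart (c • a) x₀ z w) =
        c • (fun z => OneForm.inChart a x₀ z w) := fun w => rfl
    rw [h, h, fderiv_const_smul (ha.1.differentiableAt_inChart x₀ hy v),
      fderiv_const_smul (ha.1.differentiableAt_inChart x₀ hy u)]
    simp only [smul_apply]
    rw [ha.2 x₀ y hy u v]

variable (I N) in
/-- Exact 1-forms `df`, with `f` smooth. -/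
def exactOneForms : Submodule ℝ (OneForm I N) where
  carrier := {lam | ∃ f : N → ℝ, ContMDiff I 𝓘(ℝ, ℝ) ∞ f ∧ ∀ x, lam x = mvfderiv I f x}
  zero_mem' := ⟨fun _ => 0, contMDiff_const, fun x => by rw [mvfderiv_const]; rfl⟩
  add_mem' := by
    rintro a b ⟨f, hf, hfa⟩ ⟨g, hg, hgb⟩
    refine ⟨f + g, hf.add hg, fun x => ?_⟩
    rw [mvfderiv_add (hf.mdifferentiable (by simp) x) (hg.mdifferentiable (by simp) x),
      ← hfa, ← hgb]
    rfl
  smul_mem' := by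
    rintro c a ⟨f, hf, hfa⟩
    have hc : ContMDiff I 𝓘(ℝ, ℝ) ∞ (fun _ : N => c) := contMDiff_const
    refine ⟨c • f, hc.mul hf, fun x => ?_⟩
    have h : (c • f : N → ℝ) = (fun _ : N => c) • f := rfl
    rw [h, mvfderiv_smul mdifferentiableAt_const (hf.mdifferentiable (by simp) x),
      mvfderiv_const, ← hfa]
    simp

variable (I N) in
/-- The first de Rham cohomology `H¹(N; ℝ)`: smooth closed 1-forms modulo exact ones. -/
abbrev H1 [I.Boundaryless] : Type _ :=
  closedOneForms I N ⧸ (exactOneForms I N).submoduleOf (closedOneForms I N)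

/-- Smooth loops `S¹ = ℝ/ℤ → N`, as smooth 1-periodic maps on `ℝ`. A loop stands for the free
homotopy class that it represents. -/
structure SmoothLoop (I : ModelWithCorners ℝ E H) (N : Type*) [TopologicalSpace N]
    [ChartedSpace H N] where
  toFun : ℝ → N
  periodic : ∀ t, toFun (t + 1) = toFun t
  smooth : ContMDiff 𝓘(ℝ, ℝ) I ∞ toFun

/-- The velocity `γ'(t)`. -/
def SmoothLoop.velocity (γ : SmoothLoop I N) (t : ℝ) : TangentSpace I (γ.toFun t) :=
  mfderiv 𝓘(ℝ, ℝ) I γ.toFun t (1 : ℝ)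

theorem SmoothLoop.continuous_apply (γ : SmoothLoop I N) {lam : OneForm I N}
    (hl : OneForm.IsSmooth lam) : Continuous (fun t => lam (γ.toFun t) (γ.velocity t)) := by
  have h1 : ContMDiff 𝓘(ℝ, ℝ) I.tangent ∞
      (fun t : ℝ => (⟨γ.toFun t, γ.velocity t⟩ : TangentBundle I N)) := by
    have h2 := γ.smooth.contMDiff_tangentMap (m := ∞) (by simp)
    have h3 : ContMDiff 𝓘(ℝ, ℝ) 𝓘(ℝ, ℝ).tangent ∞
        (fun t : ℝ => (⟨t, (1 : ℝ)⟩ : TangentBundle 𝓘(ℝ, ℝ) ℝ)) := by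
      intro t
      rw [contMDiffAt_totalSpace]
      refine ⟨contMDiffAt_id, ?_⟩
      simpa using contMDiffAt_const
    exact h2.comp h3
  exact continuousOn_univ.1
    ((hl.apply (γ.smooth.contMDiffOn (s := univ)) h1.contMDiffOn).continuousOn)

theorem SmoothLoop.integral_exact (γ : SmoothLoop I N) {lam : OneForm I N}
    (hl : OneForm.IsSmooth lam) {f : N → ℝ} (hf : ContMDiff I 𝓘(ℝ, ℝ) ∞ f)
    (h : ∀ x, lam x = mvfderiv I f x) :
    ∫ t in (0 : ℝ)..1, lam (γ.toFun t) (γ.velocity t) = 0 := by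
  have hd : ∀ t : ℝ, HasDerivAt (fun s => f (γ.toFun s)) (lam (γ.toFun t) (γ.velocity t)) t := by
    intro t
    have h1 := (hf.mdifferentiable (by simp) (γ.toFun t)).hasMFDerivAt.comp t
      (γ.smooth.mdifferentiable (by simp) t).hasMFDerivAt
    have h2 : HasFDerivAt (fun s => f (γ.toFun s)) ((mvfderiv I f (γ.toFun t)).comp
      (mfderiv 𝓘(ℝ, ℝ) I γ.toFun t) : ℝ →L[ℝ] ℝ) t := h1.hasFDerivAt
    rw [h]
    exact h2.hasDerivAt
  rw [intervalIntegral.integral_eq_sub_of_hasDerivAt (fun t _ => hd t)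
    ((γ.continuous_apply hl).intervalIntegrable _ _)]
  have := γ.periodic 0
  rw [zero_add] at this
  rw [this, sub_self]

/-- The pairing of the homology class of a loop with cohomology, `[λ] ↦ ∫_γ λ`; well defined on
`H¹(N; ℝ)` and dependent on the free homotopy class of `γ` only. -/
def SmoothLoop.period [I.Boundaryless] (γ : SmoothLoop I N) : Module.Dual ℝ (H1 I N) :=
  Submodule.liftQ _
    { toFun := fun lam : closedOneForms I N =>
        ∫ t in (0 : ℝ)..1, lam.1 (γ.toFun t) (γ.velocity t)
      map_add' := fun a b =>
        intervalIntegral.integral_add ((γ.continuous_apply a.2.1).intervalIntegrable _ _)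
          ((γ.continuous_apply b.2.1).intervalIntegrable _ _)
      map_smul' := fun c a => intervalIntegral.integral_const_mul c _ }
    (by
      rintro ⟨lam, hl⟩ ⟨f, hf, h⟩
      exact γ.integral_exact hl.1 hf h)

/-- `φ` is the (complete) flow of the vector field `X`. -/
def IsFlow (X : VectorField I N) (φ : ℝ → N → N) : Prop :=
  (∀ x, φ 0 x = x) ∧ ∀ x, IsMIntegralCurve (fun t => φ t x) X

/-- `𝔐(N, X)`: the Borel probability measures with compact support that are invariant under the flow
of `X`. -/
def invariantMeasures [MeasurableSpace N] (X : VectorField I N) : Set (Measure N) :=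
  {μ | IsProbabilityMeasure μ ∧ (∃ K : Set N, IsCompact K ∧ μ Kᶜ = 0) ∧
    ∃ φ : ℝ → N → N, IsFlow X φ ∧ ∀ t, MeasurePreserving (φ t) μ μ}

theorem OneForm.IsSmooth.continuous_apply {lam : OneForm I N} (hl : OneForm.IsSmooth lam)
    {X : VectorField I N} (hX : VectorField.IsSmooth X) : Continuous (fun x => lam x (X x)) :=
  continuousOn_univ.1 ((hl.apply (contMDiffOn_id (s := univ)) hX.contMDiffOn).continuousOn)

section Measure

variable [MeasurableSpace N] [BorelSpace N] [T2Space N]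

theorem integrable_of_compact_support {X : VectorField I N} {μ : Measure N}
    (hμ : μ ∈ invariantMeasures X) {g : N → ℝ} (hg : Continuous g) : Integrable g μ := by
  obtain ⟨hp, ⟨K, hK, hKμ⟩, -⟩ := hμ
  have h1 : IntegrableOn g K μ := hg.continuousOn.integrableOn_compact hK
  rwa [IntegrableOn, Measure.restrict_eq_self_of_ae_mem (mem_ae_iff.2 hKμ)] at h1

/-- For an invariant measure `μ` of `X`, `∫ df(X) dμ = 0`. -/
theorem integral_exact {X : VectorField I N} (hX : VectorField.IsSmooth X) {μ : Measure N}
    (hμ : μ ∈ invariantMeasures X) {lam : OneForm I N} (hl : OneForm.IsSmooth lam) {f : N → ℝ}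
    (hf : ContMDiff I 𝓘(ℝ, ℝ) ∞ f) (h : ∀ x, lam x = mvfderiv I f x) :
    ∫ x, lam x (X x) ∂μ = 0 := by
  have hfi := integrable_of_compact_support hμ hf.continuous
  have hgc := hl.continuous_apply hX
  obtain ⟨hp, ⟨K, hK, hKμ⟩, φ, ⟨hφ0, hφ⟩, hφμ⟩ := hμ
  have hd : ∀ x t, HasDerivAt (fun s => f (φ s x)) (lam (φ t x) (X (φ t x))) t := by
    intro x t
    have h2 : HasFDerivAt (fun s => f (φ s x)) ((mvfderiv I f (φ t x)).comp
        ((1 : ℝ →L[ℝ] ℝ).smulRight (X (φ t x))) : ℝ →L[ℝ] ℝ) t :=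
      ((hf.mdifferentiable (by simp) (φ t x)).hasMFDerivAt.comp t (hφ x t)).hasFDerivAt
    rw [h]
    refine h2.hasDerivAt.congr_deriv ?_
    change mvfderiv I f (φ t x) ((1 : ℝ) • X (φ t x)) = _
    rw [one_smul]
  obtain ⟨C, hC⟩ := hK.exists_bound_of_continuousOn hgc.continuousOn
  have hae : ∀ᵐ x ∂μ, ∀ t : ℝ, φ t x ∈ K := by
    have h1 : ∀ᵐ x ∂μ, ∀ q : ℚ, φ (q : ℝ) x ∈ K := by
      rw [ae_all_iff]
      intro q
      exact (hφμ q).quasiMeasurePreserving.ae (mem_ae_iff.2 hKμ)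
    filter_upwards [h1] with x hx t
    have hc : Continuous (fun t => φ t x) := (hφ x).continuous
    have hcl : IsClosed {t : ℝ | φ t x ∈ K} := hK.isClosed.preimage hc
    have hsub : range ((↑) : ℚ → ℝ) ⊆ {t : ℝ | φ t x ∈ K} := by
      rintro _ ⟨q, rfl⟩
      exact hx q
    exact hcl.closure_subset_iff.2 hsub (Rat.denseRange_cast t)
  have hlim : Filter.Tendsto (fun n : ℕ => ∫ x, ((n : ℝ) + 1) * (f (φ (1 / ((n : ℝ) + 1)) x) - f x) ∂μ)
      Filter.atTop (𝓝 (∫ x, lam x (X x) ∂μ)) := by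
    refine tendsto_integral_of_dominated_convergence (fun _ => C) ?_ (integrable_const C) ?_ ?_
    · intro n
      exact (((hφμ _).integrable_comp_of_integrable hfi).sub hfi).aestronglyMeasurable.const_mul _
    · intro n
      filter_upwards [hae] with x hx
      have hm := (convex_univ (𝕜 := ℝ) (E := ℝ)).norm_image_sub_le_of_norm_hasDerivWithin_le
        (f := fun s => f (φ s x)) (C := C) (fun t _ => (hd x t).hasDerivWithinAt)
        (fun t _ => hC _ (hx t)) (mem_univ 0) (mem_univ (1 / ((n : ℝ) + 1)))
      have hn : (0 : ℝ) < (n : ℝ) + 1 := by positivity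
      simp only [hφ0, sub_zero] at hm
      rw [norm_mul, Real.norm_of_nonneg hn.le]
      rw [Real.norm_of_nonneg (by positivity : (0 : ℝ) ≤ 1 / ((n : ℝ) + 1))] at hm
      calc ((n : ℝ) + 1) * ‖f (φ (1 / ((n : ℝ) + 1)) x) - f x‖
          ≤ ((n : ℝ) + 1) * (C * (1 / ((n : ℝ) + 1))) := by gcongr
        _ = C := by field_simp
    · refine Filter.Eventually.of_forall fun x => ?_
      have h1 := (hd x 0).tendsto_slope_zero_right
      rw [hφ0] at h1
      have h2 : Filter.Tendsto (fun n : ℕ => 1 / ((n : ℝ) + 1)) Filter.atTop (𝓝[>] 0) :=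
        tendsto_nhdsWithin_iff.2 ⟨tendsto_one_div_add_atTop_nhds_zero_nat,
          Filter.Eventually.of_forall fun n => by simp only [mem_Ioi]; positivity⟩
      refine (h1.comp h2).congr fun n => ?_
      simp
  have hz : (fun n : ℕ => ∫ x, ((n : ℝ) + 1) * (f (φ (1 / ((n : ℝ) + 1)) x) - f x) ∂μ) =
      fun _ => 0 := by
    funext n
    have hi : Integrable (fun x => f (φ (1 / ((n : ℝ) + 1)) x)) μ :=
      (hφμ _).integrable_comp_of_integrable hfi
    rw [integral_const_mul, integral_sub hi hfi]
    have hmap := (hφμ (1 / ((n : ℝ) + 1)))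
    have := integral_map (μ := μ) hmap.measurable.aemeasurable
      (f := f) hf.continuous.aestronglyMeasurable
    rw [hmap.map_eq] at this
    rw [← this, sub_self, mul_zero]
  rw [hz] at hlim
  exact (tendsto_nhds_unique hlim tendsto_const_nhds)

open Classical in
/-- The rotation vector `ρ(μ, X)` of an invariant measure `μ` of the flow of a smooth vector field `X`:
the element of `H₁(N; ℝ)`, seen as a functional on `H¹(N; ℝ)`, given by `⟨[λ], ρ⟩ = ∫ λ(X) dμ`. -/
def rotationVector [I.Boundaryless] (X : VectorField I N) (μ : Measure N) :
    Module.Dual ℝ (H1 I N) :=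
  if h : VectorField.IsSmooth X ∧ μ ∈ invariantMeasures X then
    Submodule.liftQ _
      { toFun := fun lam : closedOneForms I N => ∫ x, lam.1 x (X x) ∂μ
        map_add' := fun a b =>
          integral_add (integrable_of_compact_support h.2 (a.2.1.continuous_apply h.1))
            (integrable_of_compact_support h.2 (b.2.1.continuous_apply h.1))
        map_smul' := fun c a => integral_const_mul c _ }
      (by
        rintro ⟨lam, hl⟩ ⟨f, hf, hlf⟩
        exact integral_exact h.1 h.2 hl.1 hf hlf)
  else 0

end Measure

/-- The Hamiltonian vector field `X_F` of a function `F`: for a nondegenerate form, the vector field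
with `ω(X_F, V) = -dF(V)` (see `hamiltonianVectorField_spec`). -/
def hamiltonianVectorField (om : TwoForm I N) (F : N → ℝ) : VectorField I N :=
  fun x => (om x).inverse (-(mvfderiv I F x))

/-- For `l ∈ H¹(N; ℝ)` and the class `α` of `γ`: the infimum (`∞` if there is none) of all `K > 0` such
that for every smooth compactly supported `F` with `F ≥ K` on `Y` there is an invariant measure `μ` of
the flow of `X_F` with `|⟨l, ρ(μ, X_F)⟩| ≥ l(α)`. -/
def bpsCapacityClass [I.Boundaryless] [MeasurableSpace N] [BorelSpace N] [T2Space N]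
    (om : TwoForm I N) (Y : Set N) (l : H1 I N) (γ : SmoothLoop I N) : EReal :=
  sInf ((fun K : ℝ => (K : EReal)) '' {K | 0 < K ∧
    ∀ F : N → ℝ, ContMDiff I 𝓘(ℝ, ℝ) ∞ F → HasCompactSupport F → (∀ y ∈ Y, K ≤ F y) →
      ∃ μ ∈ invariantMeasures (hamiltonianVectorField om F),
        γ.period l ≤ |rotationVector (hamiltonianVectorField om F) μ l|})

/-- The supremum of `bpsCapacityClass` over all `l ∈ H¹(N; ℝ)`. -/
def bpsCapacity [I.Boundaryless] [MeasurableSpace N] [BorelSpace N] [T2Space N]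
    (om : TwoForm I N) (Y : Set N) (γ : SmoothLoop I N) : EReal :=
  ⨆ l : H1 I N, bpsCapacityClass om Y l γ

/-- `Y` is displaceable: there are a smooth Hamiltonian `F : S¹ × N → ℝ` with compact support (written as
a 1-periodic family) and its Hamiltonian isotopy `φ`, with `closure Y ∩ φ¹(Y) = ∅`. -/
def Displaceable (om : TwoForm I N) (Y : Set N) : Prop :=
  ∃ (F : ℝ → N → ℝ) (φ : ℝ → N → N),
    ContMDiff (𝓘(ℝ, ℝ).prod I) 𝓘(ℝ, ℝ) ∞ (fun z : ℝ × N => F z.1 z.2) ∧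
    (∀ t x, F (t + 1) x = F t x) ∧
    (∃ K : Set N, IsCompact K ∧ ∀ t, ∀ x ∉ K, F t x = 0) ∧
    (∀ x, φ 0 x = x) ∧
    (∀ x t, HasMFDerivAt 𝓘(ℝ, ℝ) I (fun s => φ s x) t
      ((1 : ℝ →L[ℝ] ℝ).smulRight (hamiltonianVectorField om (F t) (φ t x)))) ∧
    Disjoint (closure Y) (φ 1 '' Y)

/-- The pull-back of a 2-form to the chart domain in `E` of the chart centred at `x₀`. -/
def TwoForm.inChart (om : TwoForm I N) (x₀ : N) (y : E) (u v : E) : ℝ :=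
  om ((extChartAt I x₀).symm y) (mfderiv 𝓘(ℝ, E) I (extChartAt I x₀).symm y u)
    (mfderiv 𝓘(ℝ, E) I (extChartAt I x₀).symm y v)

/-- `dω = 0`, written out in every chart. -/
def TwoForm.IsClosed (om : TwoForm I N) : Prop :=
  ∀ x₀ : N, ∀ y ∈ (extChartAt I x₀).target, ∀ u v w : E,
    fderiv ℝ (fun z => TwoForm.inChart om x₀ z v w) y u
      - fderiv ℝ (fun z => TwoForm.inChart om x₀ z u w) y v
      + fderiv ℝ (fun z => TwoForm.inChart om x₀ z u v) y w = 0

variable {E' : Type*} [NormedAddCommGroup E'] [NormedSpace ℝ E']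
  {H' : Type*} [TopologicalSpace H'] {J : ModelWithCorners ℝ E' H'}
  {P : Type*} [TopologicalSpace P] [ChartedSpace H' P]

/-- The pull-back `f^*ω`. -/
def TwoForm.pullback (f : P → N) (om : TwoForm I N) : TwoForm J P :=
  fun x => ((mfderiv J I f x).precomp ℝ).comp ((om (f x)).comp (mfderiv J I f x))

/-- `(a ∧ b)(u, v) = a(u) b(v) - b(u) a(v)`. -/
def OneForm.wedge (a b : OneForm I N) : TwoForm I N :=
  fun x => (a x).smulRight (b x) - (b x).smulRight (a x)

variable (I N) in
/-- Symplectic forms on `N`. -/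
structure SymplecticForm where
  form : TwoForm I N
  smooth : TwoForm.IsSmooth form
  alternating : ∀ x v, form x v v = 0
  nondegenerate : ∀ x u, (∀ v, form x u v = 0) → u = 0
  closed : TwoForm.IsClosed form

/-- For a nondegenerate form, `ω(X_F, V) = -dF(V)`. -/
theorem hamiltonianVectorField_spec [FiniteDimensional ℝ E] (om : TwoForm I N)
    (hnd : ∀ x u, (∀ v, om x u v = 0) → u = 0) (F : N → ℝ) (x : N) (v : TangentSpace I x) :
    om x (hamiltonianVectorField om F x) v = -(mvfderiv I F x v) := by
  have key : ∀ A : E →L[ℝ] E →L[ℝ] ℝ, (∀ u, (∀ v, A u v = 0) → u = 0) → A.IsInvertible := by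
    intro A hA
    have hinj : Function.Injective (A : E →ₗ[ℝ] E →L[ℝ] ℝ) := by
      rw [injective_iff_map_eq_zero]
      intro u hu
      exact hA u fun v => congrArg (fun L : E →L[ℝ] ℝ => L v) hu
    have hdim : Module.finrank ℝ E = Module.finrank ℝ (E →L[ℝ] ℝ) := by
      rw [← (LinearMap.toContinuousLinearMap : (E →ₗ[ℝ] ℝ) ≃ₗ[ℝ] E →L[ℝ] ℝ).finrank_eq]
      exact (Subspace.dual_finrank_eq (K := ℝ) (V := E)).symm
    refine ⟨((A : E →ₗ[ℝ] E →L[ℝ] ℝ).linearEquivOfInjective hinj hdim).toContinuousLinearEquiv, ?_⟩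
    ext u v
    simp
  have h := (key (om x) (hnd x)).self_apply_inverse (-(mvfderiv I F x))
  exact congrArg (fun L : E →L[ℝ] ℝ => L v) h

end Forms

section Torus

/-- The torus `Tⁿ = (ℝ/ℤ)ⁿ`. -/
abbrev Torus (n : ℕ) : Type := Fin n → UnitAddCircle

/-- The universal covering `ℝⁿ → Tⁿ`. -/
def Torus.proj (n : ℕ) (q : Fin n → ℝ) : Torus n := fun i => (q i : UnitAddCircle)

theorem Torus.isLocalHomeomorph_proj (n : ℕ) : IsLocalHomeomorph (Torus.proj n) := by
  have h : IsLocalHomeomorph ((↑) : ℝ → UnitAddCircle) := AddCircle.isLocalHomeomorph_coe 1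
  refine IsLocalHomeomorph.mk _ fun q =>
    ⟨OpenPartialHomeomorph.pi fun i => (h.localInverseAt (q i)).symm, ?_, ?_⟩
  · simp [OpenPartialHomeomorph.pi, mem_pi]
  · intro y _
    funext i
    simp [OpenPartialHomeomorph.pi, Torus.proj]

theorem Torus.proj_surjective (n : ℕ) : Function.Surjective (Torus.proj n) := by
  intro q
  exact ⟨fun i => (QuotientAddGroup.mk_surjective (q i)).choose,
    funext fun i => (QuotientAddGroup.mk_surjective (q i)).choose_spec⟩

/-- The standard charts of `Tⁿ`: local inverses of the covering `ℝⁿ → Tⁿ`. -/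
instance (n : ℕ) : ChartedSpace (Fin n → ℝ) (Torus n) where
  atlas := range (Torus.isLocalHomeomorph_proj n).localInverseAt
  chartAt q := (Torus.isLocalHomeomorph_proj n).localInverseAt (Torus.proj_surjective n q).choose
  mem_chart_source q := by
    have h := (Torus.isLocalHomeomorph_proj n).apply_self_mem_localInverseAt_source
      (x := (Torus.proj_surjective n q).choose)
    rwa [(Torus.proj_surjective n q).choose_spec] at h
  chart_mem_atlas q := mem_range_self _

/-- A continuous map on an open subset of `ℝⁿ` which lifts the covering map is locally a translation. -/
theorem Torus.contDiffOn_of_proj_eq {n : ℕ} {s : Set (Fin n → ℝ)} (hs : IsOpen s)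
    {g : (Fin n → ℝ) → Fin n → ℝ} (hg : ContinuousOn g s)
    (h : ∀ y ∈ s, Torus.proj n (g y) = Torus.proj n y) : ContDiffOn ℝ ∞ g s := by
  intro y hy
  have hc : ContinuousAt (fun z => g z - z) y :=
    (hg.continuousAt (hs.mem_nhds hy)).sub continuousAt_id
  have hev : ∀ᶠ z in 𝓝 y, g z = z + (g y - y) := by
    have h1 : ∀ᶠ z in 𝓝 y, dist (g z - z) (g y - y) < 1 :=
      (Metric.continuousAt_iff'.1 hc) 1 one_pos
    filter_upwards [h1, hs.mem_nhds hy] with z hz hzs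
    have hz' : ∀ w ∈ s, ∀ i, ∃ k : ℤ, g w i - w i = k := by
      intro w hw i
      have h2 := congrFun (h w hw) i
      simp only [Torus.proj] at h2
      rw [← sub_eq_zero, ← AddCircle.coe_sub, AddCircle.coe_eq_zero_iff] at h2
      obtain ⟨k, hk⟩ := h2
      exact ⟨k, by simpa using hk.symm⟩
    funext i
    obtain ⟨k, hk⟩ := hz' z hzs i
    obtain ⟨m, hm⟩ := hz' y hy i
    have h3 := (dist_pi_lt_iff one_pos).1 hz i
    simp only [Pi.sub_apply, Real.dist_eq, hk, hm] at h3
    have h4 : k = m := by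
      have : |k - m| < 1 := by exact_mod_cast h3
      have := Int.abs_lt_one_iff.1 this
      omega
    have : g z i - z i = g y i - y i := by rw [hk, hm, h4]
    simp only [Pi.add_apply, Pi.sub_apply]
    linarith
  have hcd : ContDiffAt ℝ ∞ (fun z : Fin n → ℝ => z + (g y - y)) y :=
    contDiffAt_id.add contDiffAt_const
  exact (hcd.congr_of_eventuallyEq hev).contDiffWithinAt

instance (n : ℕ) : IsManifold 𝓘(ℝ, Fin n → ℝ) ∞ (Torus n) := by
  apply isManifold_of_contDiffOn
  rintro _ _ ⟨x, rfl⟩ ⟨y, rfl⟩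
  have hl := Torus.isLocalHomeomorph_proj n
  set e := (hl.localInverseAt x).symm.trans (hl.localInverseAt y)
  have h1 : ContDiffOn ℝ ∞ e e.source := by
    refine Torus.contDiffOn_of_proj_eq e.open_source e.continuousOn ?_
    intro z hz
    have hz2 := hz.2
    simp only [mem_preimage] at hz2
    have := hl.apply_localInverseAt_of_mem hz2
    simpa [e] using this
  simpa using h1

theorem Torus.contMDiff_proj (n : ℕ) :
    ContMDiff 𝓘(ℝ, Fin n → ℝ) 𝓘(ℝ, Fin n → ℝ) ∞ (Torus.proj n) := by
  have hl := Torus.isLocalHomeomorph_proj n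
  intro y
  rw [contMDiffAt_iff]
  refine ⟨hl.continuous.continuousAt, ?_⟩
  set c := chartAt (Fin n → ℝ) (Torus.proj n y) with hc
  have hs : IsOpen (Torus.proj n ⁻¹' c.source) := c.open_source.preimage hl.continuous
  have h1 : ContDiffOn ℝ ∞ (c ∘ Torus.proj n) (Torus.proj n ⁻¹' c.source) := by
    refine Torus.contDiffOn_of_proj_eq hs
      (c.continuousOn.comp hl.continuous.continuousOn fun _ h => h) ?_
    intro z hz
    exact hl.apply_localInverseAt_of_mem hz
  have h2 := (h1 y (mem_chart_source (Fin n → ℝ) (Torus.proj n y)))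
  have h3 := h2.contDiffAt (hs.mem_nhds (mem_chart_source (Fin n → ℝ) (Torus.proj n y)))
  exact h3.contDiffWithinAt

/-- The 1-form `dq_i` on `Tⁿ`: the differential of the `i`-th coordinate of a standard chart. -/
def Torus.dq {n : ℕ} (i : Fin n) : OneForm 𝓘(ℝ, Fin n → ℝ) (Torus n) :=
  fun q => mvfderiv 𝓘(ℝ, Fin n → ℝ) (fun q' => chartAt (Fin n → ℝ) q q' i) q

end Torus

section Stabilization

variable {E : Type*} [NormedAddCommGroup E] [NormedSpace ℝ E]
  {H : Type*} [TopologicalSpace H] {I : ModelWithCorners ℝ E H}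
  {M : Type*} [TopologicalSpace M] [ChartedSpace H M] [IsManifold I ∞ M]
  {n : ℕ} {B : Type*} [TopologicalSpace B] [ChartedSpace (Fin n → ℝ) B]

/-- The model with corners of `B × Tⁿ`, for `B` modelled on `ℝⁿ`. -/
abbrev phaseModel (n : ℕ) := 𝓘(ℝ, Fin n → ℝ).prod 𝓘(ℝ, Fin n → ℝ)

/-- The form `ω₀ = dp₁ ∧ dq₁ + ⋯ + dpₙ ∧ dqₙ` on `B × Tⁿ`, where `p : B → ℝⁿ` is the inclusion of an open
subset `B` of `ℝⁿ`. -/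
def canonicalForm (p : B → Fin n → ℝ) : TwoForm (phaseModel n) (B × Torus n) :=
  ∑ i, OneForm.wedge (fun z => mvfderiv (phaseModel n) (fun z' : B × Torus n => p z'.1 i) z)
    (fun z => (Torus.dq i z.2).comp (mfderiv (phaseModel n) 𝓘(ℝ, Fin n → ℝ) Prod.snd z))

/-- The form `pr₁^*ω + pr₂^*ω₀` on `M × (B × Tⁿ)`, where `p : B → ℝⁿ` is the inclusion. -/
def stabilizedForm (om : SymplecticForm I M) (p : B → Fin n → ℝ) :
    TwoForm (I.prod (phaseModel n)) (M × (B × Torus n)) :=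
  TwoForm.pullback Prod.fst om.form + TwoForm.pullback Prod.snd (canonicalForm p)

/-- The subset `X × Tⁿ = X × ({0} × Tⁿ)` of `M × (B × Tⁿ)`. -/
def stabilizedSet (X : Set M) (p : B → Fin n → ℝ) : Set (M × (B × Torus n)) :=
  {z | z.1 ∈ X ∧ p z.2.1 = 0}

/-- `X` is `n`-stably displaceable: `X × Tⁿ` is displaceable in `M × T^*Tⁿ = M × (ℝⁿ × Tⁿ)`. -/
def StablyDisplaceable (om : SymplecticForm I M) (n : ℕ) (X : Set M) : Prop :=
  Displaceable (stabilizedForm om (id : (Fin n → ℝ) → Fin n → ℝ)) (stabilizedSet X id)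

/-- The open box `I_R^n = {p ∈ ℝⁿ | |p_i| < R_i for all i}`. -/
def openBox (R : Fin n → ℝ) : TopologicalSpace.Opens (Fin n → ℝ) :=
  ⟨{p | ∀ i, |p i| < R i}, by
    have h : {p : Fin n → ℝ | ∀ i, |p i| < R i} = ⋂ i, {p | |p i| < R i} := by ext; simp
    rw [h]
    exact isOpen_iInter_of_finite fun i =>
      isOpen_lt (continuous_apply i).abs continuous_const⟩

/-- The origin of the box. -/
def openBox.zero {R : Fin n → ℝ} (hR : ∀ i, 0 < R i) : openBox R :=
  ⟨0, fun i => by simpa using hR i⟩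

/-- The loop `t ↦ (x₀, 0, t e)`, which represents the class `(0_M, e)` on `M × (I_R^n × Tⁿ)`. -/
def standardLoop (I : ModelWithCorners ℝ E H) (x₀ : M) {R : Fin n → ℝ} (hR : ∀ i, 0 < R i)
    (e : Fin n → ℤ) : SmoothLoop (I.prod (phaseModel n)) (M × (openBox R × Torus n)) where
  toFun t := (x₀, (openBox.zero hR, Torus.proj n (fun i => t * e i)))
  periodic t := by
    have : Torus.proj n (fun i => (t + 1) * e i) = Torus.proj n (fun i => t * e i) := by
      funext i
      have hi : ((e i : ℝ) : UnitAddCircle) = 0 :=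
        (AddCircle.coe_eq_zero_iff 1).2 ⟨e i, by simp⟩
      simp only [Torus.proj, add_mul, one_mul]
      rw [AddCircle.coe_add, hi, add_zero]
    rw [this]
  smooth := by
    refine contMDiff_const.prodMk (contMDiff_const.prodMk ?_)
    refine (Torus.contMDiff_proj n).comp ?_
    rw [contMDiff_iff_contDiff]
    fun_prop

/-- The capacity `C^P(M, X, R; e)`. The base point `x₀` is that of the loop representing `(0_M, e)`. -/
def measureCapacity [I.Boundaryless] [T2Space M] [MeasurableSpace M] [BorelSpace M]
    (om : SymplecticForm I M) (X : Set M) {R : Fin n → ℝ} (hR : ∀ i, 0 < R i)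
    (e : Fin n → ℤ) (x₀ : M) : EReal :=
  bpsCapacity (stabilizedForm om (fun p : openBox R => (p : Fin n → ℝ)))
    (stabilizedSet X fun p : openBox R => (p : Fin n → ℝ)) (standardLoop I x₀ hR e)

end Stabilization

end Symp

end

/-!
The equality is two inequalities, and each of them concerns the closed 1-forms
`pr_M^* λ + ∑ aᵢ dqᵢ` on `M × (I_R^n × Tⁿ)`, whose period on the class `(0_M, e)` is `∑ aᵢ eᵢ`
(`period_standardLoop`). Up to exact forms there are no others: on the covering `M × (I_R^n × ℝⁿ)`,
integration along the rays of the fibres compares a closed form with its restriction to `M`, and the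
deck transformations change the primitive by constants, which are the numbers `aᵢ`
(`exists_cohomologous_productForm`).

*Lower bound* (`sum_le_measureCapacity`). Let `aᵢ = sign(eᵢ) Rᵢ`, so that `∑ aᵢ dqᵢ` has period
`A = ∑ Rᵢ |eᵢ|`. If `F` is a function `φ(p)` of the momentum only, then the value of this form on the
Hamiltonian vector field of `F` is the derivative of `φ` in the direction `a`, up to sign
(`productForm_hamiltonianVectorField`). Since `a` lies in the closed box, for every `K < A` some
compactly supported `φ` has `φ(0) ≥ K` and derivative bounded by a constant less than `A` in that
direction (`exists_box_function`), and no invariant measure has rotation `A`.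

*Upper bound* (`measureCapacity_le_sum`). Let `F ≥ K` on `X × Tⁿ`, and let `c` be the period of a closed
form `λ`. Suppose every invariant measure `μ` of the Hamiltonian vector field `Y` of `F` has
`|∫ λ(Y) dμ| < c`. Long time averages of `λ(Y)` are then uniformly smaller than some `c' < c`, as
otherwise a weak limit of averages along orbits would be an invariant measure with rotation at least `c`
(`exists_invariant_measure_of_averages`). A time average of `λ(Y)` is the value on `Y` of a form
cohomologous to `λ`, so `|(λ + dg)(Y)| ≤ c'` for some function `g` (`exists_cohomologous_small`), and
`λ + dg = pr_M^* λ_M + ∑ aᵢ dqᵢ + dk` with `c = ∑ aᵢ eᵢ`.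

On `M × T^*Tⁿ` the vector field `V` dual to `pr_M^* λ_M + ∑ aᵢ dqᵢ` has a symplectic flow `S`, which moves
the momentum by `t a` in time `t`. Let `Φ` be the flow of `V + W`, where `W` is dual to the differential of
`k`, cut off outside the momenta in the support of `F`. The maps `S (-t) ∘ Φ t` are a Hamiltonian isotopy
(`displaceable_of_flows`), so at `t = T = K / c` it takes a point `y ∈ X × Tⁿ` to a point of `X × Tⁿ`.
Hence `Φ T y` has momentum `T a`. On the other hand `dF(V + W) = (λ + dg)(Y)` where `F ≠ 0`, so `F`
decreases by at most `c' T < K` on the way and is still positive at `Φ T y`. The momentum `T a` therefore lies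
in the box, and `K = T c = ∑ T aᵢ eᵢ ≤ ∑ Rᵢ |eᵢ|` (`le_sum_of_not_stablyDisplaceable`).

The smooth flows this needs are constructed below: the flow of a complete smooth vector field is smooth
(`IsFlow.contMDiff`), by the inverse function theorem on spaces of curves, and a compactly supported
perturbation of a complete vector field is complete (`IsFlow.exists_isFlow_add`).
-/

set_option linter.unusedSectionVars false

/-! ### Smooth dependence of solutions of an ordinary differential equation on the initial point -/

namespace ContinuousMap

universe u v

variable {K : Type v} [TopologicalSpace K] [CompactSpace K]
  {E F : Type u} [NormedAddCommGroup E] [NormedSpace ℝ E] [NormedAddCommGroup F] [NormedSpace ℝ F]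

/-- Pointwise evaluation `(A, h) ↦ (s ↦ A(s) h(s))` of a continuous family of operators on a
continuous function, as a bounded bilinear map. -/
noncomputable def pointwiseCLM (K : Type v) [TopologicalSpace K] [CompactSpace K]
    (E F : Type u) [NormedAddCommGroup E] [NormedSpace ℝ E] [NormedAddCommGroup F]
    [NormedSpace ℝ F] : C(K, E →L[ℝ] F) →L[ℝ] C(K, E) →L[ℝ] C(K, F) :=
  LinearMap.mkContinuous₂
    (LinearMap.mk₂ ℝ (fun (A : C(K, E →L[ℝ] F)) (h : C(K, E)) =>
      (⟨fun s => A s (h s), by fun_prop⟩ : C(K, F)))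
      (fun A B h => by ext s; simp) (fun c A h => by ext s; simp)
      (fun A h k => by ext s; simp) (fun c A h => by ext s; simp)) 1
    (fun A h => by
      rw [one_mul]
      refine (ContinuousMap.norm_le _ (by positivity)).2 fun s => ?_
      exact ((A s).le_opNorm _).trans (by gcongr <;> apply ContinuousMap.norm_coe_le_norm))

@[simp] theorem pointwiseCLM_apply (A : C(K, E →L[ℝ] F)) (h : C(K, E)) (s : K) :
    pointwiseCLM K E F A h s = A s (h s) := rfl

theorem contDiff_pointwiseCLM {n : WithTop ℕ∞} :
    ContDiff ℝ n (fun A : C(K, E →L[ℝ] F) => pointwiseCLM K E F A) :=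
  IsBoundedLinearMap.contDiff
    { map_add := map_add _
      map_smul := map_smul _
      bound := ⟨1, one_pos, fun A => ContinuousLinearMap.opNorm_le_bound _ (by positivity) fun h =>
        (ContinuousMap.norm_le _ (by positivity)).2 fun s => by
          rw [one_mul]
          exact ((A s).le_opNorm _).trans
            (by gcongr <;> apply ContinuousMap.norm_coe_le_norm)⟩ }

theorem hasFDerivAt_postcomp {V : E → F} {V' : E → E →L[ℝ] F} (hV' : Continuous V')
    (h : ∀ x, HasFDerivAt V (V' x) x) (hV : Continuous V) (γ : C(K, E)) :
    HasFDerivAt (fun γ : C(K, E) => (⟨V, hV⟩ : C(E, F)).comp γ)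
      (pointwiseCLM K E F ((⟨V', hV'⟩ : C(E, E →L[ℝ] F)).comp γ)) γ := by
  rw [hasFDerivAt_iff_isLittleO_nhds_zero, Asymptotics.isLittleO_iff]
  intro ε hε
  have hc : Continuous (fun γ : C(K, E) => (⟨V', hV'⟩ : C(E, E →L[ℝ] F)).comp γ) :=
    ContinuousMap.continuous_postcomp _
  obtain ⟨δ, hδ, hδ'⟩ := (Metric.continuous_iff (α := C(K, E)) (β := C(K, E →L[ℝ] F))).1 hc γ ε hε
  filter_upwards [Metric.ball_mem_nhds (0 : C(K, E)) hδ] with η hη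
  rw [mem_ball_zero_iff] at hη
  refine (ContinuousMap.norm_le _ (by positivity)).2 fun s => ?_
  -- the derivative of `V` varies by less than `ε` on the ball about `γ s`: shift `γ` by a constant
  have key : ∀ y ∈ Metric.ball (γ s) δ, ‖V' y - V' (γ s)‖ ≤ ε := by
    intro y hy
    rw [mem_ball_iff_norm] at hy
    have h1 : dist (γ + ContinuousMap.const K (y - γ s)) γ < δ := by
      rw [dist_eq_norm, add_sub_cancel_left]
      exact ((ContinuousMap.norm_le _ (norm_nonneg _)).2 fun _ => le_rfl).trans_lt hy
    have h2 := (ContinuousMap.dist_lt_iff hε).1 (hδ' _ h1) s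
    simp only [comp_apply, coe_mk, add_apply, const_apply, add_sub_cancel] at h2
    rw [← dist_eq_norm]
    exact h2.le
  have hs : γ s + η s ∈ Metric.ball (γ s) δ := by
    rw [mem_ball_iff_norm, add_sub_cancel_left]
    exact (η.norm_coe_le_norm s).trans_lt hη
  have h3 := (convex_ball (γ s) δ).norm_image_sub_le_of_norm_hasFDerivWithin_le'
    (fun y _ => (h y).hasFDerivWithinAt) key (Metric.mem_ball_self hδ) hs
  rw [add_sub_cancel_left] at h3
  refine h3.trans ?_
  gcongr
  exact η.norm_coe_le_norm s

/-- The substitution operator `γ ↦ V ∘ γ` on a space of continuous functions is as smooth as `V`. -/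
theorem contDiff_postcomp (n : ℕ) : ∀ {E F : Type u} [NormedAddCommGroup E] [NormedSpace ℝ E]
    [NormedAddCommGroup F] [NormedSpace ℝ F] {V : E → F} (_ : ContDiff ℝ n V) (hc : Continuous V),
    ContDiff ℝ n (fun γ : C(K, E) => (⟨V, hc⟩ : C(E, F)).comp γ) := by
  induction n with
  | zero =>
    intro E F _ _ _ _ V hV hc
    exact contDiff_zero.2 (ContinuousMap.continuous_postcomp _)
  | succ n ih =>
    intro E F _ _ _ _ V hV hc
    have h1 : ContDiff ℝ n (fderiv ℝ V) := hV.fderiv_right (by norm_cast)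
    have h2 := ih h1 h1.continuous
    have h3 : ∀ x, HasFDerivAt V (fderiv ℝ V x) x := fun x =>
      (hV.differentiable (by simp) x).hasFDerivAt
    push_cast
    rw [contDiff_succ_iff_hasFDerivAt]
    have h4 : ContDiff ℝ n (fun γ : C(K, E) => pointwiseCLM K E F
        ((⟨fderiv ℝ V, h1.continuous⟩ : C(E, E →L[ℝ] F)).comp γ)) :=
      contDiff_pointwiseCLM.comp h2
    exact ⟨_, h4, fun γ => hasFDerivAt_postcomp h1.continuous h3 hc γ⟩

end ContinuousMap

section LocalFlow

open Set

variable {E : Type*} [NormedAddCommGroup E] [NormedSpace ℝ E]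

/-- The primitive vanishing at `0` of a continuous function on `[-2, 2]`. -/
noncomputable def primitiveCLM (E : Type*) [NormedAddCommGroup E] [NormedSpace ℝ E] :
    C(Icc (-2 : ℝ) 2, E) →L[ℝ] C(Icc (-2 : ℝ) 2, E) :=
  LinearMap.mkContinuous
    { toFun := fun g => ⟨fun s => ∫ r in (0 : ℝ)..s, IccExtend (by norm_num) g r, by
        have h : Continuous (IccExtend (by norm_num : (-2 : ℝ) ≤ 2) g) :=
          g.continuous.Icc_extend'
        exact (intervalIntegral.continuous_primitive (fun a b => h.intervalIntegrable a b) 0).comp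
          continuous_subtype_val⟩
      map_add' := fun g k => by
        ext s
        have h : ∀ g : C(Icc (-2 : ℝ) 2, E), Continuous (IccExtend (by norm_num : (-2 : ℝ) ≤ 2) g) :=
          fun g => g.continuous.Icc_extend'
        exact intervalIntegral.integral_add ((h g).intervalIntegrable _ _)
          ((h k).intervalIntegrable _ _)
      map_smul' := fun c g => by
        ext s
        exact intervalIntegral.integral_smul c _ } 2
    (fun g => by
      refine (ContinuousMap.norm_le _ (by positivity)).2 fun s => ?_
      have h := intervalIntegral.norm_integral_le_of_norm_le_const (a := 0) (b := (s : ℝ))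
        (f := IccExtend (by norm_num : (-2 : ℝ) ≤ 2) g) (C := ‖g‖)
        (fun r _ => g.norm_coe_le_norm _)
      refine h.trans ?_
      rw [mul_comm, sub_zero]
      gcongr
      exact abs_le.2 s.2)

theorem hasDerivAt_primitiveCLM [CompleteSpace E] (g : C(Icc (-2 : ℝ) 2, E)) {s : ℝ}
    (hs : s ∈ Ioo (-2 : ℝ) 2) :
    HasDerivAt (IccExtend (by norm_num : (-2 : ℝ) ≤ 2) (primitiveCLM E g))
      (IccExtend (by norm_num : (-2 : ℝ) ≤ 2) g s) s := by
  have h : Continuous (IccExtend (by norm_num : (-2 : ℝ) ≤ 2) g) := g.continuous.Icc_extend'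
  have h1 := intervalIntegral.integral_hasDerivAt_right (h.intervalIntegrable 0 s)
    (h.stronglyMeasurableAtFilter _ _) h.continuousAt
  refine h1.congr_of_eventuallyEq ?_
  filter_upwards [Ioo_mem_nhds hs.1 hs.2] with r hr
  rw [IccExtend_of_mem _ _ (Ioo_subset_Icc_self hr)]
  rfl

/-- The integral equation `γ(s) = y + t ∫₀ˢ V(γ)` has, for small `t`, a solution that depends smoothly on
`(t, y)`: by the inverse function theorem in the Banach space of continuous curves on `[-2, 2]`, since the
equation is solved by constant curves at `t = 0`. -/
theorem exists_solution_family [CompleteSpace E] {V : E → E} (hV : ContDiff ℝ ∞ V) (y₀ : E) :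
    ∃ Γ : ℝ × E → C(Icc (-2 : ℝ) 2, E), ContDiffAt ℝ ∞ Γ (0, y₀) ∧
      Γ (0, y₀) = ContinuousMap.const _ y₀ ∧
      ∀ᶠ p in 𝓝 (0, y₀), Γ p = ContinuousMap.const _ p.2 +
        p.1 • primitiveCLM E ((⟨V, hV.continuous⟩ : C(E, E)).comp (Γ p)) := by
  set Z := C(Icc (-2 : ℝ) 2, E)
  set N : Z → Z := fun γ => primitiveCLM E ((⟨V, hV.continuous⟩ : C(E, E)).comp γ) with hN
  have hNs : ContDiff ℝ ∞ N := (primitiveCLM E).contDiff.comp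
    (contDiff_infty.2 fun n => ContinuousMap.contDiff_postcomp n (contDiff_infty.1 hV n) _)
  -- invert `(t, y, γ) ↦ (t, y, γ - t N(γ))` at `t = 0`
  set Θ : (ℝ × E) × Z → (ℝ × E) × Z := fun z => (z.1, z.2 - z.1.1 • N z.2) with hΘ
  have hΘs : ContDiff ℝ ∞ Θ := by
    have := hNs.comp (contDiff_snd (𝕜 := ℝ) (E := ℝ × E) (F := Z))
    exact contDiff_fst.prodMk (contDiff_snd.sub ((contDiff_fst.comp contDiff_fst).smul this))
  set c₀ : Z := ContinuousMap.const _ y₀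
  set D : ((ℝ × E) × Z) ≃L[ℝ] ((ℝ × E) × Z) := ContinuousLinearEquiv.equivOfInverse
    ((ContinuousLinearMap.fst ℝ (ℝ × E) Z).prod (ContinuousLinearMap.snd ℝ (ℝ × E) Z -
      ((ContinuousLinearMap.fst ℝ ℝ E).comp (ContinuousLinearMap.fst ℝ (ℝ × E) Z)).smulRight
        (N c₀)))
    ((ContinuousLinearMap.fst ℝ (ℝ × E) Z).prod (ContinuousLinearMap.snd ℝ (ℝ × E) Z +
      ((ContinuousLinearMap.fst ℝ ℝ E).comp (ContinuousLinearMap.fst ℝ (ℝ × E) Z)).smulRight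
        (N c₀)))
    (fun z => by ext <;> simp) (fun z => by ext <;> simp)
  have hD : HasFDerivAt Θ (D : ((ℝ × E) × Z) →L[ℝ] ((ℝ × E) × Z)) ((0, y₀), c₀) := by
    have h1 : HasFDerivAt (fun z : (ℝ × E) × Z => z.1.1)
        ((ContinuousLinearMap.fst ℝ ℝ E).comp (ContinuousLinearMap.fst ℝ (ℝ × E) Z))
        ((0, y₀), c₀) := hasFDerivAt_fst.fst
    have h2 : HasFDerivAt (fun z : (ℝ × E) × Z => N z.2) ((fderiv ℝ N c₀).comp
        (ContinuousLinearMap.snd ℝ (ℝ × E) Z)) ((0, y₀), c₀) :=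
      HasFDerivAt.comp (𝕜 := ℝ) (g := N) ((0, y₀), c₀)
        (hNs.differentiable (by simp) c₀).hasFDerivAt hasFDerivAt_snd
    refine (hasFDerivAt_fst.prodMk (hasFDerivAt_snd.sub (h1.smul h2))).congr_fderiv ?_
    ext z <;> simp [D]
  set Ψ := hΘs.contDiffAt.localInverse hD (by simp) with hΨ
  have hΘ0 : Θ ((0, y₀), c₀) = ((0, y₀), c₀) := by simp [hΘ]
  have hΨs : ContDiffAt ℝ ∞ Ψ ((0, y₀), c₀) := by
    have := hΘs.contDiffAt.to_localInverse hD (by simp)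
    rwa [hΘ0] at this
  have hs : HasStrictFDerivAt Θ (D : ((ℝ × E) × Z) →L[ℝ] ((ℝ × E) × Z)) ((0, y₀), c₀) :=
    hΘs.contDiffAt.hasStrictFDerivAt' hD (by simp)
  have hr : ∀ᶠ w in 𝓝 ((0, y₀), c₀), Θ (Ψ w) = w := by
    have := hs.eventually_right_inverse
    rwa [hΘ0] at this
  have h0 : Ψ ((0, y₀), c₀) = ((0, y₀), c₀) := by
    have := hs.localInverse_apply_image
    rwa [hΘ0] at this
  set ι : ℝ × E → (ℝ × E) × Z := fun p => (p, ContinuousMap.const _ p.2) with hι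
  have hιs : ContDiff ℝ ∞ ι := by
    have : ContDiff ℝ ∞ (fun y : E => (ContinuousMap.const (Icc (-2 : ℝ) 2) y : Z)) :=
      IsBoundedLinearMap.contDiff (𝕜 := ℝ) (f := fun y : E => (ContinuousMap.const _ y : Z))
        { map_add := fun x y => rfl
          map_smul := fun c x => rfl
          bound := ⟨1, one_pos, fun y => (ContinuousMap.norm_le _ (by positivity)).2
            fun s => by simp⟩ }
    exact contDiff_id.prodMk (this.comp contDiff_snd)
  refine ⟨fun p => (Ψ (ι p)).2, ?_, ?_, ?_⟩
  · have : ContDiffAt ℝ ∞ Ψ (ι (0, y₀)) := hΨs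
    exact (this.comp (0, y₀) hιs.contDiffAt).snd
  · change (Ψ ((0, y₀), c₀)).2 = c₀
    rw [h0]
  · have hι0 : Filter.Tendsto ι (𝓝 (0, y₀)) (𝓝 ((0, y₀), c₀)) := hιs.continuous.tendsto _
    filter_upwards [hι0.eventually hr] with p hp
    have hp1 : (Ψ (ι p)).1 = p := congrArg Prod.fst hp
    have hp2 : (Ψ (ι p)).2 - (Ψ (ι p)).1.1 • N (Ψ (ι p)).2 = ContinuousMap.const _ p.2 :=
      congrArg Prod.snd hp
    rw [hp1] at hp2
    rw [← hp2, sub_add_cancel]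

/-- The time-one map of `t V`, jointly in `t` and the initial point, is smooth where `t` is small.
The integral curves `c` are kept along, for comparison with other integral curves. -/
theorem exists_local_flow [FiniteDimensional ℝ E] {V : E → E} {U : Set E} (hU : IsOpen U)
    (hV : ContDiffOn ℝ ∞ V U) {y₀ : E} (hy₀ : y₀ ∈ U) :
    ∃ Γ : ℝ × E → E, ContDiffAt ℝ ∞ Γ (0, y₀) ∧
      ∀ᶠ p in 𝓝 (0, y₀), ∃ c : ℝ → E, c 0 = p.2 ∧ c 1 = Γ p ∧
        ∀ s ∈ Ioo (-2 : ℝ) 2, c s ∈ U ∧ HasDerivAt c (p.1 • V (c s)) s := by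
  have : CompleteSpace E := FiniteDimensional.complete ℝ E
  obtain ⟨r, hr, hrU⟩ := Metric.isOpen_iff.1 hU y₀ hy₀
  let b : ContDiffBump y₀ := ⟨r / 4, r / 2, by positivity, by linarith⟩
  have hW : ContDiff ℝ ∞ (fun y => b y • V y) := by
    rw [contDiff_iff_contDiffAt]
    intro y
    by_cases hy : y ∈ tsupport b
    · have hyU : y ∈ U := by
        rw [b.tsupport_eq] at hy
        exact hrU (Metric.closedBall_subset_ball (by simp only [b]; linarith) hy)
      exact b.contDiffAt.smul (hV.contDiffAt (hU.mem_nhds hyU))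
    · have : (fun y => b y • V y) =ᶠ[𝓝 y] fun _ => 0 := by
        filter_upwards [(isClosed_tsupport b).isOpen_compl.mem_nhds hy] with z hz
        rw [image_eq_zero_of_notMem_tsupport hz, zero_smul]
      exact contDiffAt_const.congr_of_eventuallyEq this
  obtain ⟨Γ, hΓ, hΓ0, hΓe⟩ := exists_solution_family hW y₀
  have h1 : (1 : ℝ) ∈ Icc (-2 : ℝ) 2 := by norm_num
  have h0 : (0 : ℝ) ∈ Icc (-2 : ℝ) 2 := by norm_num
  refine ⟨fun p => Γ p ⟨1, h1⟩, ?_, ?_⟩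
  · exact ((ContinuousMap.evalCLM ℝ (⟨1, h1⟩ : Icc (-2 : ℝ) 2)).contDiff.contDiffAt (n := ∞)).comp
      (0, y₀) hΓ
  · have hclose : ∀ᶠ p in 𝓝 (0, y₀), dist (Γ p) (Γ (0, y₀)) < r / 4 :=
      (Metric.continuousAt_iff'.1 hΓ.continuousAt) _ (by positivity)
    filter_upwards [hΓe, hclose] with p hp hpc
    have hmem : ∀ s, Γ p s ∈ Metric.ball y₀ (r / 4) := fun s => by
      rw [hΓ0] at hpc
      exact (ContinuousMap.dist_lt_iff (by positivity)).1 hpc s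
    refine ⟨IccExtend (by norm_num : (-2 : ℝ) ≤ 2) (Γ p), ?_, ?_, fun s hs => ⟨?_, ?_⟩⟩
    · rw [IccExtend_of_mem _ _ h0, hp]
      simp [primitiveCLM]
    · rw [IccExtend_of_mem _ _ h1]
    · exact hrU (Metric.ball_subset_ball (by linarith) (hmem _))
    · have hd := (hasDerivAt_primitiveCLM
        ((⟨_, hW.continuous⟩ : C(E, E)).comp (Γ p)) hs).const_smul p.1 |>.const_add p.2
      have hval : IccExtend (by norm_num : (-2 : ℝ) ≤ 2)
          ((⟨_, hW.continuous⟩ : C(E, E)).comp (Γ p)) s =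
          V (IccExtend (by norm_num : (-2 : ℝ) ≤ 2) (Γ p) s) := by
        simp only [IccExtend, Function.comp_apply, ContinuousMap.comp_apply, ContinuousMap.coe_mk]
        rw [b.one_of_mem_closedBall (Metric.ball_subset_closedBall (hmem _)), one_smul]
      rw [hval] at hd
      refine hd.congr_of_eventuallyEq (Filter.Eventually.of_forall fun s => ?_)
      simp only [IccExtend, Function.comp_apply]
      conv_lhs => rw [hp]
      rfl

end LocalFlow

/-! ### Charts, vector fields and flows -/

namespace Symp

open MeasureTheory Set Bundle

section Charts

variable {E : Type*} [NormedAddCommGroup E] [NormedSpace ℝ E]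
  {H : Type*} [TopologicalSpace H] {I : ModelWithCorners ℝ E H} [I.Boundaryless]
  {N : Type*} [TopologicalSpace N] [ChartedSpace H N] [IsManifold I ∞ N]

theorem isManifold_one : IsManifold I 1 N := IsManifold.of_le (n := ∞) (by simp)

theorem hasMFDerivAt_chart_symm (x₀ : N) {y : E} (hy : y ∈ (extChartAt I x₀).target) :
    HasMFDerivAt 𝓘(ℝ, E) I (extChartAt I x₀).symm y
      (mfderiv 𝓘(ℝ, E) I (extChartAt I x₀).symm y) := by
  have := isManifold_one (I := I) (N := N)
  have h := mdifferentiableWithinAt_extChartAt_symm hy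
  rw [I.range_eq_univ, mdifferentiableWithinAt_univ] at h
  exact h.hasMFDerivAt

theorem mfderiv_chart_symm_comp (x₀ : N) {y : E} (hy : y ∈ (extChartAt I x₀).target)
    (v : TangentSpace I ((extChartAt I x₀).symm y)) :
    mfderiv 𝓘(ℝ, E) I (extChartAt I x₀).symm y
      (mfderiv I 𝓘(ℝ, E) (extChartAt I x₀) ((extChartAt I x₀).symm y) v) = v := by
  have := isManifold_one (I := I) (N := N)
  have h := mfderivWithin_extChartAt_symm_comp_mfderiv_extChartAt hy
  rw [I.range_eq_univ, mfderivWithin_univ] at h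
  exact DFunLike.congr_fun h v

theorem mfderiv_chart_comp_symm (x₀ : N) {y : E} (hy : y ∈ (extChartAt I x₀).target)
    (v : TangentSpace 𝓘(ℝ, E) y) :
    mfderiv I 𝓘(ℝ, E) (extChartAt I x₀) ((extChartAt I x₀).symm y)
      (mfderiv 𝓘(ℝ, E) I (extChartAt I x₀).symm y v) = v := by
  have := isManifold_one (I := I) (N := N)
  have h := mfderiv_extChartAt_comp_mfderivWithin_extChartAt_symm hy
  rw [I.range_eq_univ, mfderivWithin_univ] at h
  exact DFunLike.congr_fun h v

theorem mfderiv_chart_symm_self (x₀ : N) (v : TangentSpace 𝓘(ℝ, E) (extChartAt I x₀ x₀)) :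
    mfderiv 𝓘(ℝ, E) I (extChartAt I x₀).symm (extChartAt I x₀ x₀) v = v := by
  have := isManifold_one (I := I) (N := N)
  have h := mfderivWithin_range_extChartAt_symm (I := I) (x := x₀)
  rw [I.range_eq_univ, mfderivWithin_univ] at h
  exact DFunLike.congr_fun h v

/-- The expression of a vector field in the chart centred at `x₀`. -/
noncomputable def VectorField.inChart (X : VectorField I N) (x₀ : N) (y : E) : E :=
  mfderiv I 𝓘(ℝ, E) (extChartAt I x₀) ((extChartAt I x₀).symm y) (X ((extChartAt I x₀).symm y))

theorem VectorField.mfderiv_inChart (X : VectorField I N) (x₀ : N) {y : E}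
    (hy : y ∈ (extChartAt I x₀).target) :
    mfderiv 𝓘(ℝ, E) I (extChartAt I x₀).symm y (X.inChart x₀ y) = X ((extChartAt I x₀).symm y) :=
  mfderiv_chart_symm_comp x₀ hy _

theorem VectorField.isSmooth_iff (X : VectorField I N) :
    X.IsSmooth ↔ ∀ x₀ : N, ContDiffOn ℝ ∞ (X.inChart x₀) (extChartAt I x₀).target := by
  have := isManifold_one (I := I) (N := N)
  have key : ∀ x₀ : N, ∀ x ∈ (chartAt H x₀).source,
      (trivializationAt E (TangentSpace I : N → Type _) x₀ ⟨x, X x⟩).2 =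
        mfderiv I 𝓘(ℝ, E) (extChartAt I x₀) x (X x) := by
    intro x₀ x hx
    have h := DFunLike.congr_fun
      (TangentBundle.continuousLinearMapAt_trivializationAt (I := I) (𝕜 := ℝ) hx) (X x)
    exact ((trivializationAt E (TangentSpace I : N → Type _) x₀).continuousLinearMapAt_apply_of_mem
      (R := ℝ) (by simpa using hx) (X x)).symm.trans h
  have hiff : ∀ x₀ : N, ContMDiffOn I I.tangent ∞ (fun x => (⟨x, X x⟩ : TangentBundle I N))
      (chartAt H x₀).source ↔ ContDiffOn ℝ ∞ (X.inChart x₀) (extChartAt I x₀).target := by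
    intro x₀
    have h1 := (trivializationAt E (TangentSpace I : N → Type _) x₀).contMDiffOn_section_iff
      (IB := I) (n := ∞) (s := X) (a := (chartAt H x₀).source) (chartAt H x₀).open_source
      (by simp)
    have h2 : ContMDiffOn I 𝓘(ℝ, E) ∞
        (fun x => (trivializationAt E (TangentSpace I : N → Type _) x₀ ⟨x, X x⟩).2)
        (chartAt H x₀).source ↔ ContDiffOn ℝ ∞ (X.inChart x₀) (extChartAt I x₀).target := by
      constructor
      · intro h
        have h3 := h.comp (contMDiffOn_extChartAt_symm x₀) (fun z hz => by
          have := (extChartAt I x₀).map_target hz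
          rwa [extChartAt_source] at this)
        refine h3.contDiffOn.congr fun y hy => ?_
        have := (extChartAt I x₀).map_target hy
        rw [extChartAt_source] at this
        exact (key x₀ _ this).symm
      · intro h
        have h3 := h.contMDiffOn.comp (contMDiffOn_extChartAt (I := I) (n := ∞) (x := x₀))
          (fun z hz => by
            rw [← extChartAt_source I] at hz
            exact (extChartAt I x₀).map_source hz)
        refine h3.congr fun x hx => ?_
        rw [key x₀ x hx]
        rw [← extChartAt_source I] at hx
        simp only [VectorField.inChart, Function.comp_apply]
        rw [(extChartAt I x₀).left_inv hx]
    exact h1.trans h2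
  constructor
  · intro h x₀
    exact (hiff x₀).1 (ContMDiff.contMDiffOn h)
  · intro h x₀
    exact ((hiff x₀).2 (h x₀)).contMDiffAt ((chartAt H x₀).open_source.mem_nhds
      (mem_chart_source H x₀))

end Charts

section Flow

variable {E : Type*} [NormedAddCommGroup E] [NormedSpace ℝ E]
  {H : Type*} [TopologicalSpace H] {I : ModelWithCorners ℝ E H} [I.Boundaryless]
  {N : Type*} [TopologicalSpace N] [ChartedSpace H N] [IsManifold I ∞ N] [T2Space N]

theorem VectorField.IsSmooth.one {X : VectorField I N} (hX : X.IsSmooth) :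
    ContMDiff I I.tangent 1 (fun x => (⟨x, X x⟩ : TangentBundle I N)) :=
  ContMDiff.of_le (m := 1) (n := ∞) hX (by simp)

theorem IsFlow.eq_of_isMIntegralCurve {X : VectorField I N} (hX : X.IsSmooth) {φ : ℝ → N → N}
    (hφ : IsFlow X φ) {γ : ℝ → N} (hγ : IsMIntegralCurve γ X) (t : ℝ) : γ t = φ t (γ 0) := by
  have := isManifold_one (I := I) (N := N)
  have h := isMIntegralCurve_Ioo_eq_of_contMDiff_boundaryless (t₀ := 0) hX.one hγ (hφ.2 (γ 0))
    (hφ.1 _).symm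
  exact congrFun h t

theorem IsFlow.add {X : VectorField I N} (hX : X.IsSmooth) {φ : ℝ → N → N}
    (hφ : IsFlow X φ) (s t : ℝ) (x : N) : φ (s + t) x = φ s (φ t x) := by
  have h := hφ.eq_of_isMIntegralCurve hX ((hφ.2 x).comp_add t) s
  simpa using h

theorem IsFlow.neg_apply {X : VectorField I N} (hX : X.IsSmooth) {φ : ℝ → N → N}
    (hφ : IsFlow X φ) (t : ℝ) (x : N) : φ (-t) (φ t x) = x := by
  rw [← hφ.add hX, neg_add_cancel, hφ.1]

theorem IsFlow.apply_neg {X : VectorField I N} (hX : X.IsSmooth) {φ : ℝ → N → N}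
    (hφ : IsFlow X φ) (t : ℝ) (x : N) : φ t (φ (-t) x) = x := by
  rw [← hφ.add hX, add_neg_cancel, hφ.1]

theorem IsFlow.eq_self {X : VectorField I N} (hX : X.IsSmooth) {φ : ℝ → N → N}
    (hφ : IsFlow X φ) {x : N} (hx : X x = 0) (t : ℝ) : φ t x = x :=
  (hφ.eq_of_isMIntegralCurve hX (isMIntegralCurve_const hx) t).symm

variable [FiniteDimensional ℝ E]

/-- Local integral curves of `t X`, on a fixed interval of time and for small `t`, with time-one values
depending smoothly on `t` and the initial point: `exists_local_flow` in a chart. -/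
theorem VectorField.IsSmooth.exists_local_flow {X : VectorField I N} (hX : X.IsSmooth) (x₀ : N) :
    ∃ Γ : ℝ × N → N, ContMDiffAt (𝓘(ℝ, ℝ).prod I) I ∞ Γ (0, x₀) ∧
      ∀ᶠ z in 𝓝 ((0 : ℝ), x₀), ∃ γ : ℝ → N, γ 0 = z.2 ∧ γ 1 = Γ z ∧
        IsMIntegralCurveOn γ (z.1 • X) (Ioo (-2 : ℝ) 2) := by
  have := isManifold_one (I := I) (N := N)
  obtain ⟨Γ, hΓ, hΓe⟩ := _root_.exists_local_flow (isOpen_extChartAt_target (I := I) x₀)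
    (X.isSmooth_iff.1 hX x₀) (mem_extChartAt_target (I := I) x₀)
  set j : ℝ × N → ℝ × E := fun z => (z.1, extChartAt I x₀ z.2) with hj
  have hjs : ContMDiffAt (𝓘(ℝ, ℝ).prod I) 𝓘(ℝ, ℝ × E) ∞ j (0, x₀) := by
    refine (contMDiffAt_fst (I := 𝓘(ℝ, ℝ))).prodMk_space ?_
    exact ContMDiffAt.comp (I' := I) (0, x₀) (contMDiffAt_extChartAt (x := x₀))
      contMDiffAt_snd
  refine ⟨fun z => (extChartAt I x₀).symm (Γ (j z)), ?_, ?_⟩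
  · obtain ⟨c, hc0, hc1, hc⟩ := hΓe.self_of_nhds
    have hmem : Γ (j (0, x₀)) ∈ (extChartAt I x₀).target := by
      have := (hc 1 (by norm_num)).1
      rwa [hc1] at this
    have h4 : ContMDiffAt 𝓘(ℝ, E) I ∞ (extChartAt I x₀).symm (Γ (j (0, x₀))) :=
      (contMDiffOn_extChartAt_symm x₀).contMDiffAt
        ((isOpen_extChartAt_target x₀).mem_nhds hmem)
    have h5 : ContMDiffAt (𝓘(ℝ, ℝ).prod I) 𝓘(ℝ, E) ∞ (fun z => Γ (j z)) (0, x₀) :=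
      ContMDiffAt.comp (I' := 𝓘(ℝ, ℝ × E)) (g := Γ) (f := j) (0, x₀) hΓ.contMDiffAt hjs
    exact ContMDiffAt.comp (g := (extChartAt I x₀).symm) (f := fun z => Γ (j z)) (0, x₀) h4 h5
  · have h1 : ∀ᶠ z in 𝓝 ((0 : ℝ), x₀), z.2 ∈ (extChartAt I x₀).source :=
      continuousAt_snd.eventually (extChartAt_source_mem_nhds (I := I) x₀)
    filter_upwards [hjs.continuousAt.eventually hΓe, h1] with z hz hzs
    obtain ⟨c, hc0, hc1, hc⟩ := hz
    refine ⟨fun s => (extChartAt I x₀).symm (c s), ?_, ?_, ?_⟩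
    · dsimp only
      rw [hc0, (extChartAt I x₀).left_inv hzs]
    · dsimp only
      rw [hc1]
    · intro s hs
      obtain ⟨hcs, hcd⟩ := hc s hs
      have h2 : HasMFDerivAt 𝓘(ℝ, ℝ) 𝓘(ℝ, E) c s
          ((1 : ℝ →L[ℝ] ℝ).smulRight (z.1 • X.inChart x₀ (c s))) := hcd.hasFDerivAt.hasMFDerivAt
      have h3 := (hasMFDerivAt_chart_symm x₀ hcs).comp s h2
      refine (h3.congr_mfderiv ?_).hasMFDerivWithinAt
      ext
      have hL : ∀ (L : E →L[ℝ] E) (w w' : E), L w = w' →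
          L ((1 : ℝ) • (z.1 • w)) = (1 : ℝ) • (z.1 • w') := fun L w w' h => by
        rw [map_smul, map_smul, h]
      exact hL _ _ _ (VectorField.mfderiv_inChart X x₀ hcs)

theorem IsFlow.contMDiffAt_zero {X : VectorField I N} (hX : X.IsSmooth) {φ : ℝ → N → N}
    (hφ : IsFlow X φ) (x₀ : N) :
    ContMDiffAt (𝓘(ℝ, ℝ).prod I) I ∞ (fun z : ℝ × N => φ z.1 z.2) (0, x₀) := by
  have := isManifold_one (I := I) (N := N)
  obtain ⟨Γ, hΓ, hΓe⟩ := hX.exists_local_flow x₀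
  refine hΓ.congr_of_eventuallyEq ?_
  filter_upwards [hΓe] with z hz
  obtain ⟨γ, hγ0, hγ1, hγ⟩ := hz
  have hφc : IsMIntegralCurveOn ((fun s => φ s z.2) ∘ (· * z.1)) (z.1 • X)
      (Ioo (-2 : ℝ) 2) := ((hφ.2 z.2).comp_mul z.1).isMIntegralCurveOn _
  have hXs : ContMDiff I I.tangent 1 (fun x => (⟨x, (z.1 • X) x⟩ : TangentBundle I N)) :=
    ContMDiff.const_smul_section hX.one
  have h := isMIntegralCurveOn_Ioo_eqOn_of_contMDiff_boundaryless (t₀ := 0) (by norm_num)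
    hXs hφc hγ (by
      simp only [Function.comp_apply, zero_mul]
      rw [hφ.1, hγ0])
  have h1 := h (x := 1) (by norm_num)
  simpa [hγ1] using h1

/-- The flow of a complete smooth vector field is smooth in time and space jointly. -/
theorem IsFlow.contMDiff {X : VectorField I N} (hX : X.IsSmooth) {φ : ℝ → N → N}
    (hφ : IsFlow X φ) : ContMDiff (𝓘(ℝ, ℝ).prod I) I ∞ (fun z : ℝ × N => φ z.1 z.2) := by
  rw [contMDiff_infty]
  rintro n ⟨t₀, x₀⟩
  have : IsManifold I n N := IsManifold.of_le (n := ∞) (by exact_mod_cast le_top)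
  -- the times at which the flow is `C^n` near `x₀` form an open and closed set
  set J : Set ℝ := {t | ContMDiffAt (𝓘(ℝ, ℝ).prod I) I n (fun z : ℝ × N => φ z.1 z.2) (t, x₀)}
    with hJ
  have hev : ∀ (t : ℝ) (x : N), ContMDiffAt (𝓘(ℝ, ℝ).prod I) I n
      (fun z : ℝ × N => φ z.1 z.2) (t, x) → ∀ᶠ z in 𝓝 (t, x),
        ContMDiffAt (𝓘(ℝ, ℝ).prod I) I n (fun z : ℝ × N => φ z.1 z.2) z := fun t x h =>
    (contMDiffAt_iff_contMDiffAt_nhds (by simp)).1 h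
  have h0 : ∀ x, ContMDiffAt (𝓘(ℝ, ℝ).prod I) I n (fun z : ℝ × N => φ z.1 z.2) (0, x) :=
    fun x => (hφ.contMDiffAt_zero hX x).of_le (by exact_mod_cast le_top)
  have hopen : IsOpen J := by
    rw [isOpen_iff_mem_nhds]
    intro t ht
    have : Filter.Tendsto (fun s : ℝ => (s, x₀)) (𝓝 t) (𝓝 (t, x₀)) :=
      (Continuous.prodMk_left x₀).tendsto t
    exact this.eventually (hev t x₀ ht)
  have hclosed : IsClosed J := by
    rw [← closure_subset_iff_isClosed]
    intro t₁ ht₁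
    have h1 := hev 0 (φ t₁ x₀) (h0 _)
    have hcont : Continuous (fun t => φ t x₀) := (hφ.2 x₀).continuous
    have h2 : Filter.Tendsto (fun t : ℝ => (t₁ - t, φ t x₀)) (𝓝 t₁) (𝓝 (0, φ t₁ x₀)) := by
      have : Continuous (fun t : ℝ => (t₁ - t, φ t x₀)) := by fun_prop
      simpa using this.tendsto t₁
    obtain ⟨t, ht, htJ⟩ := mem_closure_iff_nhds.1 ht₁ _ (h2.eventually h1)
    have hcomp : ContMDiffAt (𝓘(ℝ, ℝ).prod I) I n
        (fun z : ℝ × N => φ (z.1 - t) (φ t z.2)) (t₁, x₀) := by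
      have h3 : ContMDiffAt (𝓘(ℝ, ℝ).prod I) I n (fun z : ℝ × N => φ t z.2) (t₁, x₀) :=
        ContMDiffAt.comp (I' := 𝓘(ℝ, ℝ).prod I) (t₁, x₀) (f := fun z : ℝ × N => (t, z.2)) htJ
          (contMDiffAt_const.prodMk contMDiffAt_snd)
      have h4 : ContMDiffAt (𝓘(ℝ, ℝ).prod I) 𝓘(ℝ, ℝ) n (fun z : ℝ × N => z.1 - t) (t₁, x₀) :=
        contMDiffAt_fst.sub contMDiffAt_const
      exact ContMDiffAt.comp (I' := 𝓘(ℝ, ℝ).prod I) (t₁, x₀)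
        (f := fun z : ℝ × N => (z.1 - t, φ t z.2)) ht (h4.prodMk h3)
    refine hcomp.congr_of_eventuallyEq (Filter.Eventually.of_forall fun z => ?_)
    dsimp only
    rw [← hφ.add hX, sub_add_cancel]
  have huniv : J = univ := IsClopen.eq_univ ⟨hclosed, hopen⟩ ⟨0, h0 x₀⟩
  have : t₀ ∈ J := huniv ▸ mem_univ t₀
  exact this

theorem IsFlow.contMDiff_apply {X : VectorField I N} (hX : X.IsSmooth) {φ : ℝ → N → N}
    (hφ : IsFlow X φ) (t : ℝ) : ContMDiff I I ∞ (φ t) :=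
  (hφ.contMDiff hX).comp (contMDiff_const.prodMk contMDiff_id)

theorem IsFlow.continuous {X : VectorField I N} (hX : X.IsSmooth) {φ : ℝ → N → N}
    (hφ : IsFlow X φ) : Continuous (fun z : ℝ × N => φ z.1 z.2) := (hφ.contMDiff hX).continuous

theorem VectorField.IsSmooth.add {X Y : VectorField I N} (hX : X.IsSmooth) (hY : Y.IsSmooth) :
    VectorField.IsSmooth (fun x => X x + Y x) := ContMDiff.add_section hX hY

/-- The integral curves through the points of a compact set are defined on a common interval. -/
theorem VectorField.IsSmooth.exists_uniform_time {X : VectorField I N} (hX : X.IsSmooth)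
    {K : Set N} (hK : IsCompact K) : ∃ ε > 0, ∀ x ∈ K, ∃ γ : ℝ → N, γ 0 = x ∧
      IsMIntegralCurveOn γ X (Ioo (-ε) ε) := by
  have hloc : ∀ x₀ : N, ∃ ε > 0, ∀ᶠ x in 𝓝 x₀, ∃ γ : ℝ → N, γ 0 = x ∧
      IsMIntegralCurveOn γ X (Ioo (-ε) ε) := by
    intro x₀
    obtain ⟨Γ, -, hΓe⟩ := hX.exists_local_flow x₀
    rw [nhds_prod_eq] at hΓe
    have h1 := hΓe.curry
    obtain ⟨δ, hδ, hδ'⟩ := Metric.eventually_nhds_iff.1 h1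
    refine ⟨δ, hδ, ?_⟩
    have h2 := hδ' (y := δ / 2) (by rw [Real.dist_eq, sub_zero, abs_of_pos] <;> linarith)
    filter_upwards [h2] with x hx
    obtain ⟨γ, hγ0, -, hγ⟩ := hx
    refine ⟨γ ∘ (· * (δ / 2)⁻¹), by simpa using hγ0, ?_⟩
    have h3 := (hγ.comp_mul (δ / 2)⁻¹)
    rw [smul_smul, inv_mul_cancel₀ (by positivity), one_smul] at h3
    refine h3.mono fun s hs => ?_
    simp only [mem_ofPred_eq, mem_Ioo] at hs ⊢
    rw [← div_eq_mul_inv, lt_div_iff₀ (by positivity), div_lt_iff₀ (by positivity)]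
    constructor <;> linarith [hs.1, hs.2]
  refine hK.induction_on (p := fun K => ∃ ε > 0, ∀ x ∈ K, ∃ γ : ℝ → N, γ 0 = x ∧
      IsMIntegralCurveOn γ X (Ioo (-ε) ε)) ⟨1, one_pos, by simp⟩ ?_ ?_ ?_
  · rintro s t hst ⟨ε, hε, h⟩
    exact ⟨ε, hε, fun x hx => h x (hst hx)⟩
  · rintro s t ⟨ε, hε, h⟩ ⟨δ, hδ, h'⟩
    refine ⟨min ε δ, lt_min hε hδ, ?_⟩
    rintro x (hx | hx)
    · obtain ⟨γ, h0, hγ⟩ := h x hx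
      exact ⟨γ, h0, hγ.mono (Ioo_subset_Ioo (neg_le_neg (min_le_left _ _)) (min_le_left _ _))⟩
    · obtain ⟨γ, h0, hγ⟩ := h' x hx
      exact ⟨γ, h0, hγ.mono (Ioo_subset_Ioo (neg_le_neg (min_le_right _ _)) (min_le_right _ _))⟩
  · intro x _
    obtain ⟨ε, hε, h⟩ := hloc x
    exact ⟨_, mem_nhdsWithin_of_mem_nhds h, ε, hε, fun y hy => hy⟩

/-- A compactly supported perturbation of a complete vector field is complete. -/
theorem IsFlow.exists_isFlow_add {X W : VectorField I N} (hX : X.IsSmooth) (hW : W.IsSmooth)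
    {S : ℝ → N → N} (hS : IsFlow X S) {K : Set N} (hK : IsCompact K) (hWK : ∀ x ∉ K, W x = 0) :
    ∃ φ : ℝ → N → N, IsFlow (fun x => X x + W x) φ := by
  have := isManifold_one (I := I) (N := N)
  have hXW := hX.add hW
  -- outside the sweep of `K` during the times `[-1, 1]`, the flow `S` does not meet `K`
  have hK' : IsCompact ((fun z : ℝ × N => S z.1 z.2) '' (Icc (-1 : ℝ) 1 ×ˢ K)) :=
    (isCompact_Icc.prod hK).image (hS.continuous hX)
  obtain ⟨ε, hε, h⟩ := hXW.exists_uniform_time hK'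
  have hglob : ∀ x, ∃ γ : ℝ → N, γ 0 = x ∧ IsMIntegralCurve γ (fun x => X x + W x) := by
    refine exists_isMIntegralCurve_of_isMIntegralCurveOn hXW.one (lt_min hε one_pos) fun x => ?_
    by_cases hx : x ∈ (fun z : ℝ × N => S z.1 z.2) '' (Icc (-1 : ℝ) 1 ×ˢ K)
    · obtain ⟨γ, h0, hγ⟩ := h x hx
      exact ⟨γ, h0, hγ.mono (Ioo_subset_Ioo (neg_le_neg (min_le_left _ _)) (min_le_left _ _))⟩
    · refine ⟨fun t => S t x, hS.1 x, fun t ht => ?_⟩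
      have hnot : S t x ∉ K := by
        intro hmem
        refine hx ⟨(-t, S t x), ⟨⟨?_, ?_⟩, hmem⟩, hS.neg_apply hX t x⟩ <;>
          linarith [ht.1, ht.2, min_le_right ε 1]
      have hval : X (S t x) = X (S t x) + W (S t x) := by rw [hWK _ hnot, add_zero]
      exact ((hS.2 x t).congr_mfderiv (congrArg _ hval)).hasMFDerivWithinAt
  choose γ hγ0 hγ using hglob
  exact ⟨fun t x => γ x t, hγ0, hγ⟩

theorem VectorField.isSmooth_zero : VectorField.IsSmooth (fun _ => 0 : VectorField I N) :=
  contMDiff_zeroSection ℝ (TangentSpace I : N → Type _)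

/-- A compactly supported smooth vector field is complete. -/
theorem VectorField.IsSmooth.exists_isFlow {X : VectorField I N} (hX : X.IsSmooth)
    {K : Set N} (hK : IsCompact K) (hXK : ∀ x ∉ K, X x = 0) : ∃ φ : ℝ → N → N, IsFlow X φ := by
  have h0 : IsFlow (fun _ => 0 : VectorField I N) (fun _ x => x) :=
    ⟨fun _ => rfl, fun x => isMIntegralCurve_const rfl⟩
  obtain ⟨φ, hφ⟩ := h0.exists_isFlow_add VectorField.isSmooth_zero hX hK hXK
  refine ⟨φ, ?_⟩
  simpa only [zero_add] using hφ

end Flow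

end Symp

/-! ### Invariant measures as limits of time averages -/

section Averages

open MeasureTheory Set

variable {N : Type*} [TopologicalSpace N]

theorem intervalIntegral_shift_sub {u : ℝ → ℝ} (hu : Continuous u) (T t : ℝ) :
    (∫ s in (0 : ℝ)..T, u (s + t)) - ∫ s in (0 : ℝ)..T, u s =
      (∫ s in T..(T + t), u s) - ∫ s in (0 : ℝ)..t, u s := by
  rw [intervalIntegral.integral_comp_add_right, zero_add]
  have h := fun a b => hu.intervalIntegrable (μ := volume) a b
  rw [← intervalIntegral.integral_add_adjacent_intervals (h t T) (h T (T + t)),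
    ← intervalIntegral.integral_add_adjacent_intervals (h 0 t) (h t T)]
  ring

/-- Along an ultrafilter, the time averages of a flow along orbits in a compact invariant set `K`
converge to an invariant probability measure on `K`. The average of `h` over it is bounded below like
the time averages of `h`. -/
theorem exists_invariant_measure_of_averages [TopologicalSpace.MetrizableSpace N] [MeasurableSpace N]
    [BorelSpace N] {φ : ℝ → N → N} (hφ : Continuous (fun z : ℝ × N => φ z.1 z.2))
    (hadd : ∀ s t x, φ (s + t) x = φ s (φ t x)) {K : Set N} (hK : IsCompact K)
    (hφK : ∀ t, ∀ x ∈ K, φ t x ∈ K) {h : N → ℝ} (hh : Continuous h) {c : ℝ}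
    (H : ∀ n : ℕ, ∃ x ∈ K, c ≤ |((n : ℝ) + 1)⁻¹ * ∫ s in (0 : ℝ)..((n : ℝ) + 1), h (φ s x)|) :
    ∃ μ : Measure N, IsProbabilityMeasure μ ∧ μ Kᶜ = 0 ∧
      (∀ t, MeasurePreserving (φ t) μ μ) ∧ c ≤ |∫ x, h x ∂μ| := by
  have : CompactSpace K := isCompact_iff_compactSpace.1 hK
  choose x hxK hx using H
  have hφx : ∀ x, Continuous (fun t => φ t x) := fun x => by fun_prop
  set ψ : ℕ → ℝ → K := fun n s => ⟨φ s (x n), hφK s _ (hxK n)⟩ with hψ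
  have hψc : ∀ n, Continuous (ψ n) := fun n => (hφx (x n)).subtype_mk _
  -- the uniform probability measure on `[0, n + 1]`
  set lam : ℕ → Measure ℝ := fun n =>
    ENNReal.ofReal ((n : ℝ) + 1)⁻¹ • volume.restrict (Ioc 0 ((n : ℝ) + 1)) with hlam
  have hlamp : ∀ n, IsProbabilityMeasure (lam n) := fun n => ⟨by
    simp only [hlam, Measure.smul_apply, Measure.restrict_apply_univ, Real.volume_Ioc, sub_zero,
      smul_eq_mul]
    rw [← ENNReal.ofReal_mul (by positivity), inv_mul_cancel₀ (by positivity), ENNReal.ofReal_one]⟩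
  have hlami : ∀ n (u : ℝ → ℝ), ∫ s, u s ∂(lam n) =
      ((n : ℝ) + 1)⁻¹ * ∫ s in (0 : ℝ)..((n : ℝ) + 1), u s := fun n u => by
    rw [hlam, integral_smul_measure, intervalIntegral.integral_of_le (by positivity),
      ENNReal.toReal_ofReal (by positivity), smul_eq_mul]
  set ν : ℕ → ProbabilityMeasure K := fun n =>
    ⟨(lam n).map (ψ n), Measure.isProbabilityMeasure_map (hψc n).measurable.aemeasurable⟩ with hν
  have hνi : ∀ n (f : C(K, ℝ)), ∫ y, f y ∂(ν n : Measure K) =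
      ((n : ℝ) + 1)⁻¹ * ∫ s in (0 : ℝ)..((n : ℝ) + 1), f (ψ n s) := fun n f => by
    rw [← hlami]
    exact integral_map (hψc n).measurable.aemeasurable f.continuous.aestronglyMeasurable
  set U : Ultrafilter ℕ := Filter.hyperfilter ℕ
  obtain ⟨μ, -, hμ⟩ := isCompact_univ.ultrafilter_le_nhds (U.map ν) (by simp)
  have hμt : Filter.Tendsto ν U (𝓝 μ) := hμ
  rw [ProbabilityMeasure.tendsto_iff_forall_integral_tendsto] at hμt
  have hlim : ∀ f : C(K, ℝ), Filter.Tendsto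
      (fun n : ℕ => ((n : ℝ) + 1)⁻¹ * ∫ s in (0 : ℝ)..((n : ℝ) + 1), f (ψ n s)) U
      (𝓝 (∫ y, f y ∂(μ : Measure K))) := fun f => by
    have := hμt (BoundedContinuousFunction.mkOfCompact f)
    simp only [BoundedContinuousFunction.mkOfCompact_apply] at this
    exact this.congr (hνi · f)
  have hUtop : (U : Filter ℕ) ≤ Filter.atTop := by
    rw [← Nat.cofinite_eq_atTop]
    exact Filter.hyperfilter_le_cofinite
  have hval : Measurable (Subtype.val : K → N) := measurable_subtype_coe
  have hmapi : ∀ f : N → ℝ, Continuous f →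
      ∫ y, f y ∂((μ : Measure K).map Subtype.val) = ∫ y, f (y : K) ∂(μ : Measure K) := fun f hf =>
    integral_map hval.aemeasurable hf.aestronglyMeasurable
  have hφt : ∀ t, Continuous (φ t) := fun t => by fun_prop
  have hprob : IsProbabilityMeasure ((μ : Measure K).map Subtype.val) :=
    Measure.isProbabilityMeasure_map hval.aemeasurable
  refine ⟨(μ : Measure K).map Subtype.val, hprob, ?_, fun t => ⟨(hφt t).measurable, ?_⟩, ?_⟩
  · rw [Measure.map_apply hval hK.isClosed.measurableSet.compl]
    simp
  · have : IsProbabilityMeasure (((μ : Measure K).map Subtype.val).map (φ t)) :=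
      Measure.isProbabilityMeasure_map (hφt t).measurable.aemeasurable
    refine ext_of_forall_integral_eq_of_IsFiniteMeasure fun f => ?_
    rw [integral_map (hφt t).measurable.aemeasurable f.continuous.aestronglyMeasurable,
      hmapi (fun y => f (φ t y)) (f.continuous.comp (hφt t)), hmapi _ f.continuous]
    have h1 := hlim ⟨fun y => f (φ t y), by fun_prop⟩
    have h2 := hlim ⟨fun y => f y, by fun_prop⟩
    have h3 : Filter.Tendsto (fun n : ℕ => ((n : ℝ) + 1)⁻¹ * (2 * |t| * ‖f‖)) U (𝓝 0) := by
      have := tendsto_one_div_add_atTop_nhds_zero_nat (𝕜 := ℝ) |>.mul_const (2 * |t| * ‖f‖)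
      simp only [one_div, zero_mul] at this
      exact this.mono_left hUtop
    refine sub_eq_zero.1 (tendsto_nhds_unique (h1.sub h2)
      (squeeze_zero_norm (fun n => ?_) h3))
    rw [← mul_sub, norm_mul, Real.norm_of_nonneg (by positivity)]
    gcongr
    have hu : Continuous (fun s => f (φ s (x n))) := f.continuous.comp (hφx (x n))
    have h4 := intervalIntegral_shift_sub hu ((n : ℝ) + 1) t
    have h5 : ∀ s, φ t (φ s (x n)) = φ (s + t) (x n) := fun s => by rw [← hadd, add_comm]
    simp only [hψ, ContinuousMap.coe_mk, h5]
    rw [h4]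
    have h6 : ∀ a b, ‖∫ s in a..b, f (φ s (x n))‖ ≤ ‖f‖ * |b - a| := fun a b =>
      intervalIntegral.norm_integral_le_of_norm_le_const fun s _ => f.norm_coe_le_norm _
    refine (norm_sub_le _ _).trans ((add_le_add (h6 _ _) (h6 _ _)).trans (le_of_eq ?_))
    rw [add_sub_cancel_left, sub_zero]
    ring
  · rw [hmapi h hh]
    have h1 := hlim ⟨fun y => h y, by fun_prop⟩
    exact ge_of_tendsto h1.abs (Filter.Eventually.of_forall hx)

end Averages

/-! ### Integrals depending smoothly on a parameter -/

section Parametric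

open MeasureTheory Set

variable {E : Type*} [NormedAddCommGroup E] [NormedSpace ℝ E] [FiniteDimensional ℝ E]
  {W : Set (E × ℝ)} {U : Set E} {a b : ℝ}

theorem hasFDerivAt_intervalIntegral_param {f : E × ℝ → ℝ} (hW : IsOpen W)
    (hf : ContDiffOn ℝ 1 f W) {x₀ : E} (hx₀ : ∀ s ∈ uIcc a b, (x₀, s) ∈ W) :
    HasFDerivAt (fun x => ∫ s in a..b, f (x, s))
      (∫ s in a..b, (fderiv ℝ f (x₀, s)).comp (ContinuousLinearMap.inl ℝ E ℝ)) x₀ := by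
  have hd : ContinuousOn (fderiv ℝ f) W := hf.continuousOn_fderiv_of_isOpen hW (by simp)
  have hd' : ContinuousOn (fun z => (fderiv ℝ f z).comp (ContinuousLinearMap.inl ℝ E ℝ)) W :=
    hd.clm_comp continuousOn_const
  obtain ⟨u, v, hu, hv, hxu, hsv, huv⟩ := generalized_tube_lemma (isCompact_singleton (x := x₀))
    (isCompact_uIcc (a := a) (b := b)) hW (by rintro ⟨x, s⟩ ⟨rfl, hs⟩; exact hx₀ s hs)
  obtain ⟨r, hr, hru⟩ := Metric.nhds_basis_closedBall.mem_iff.1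
    (hu.mem_nhds (hxu (mem_singleton x₀)))
  have hsub : Metric.closedBall x₀ r ×ˢ uIcc a b ⊆ W := (prod_mono hru hsv).trans huv
  have hcomp : IsCompact (Metric.closedBall x₀ r ×ˢ uIcc a b) :=
    (isCompact_closedBall x₀ r).prod isCompact_uIcc
  obtain ⟨C, hC⟩ := hcomp.exists_bound_of_continuousOn (hd'.mono hsub)
  have hslice : ∀ x ∈ Metric.closedBall x₀ r, ContinuousOn (fun s : ℝ => (x, s)) (uIcc a b) :=
    fun x _ => (Continuous.prodMk_right x).continuousOn
  have hmaps : ∀ x ∈ Metric.closedBall x₀ r, MapsTo (fun s : ℝ => (x, s)) (uIcc a b) W :=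
    fun x hx s hs => hsub ⟨hx, hs⟩
  have hx₀r := Metric.mem_closedBall_self (x := x₀) hr.le
  refine intervalIntegral.hasFDerivAt_integral_of_dominated_of_fderiv_le
    (F' := fun x s => (fderiv ℝ f (x, s)).comp (ContinuousLinearMap.inl ℝ E ℝ))
    (Metric.closedBall_mem_nhds x₀ hr) (bound := fun _ => C) ?_ ?_ ?_ ?_ intervalIntegrable_const ?_
  · filter_upwards [Metric.closedBall_mem_nhds x₀ hr] with x hx
    exact ((hf.continuousOn.comp (hslice x hx) (hmaps x hx)).mono
      uIoc_subset_uIcc).aestronglyMeasurable measurableSet_uIoc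
  · exact (hf.continuousOn.comp (hslice x₀ hx₀r) (hmaps x₀ hx₀r)).intervalIntegrable
  · exact ((hd'.comp (hslice x₀ hx₀r) (hmaps x₀ hx₀r)).mono
      uIoc_subset_uIcc).aestronglyMeasurable measurableSet_uIoc
  · exact Filter.Eventually.of_forall fun s hs x hx => hC _ ⟨hx, uIoc_subset_uIcc hs⟩
  · refine Filter.Eventually.of_forall fun s hs x hx => ?_
    have h1 : HasFDerivAt f (fderiv ℝ f (x, s)) (x, s) :=
      ((hf.differentiableOn (by simp)).differentiableAt
        (hW.mem_nhds (hsub ⟨hx, uIoc_subset_uIcc hs⟩))).hasFDerivAt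
    exact h1.comp x (hasFDerivAt_prodMk_left x s)

theorem contDiffOn_intervalIntegral_param {f : E × ℝ → ℝ} (hW : IsOpen W)
    (hf : ContDiffOn ℝ ∞ f W) (hU : IsOpen U) (hUW : ∀ x ∈ U, ∀ s ∈ uIcc a b, (x, s) ∈ W) :
    ContDiffOn ℝ ∞ (fun x => ∫ s in a..b, f (x, s)) U := by
  refine contDiffOn_infty.2 fun n => ?_
  induction n generalizing f with
  | zero =>
    refine contDiffOn_zero.2 fun x hx => ?_
    exact (hasFDerivAt_intervalIntegral_param hW (hf.of_le (by simp))
      (hUW x hx)).continuousAt.continuousWithinAt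
  | succ n ih =>
    have h1 : ∀ x ∈ U, HasFDerivAt (fun x => ∫ s in a..b, f (x, s))
      (∫ s in a..b, (fderiv ℝ f (x, s)).comp (ContinuousLinearMap.inl ℝ E ℝ)) x := fun x hx =>
        hasFDerivAt_intervalIntegral_param hW (hf.of_le (by simp)) (hUW x hx)
    have hd : ContDiffOn ℝ ∞ (fderiv ℝ f) W := hf.fderiv_of_isOpen hW (by simp)
    push_cast
    rw [contDiffOn_succ_iff_fderiv_apply hU.uniqueDiffOn]
    refine ⟨fun x hx => (h1 x hx).differentiableAt.differentiableWithinAt, by simp, fun v => ?_⟩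
    have h2 : ContDiffOn ℝ ∞ (fun z : E × ℝ => fderiv ℝ f z (v, 0)) W :=
      hd.clm_apply contDiffOn_const
    refine (ih h2).congr fun x hx => ?_
    rw [fderivWithin_of_isOpen hU hx, (h1 x hx).fderiv,
      ContinuousLinearMap.intervalIntegral_apply]
    · simp
    · have hc : ContinuousOn (fun s : ℝ => (fderiv ℝ f (x, s)).comp
          (ContinuousLinearMap.inl ℝ E ℝ)) (uIcc a b) :=
        (hd.continuousOn.comp (Continuous.prodMk_right x).continuousOn (hUW x hx)).clm_comp
          continuousOn_const
      exact hc.intervalIntegrable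

end Parametric

/-! ### Closed 1-forms cohomologous to a given one and small on a vector field -/

namespace Symp

open MeasureTheory Set Bundle

variable {E : Type*} [NormedAddCommGroup E] [NormedSpace ℝ E]
  {H : Type*} [TopologicalSpace H] {I : ModelWithCorners ℝ E H} [I.Boundaryless]
  {N : Type*} [TopologicalSpace N] [ChartedSpace H N] [IsManifold I ∞ N] [T2Space N]

/-- The derivative of a function along an integral curve. -/
theorem hasDerivAt_comp_of_hasMFDerivAt {γ : ℝ → N} {t : ℝ} {v : TangentSpace I (γ t)}
    (hγ : HasMFDerivAt 𝓘(ℝ, ℝ) I γ t ((1 : ℝ →L[ℝ] ℝ).smulRight v)) {f : N → ℝ}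
    (hf : MDifferentiableAt I 𝓘(ℝ, ℝ) f (γ t)) :
    HasDerivAt (fun s => f (γ s)) (mvfderiv I f (γ t) v) t := by
  have h2 : HasFDerivAt (fun s => f (γ s)) ((mvfderiv I f (γ t)).comp
      ((1 : ℝ →L[ℝ] ℝ).smulRight v) : ℝ →L[ℝ] ℝ) t :=
    (hf.hasMFDerivAt.comp t hγ).hasFDerivAt
  refine h2.hasDerivAt.congr_deriv ?_
  change mvfderiv I f (γ t) ((1 : ℝ) • v) = _
  rw [one_smul]

theorem hasDerivAt_integral_window {w : ℝ → ℝ} (hw : Continuous w) (T : ℝ) (r : ℝ) :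
    HasDerivAt (fun r => ∫ s in r..(T + r), w s) (w (T + r) - w r) r := by
  have h0 : ∀ a, HasDerivAt (fun r => ∫ s in (0 : ℝ)..r, w s) (w a) a := fun a =>
    intervalIntegral.integral_hasDerivAt_right (hw.intervalIntegrable _ _)
      (hw.stronglyMeasurableAtFilter _ _) hw.continuousAt
  have h1 : HasDerivAt (fun r => ∫ s in (0 : ℝ)..(T + r), w s) (w (T + r)) r :=
    ((h0 (T + r)).comp r ((hasDerivAt_id r).const_add T)).congr_deriv (mul_one _)
  refine (h1.sub (h0 r)).congr_of_eventuallyEq (Filter.Eventually.of_forall fun r => ?_)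
  simp only [Pi.sub_apply]
  rw [intervalIntegral.integral_interval_sub_left] <;> exact hw.intervalIntegrable _ _

theorem hasDerivAt_weighted_average {u : ℝ → ℝ} (hu : Continuous u) (T : ℝ) :
    HasDerivAt (fun r => ∫ s in (0 : ℝ)..T, (T - s) * u (s + r))
      ((∫ s in (0 : ℝ)..T, u s) - T * u 0) 0 := by
  have hsu : Continuous (fun s => s * u s) := continuous_id.mul hu
  have h1 := hasDerivAt_integral_window hu T 0
  have h2 := hasDerivAt_integral_window hsu T 0
  have h3 := (((hasDerivAt_id (0 : ℝ)).const_add T).mul h1).sub h2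
  refine (h3.congr_of_eventuallyEq (Filter.Eventually.of_forall fun r => ?_)).congr_deriv ?_
  · simp only [Pi.sub_apply, Pi.mul_apply, id]
    have h4 := intervalIntegral.integral_comp_add_right (a := 0) (b := T)
      (fun s => (T + r - s) * u s) r
    rw [zero_add] at h4
    have h5 : ∀ s, (T + r - (s + r)) * u (s + r) = (T - s) * u (s + r) := fun s => by ring
    simp only [h5] at h4
    rw [h4, ← intervalIntegral.integral_const_mul, ← intervalIntegral.integral_sub]
    · congr 1
      ext s
      ring
    · exact (hu.intervalIntegrable _ _).const_mul _
    · exact hsu.intervalIntegrable _ _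
  · simp only [add_zero, id]
    ring

variable [FiniteDimensional ℝ E]

theorem IsFlow.contMDiff_integral {X : VectorField I N} (hX : X.IsSmooth) {φ : ℝ → N → N}
    (hφ : IsFlow X φ) {h : N → ℝ} (hh : ContMDiff I 𝓘(ℝ, ℝ) ∞ h) (T : ℝ) :
    ContMDiff I 𝓘(ℝ, ℝ) ∞ (fun x => ∫ s in (0 : ℝ)..T, (T - s) * h (φ s x)) := by
  intro x₀
  have h1 : ContMDiffOn 𝓘(ℝ, E × ℝ) 𝓘(ℝ, ℝ) ∞
      (fun z : E × ℝ => (T - z.2) * h (φ z.2 ((extChartAt I x₀).symm z.1)))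
      ((extChartAt I x₀).target ×ˢ univ) := by
    have hs : ContMDiffOn 𝓘(ℝ, E × ℝ) I ∞ (fun z : E × ℝ => (extChartAt I x₀).symm z.1)
        ((extChartAt I x₀).target ×ˢ univ) :=
      (contMDiffOn_extChartAt_symm x₀).comp (contDiff_fst.contMDiff.contMDiffOn)
        (fun z hz => hz.1)
    have hp : ContMDiffOn 𝓘(ℝ, E × ℝ) (𝓘(ℝ, ℝ).prod I) ∞
        (fun z : E × ℝ => (z.2, (extChartAt I x₀).symm z.1))
        ((extChartAt I x₀).target ×ˢ univ) :=
      contDiff_snd.contMDiff.contMDiffOn.prodMk hs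
    have hc : ContMDiffOn 𝓘(ℝ, E × ℝ) 𝓘(ℝ, ℝ) ∞
        (fun z : E × ℝ => h (φ z.2 ((extChartAt I x₀).symm z.1)))
        ((extChartAt I x₀).target ×ˢ univ) :=
      (hh.comp (hφ.contMDiff hX)).comp_contMDiffOn hp
    exact (contDiff_const.sub contDiff_snd).contMDiff.contMDiffOn.mul hc
  have h2 := contDiffOn_intervalIntegral_param (a := 0) (b := T)
    ((isOpen_extChartAt_target (I := I) x₀).prod isOpen_univ) h1.contDiffOn
    (isOpen_extChartAt_target (I := I) x₀) (fun x hx s _ => ⟨hx, mem_univ s⟩)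
  have h3 := h2.contMDiffOn.contMDiffAt ((isOpen_extChartAt_target (I := I) x₀).mem_nhds
    (mem_extChartAt_target (I := I) x₀))
  have h4 := ContMDiffAt.comp x₀ h3 (contMDiffAt_extChartAt (I := I) (n := ∞) (x := x₀))
  refine h4.congr_of_eventuallyEq ?_
  filter_upwards [extChartAt_source_mem_nhds (I := I) x₀] with x hx
  simp only [Function.comp_apply]
  rw [(extChartAt I x₀).left_inv hx]

/-- If no invariant measure has rotation at least `c` against `λ`, then some 1-form `λ + dg` is
pointwise smaller than `c` on the vector field. Averaging over a long time does it: the time average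
of `λ(X)` over `[0, T]` equals `λ(X) + dg(X)` for `g = T⁻¹ ∫₀ᵀ (T - s) λ(X) ∘ φ_s ds`. -/
theorem exists_cohomologous_small [Nonempty N] [TopologicalSpace.MetrizableSpace N]
    [MeasurableSpace N] [BorelSpace N] {X : VectorField I N} (hX : X.IsSmooth) {K : Set N}
    (hK : IsCompact K) (hXK : ∀ x ∉ K, X x = 0) {lam : OneForm I N} (hl : lam.IsSmooth) {c : ℝ}
    (hc : ∀ μ ∈ invariantMeasures X, |∫ x, lam x (X x) ∂μ| < c) :
    ∃ g : N → ℝ, ContMDiff I 𝓘(ℝ, ℝ) ∞ g ∧ ∃ c' < c, ∀ x,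
      |lam x (X x) + mvfderiv I g x (X x)| ≤ c' := by
  obtain ⟨φ, hφ⟩ := hX.exists_isFlow hK hXK
  obtain ⟨z₀⟩ := ‹Nonempty N›
  have hK' : IsCompact (insert z₀ K) := hK.insert z₀
  have hXK' : ∀ x ∉ insert z₀ K, X x = 0 := fun x hx => hXK x fun h => hx (Or.inr h)
  have hfix : ∀ x, X x = 0 → ∀ t, φ t x = x := fun x hx t => hφ.eq_self hX hx t
  have hinv : ∀ t, ∀ x ∈ insert z₀ K, φ t x ∈ insert z₀ K := by
    intro t x hx
    by_contra hcon
    have h1 := hfix _ (hXK' _ hcon) (-t)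
    rw [hφ.neg_apply hX] at h1
    exact hcon (h1 ▸ hx)
  have hhs : ContMDiff I 𝓘(ℝ, ℝ) ∞ (fun x => lam x (X x)) := contMDiffOn_univ.1
    (hl.apply (contMDiffOn_id (s := univ)) (ContMDiff.contMDiffOn hX))
  set h : N → ℝ := fun x => lam x (X x) with hh
  have hex : ∃ n : ℕ, ∀ x ∈ insert z₀ K,
      |((n : ℝ) + 1)⁻¹ * ∫ s in (0 : ℝ)..((n : ℝ) + 1), h (φ s x)| < c := by
    by_contra! hcon
    obtain ⟨μ, hμ, hμK, hμφ, hμc⟩ := exists_invariant_measure_of_averages (hφ.continuous hX)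
      (hφ.add hX) hK' hinv hhs.continuous hcon
    exact (hc μ ⟨hμ, ⟨_, hK', hμK⟩, φ, hφ, hμφ⟩).not_ge hμc
  obtain ⟨n, hn⟩ := hex
  set T : ℝ := (n : ℝ) + 1 with hT
  have hTpos : 0 < T := by positivity
  set G : N → ℝ := fun x => ∫ s in (0 : ℝ)..T, (T - s) * h (φ s x) with hG
  have hGs : ContMDiff I 𝓘(ℝ, ℝ) ∞ G := hφ.contMDiff_integral hX hhs T
  have hgs : ContMDiff I 𝓘(ℝ, ℝ) ∞ (fun x => T⁻¹ * G x) := contMDiff_const.mul hGs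
  have havg : ∀ x, lam x (X x) + mvfderiv I (fun x => T⁻¹ * G x) x (X x) =
      T⁻¹ * ∫ s in (0 : ℝ)..T, h (φ s x) := by
    intro x
    have hu : Continuous (fun s => h (φ s x)) := hhs.continuous.comp (hφ.2 x).continuous
    have h1 := (hasDerivAt_weighted_average hu T).const_mul T⁻¹
    have h2 : HasDerivAt (fun s => T⁻¹ * G (φ s x))
        (mvfderiv I (fun x => T⁻¹ * G x) (φ 0 x) (X (φ 0 x))) 0 :=
      hasDerivAt_comp_of_hasMFDerivAt (γ := fun s => φ s x) (f := fun x => T⁻¹ * G x)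
        (hφ.2 x 0) (hgs.mdifferentiable (by simp) _)
    have h3 : (fun s => T⁻¹ * G (φ s x)) =
        fun r => T⁻¹ * ∫ s in (0 : ℝ)..T, (T - s) * h (φ (s + r) x) := by
      funext r
      simp only [hG, hφ.add hX]
    rw [h3] at h2
    have h4 := h2.unique h1
    rw [hφ.1] at h4
    rw [h4, mul_sub, ← mul_assoc, inv_mul_cancel₀ hTpos.ne', one_mul]
    simp only [hh]
    ring
  refine ⟨fun x => T⁻¹ * G x, hgs, ?_⟩
  have hcont : Continuous (fun x => |T⁻¹ * ∫ s in (0 : ℝ)..T, h (φ s x)|) := by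
    have : Continuous (fun z : N × ℝ => h (φ z.2 z.1)) :=
      hhs.continuous.comp ((hφ.continuous hX).comp continuous_swap)
    exact ((intervalIntegral.continuous_parametric_intervalIntegral_of_continuous'
      (f := fun x s => h (φ s x)) this 0 T).const_mul _).abs
  obtain ⟨x₁, hx₁, hmax⟩ := hK'.exists_isMaxOn ⟨z₀, mem_insert _ _⟩ hcont.continuousOn
  refine ⟨_, hn x₁ hx₁, fun x => ?_⟩
  by_cases hx : x ∈ insert z₀ K
  · rw [havg]
    exact hmax hx
  · rw [hXK' x hx, map_zero, map_zero, add_zero, abs_zero]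
    exact abs_nonneg _

/-! ### Differential forms in charts -/

section FormsInCharts

variable {E : Type*} [NormedAddCommGroup E] [NormedSpace ℝ E]
  {H : Type*} [TopologicalSpace H] {I : ModelWithCorners ℝ E H} [I.Boundaryless]
  {N : Type*} [TopologicalSpace N] [ChartedSpace H N] [IsManifold I ∞ N]

/-- The vector fields that are constant in the chart centred at `x₀` are smooth there. -/
theorem contMDiffOn_chart_const (x₀ : N) (v : E) :
    ContMDiffOn I I.tangent ∞
      (fun x => (⟨x, (trivializationAt E (TangentSpace I : N → Type _) x₀).symmL ℝ x v⟩ :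
        TangentBundle I N)) (chartAt H x₀).source := by
  set e := trivializationAt E (TangentSpace I : N → Type _) x₀ with he
  have h1 := e.contMDiffOn_symmL (IB := I) (n := ∞)
  have h2 := h1.clm_bundle_apply (E₁ := Trivial N E) (v := fun _ : N => v) (b := id)
    (fun x _ => (contMDiffAt_section x).2 contMDiffAt_const |>.contMDiffWithinAt)
  simpa [he] using h2

theorem symmL_eq_mfderiv (x₀ : N) {y : E} (hy : y ∈ (extChartAt I x₀).target) (v : E) :
    (trivializationAt E (TangentSpace I : N → Type _) x₀).symmL ℝ ((extChartAt I x₀).symm y) v =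
      mfderiv 𝓘(ℝ, E) I (extChartAt I x₀).symm y v := by
  have := isManifold_one (I := I) (N := N)
  have hz' := (extChartAt I x₀).map_target hy
  rw [extChartAt_source] at hz'
  rw [TangentBundle.symmL_trivializationAt hz', (extChartAt I x₀).right_inv hy]
  rw [I.range_eq_univ, mfderivWithin_univ]
  rfl

theorem mapsTo_chart_symm (x₀ : N) :
    MapsTo (extChartAt I x₀).symm (extChartAt I x₀).target (chartAt H x₀).source := by
  intro y hy
  have := (extChartAt I x₀).map_target hy
  rwa [extChartAt_source] at this

theorem OneForm.IsSmooth.contDiffOn_inChart {lam : OneForm I N} (hl : lam.IsSmooth) (x₀ : N)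
    (v : E) : ContDiffOn ℝ ∞ (fun y => lam.inChart x₀ y v) (extChartAt I x₀).target := by
  have h3 := hl.apply (b := id) contMDiffOn_id (contMDiffOn_chart_const x₀ v)
  have h4 := h3.comp (contMDiffOn_extChartAt_symm x₀) (mapsTo_chart_symm (I := I) x₀)
  refine h4.contDiffOn.congr fun y hy => ?_
  exact congrArg (lam ((extChartAt I x₀).symm y)) (symmL_eq_mfderiv x₀ hy v).symm

theorem TwoForm.IsSmooth.contDiffOn_inChart {om : TwoForm I N} (hom : om.IsSmooth) (x₀ : N)
    (u v : E) : ContDiffOn ℝ ∞ (fun y => om.inChart x₀ y u v) (extChartAt I x₀).target := by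
  have h1 := ContMDiffOn.clm_bundle_apply₂ (F₁ := E) (F₂ := E) (F₃ := ℝ)
    (E₁ := fun x : N => TangentSpace I x) (E₂ := fun x : N => TangentSpace I x)
    (E₃ := Trivial N ℝ) (ContMDiff.contMDiffOn (s := (chartAt H x₀).source) hom)
    (contMDiffOn_chart_const x₀ u) (contMDiffOn_chart_const x₀ v)
  have h3 : ContMDiffOn I 𝓘(ℝ, ℝ) ∞ (fun x => om x
      ((trivializationAt E (TangentSpace I : N → Type _) x₀).symmL ℝ x u)
      ((trivializationAt E (TangentSpace I : N → Type _) x₀).symmL ℝ x v))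
      (chartAt H x₀).source := fun p hp => ((contMDiffWithinAt_totalSpace).1 (h1 p hp)).2
  have h4 := h3.comp (contMDiffOn_extChartAt_symm x₀) (mapsTo_chart_symm (I := I) x₀)
  refine h4.contDiffOn.congr fun y hy => ?_
  exact congrArg₂ (fun a b => om ((extChartAt I x₀).symm y) a b)
    (symmL_eq_mfderiv x₀ hy u).symm (symmL_eq_mfderiv x₀ hy v).symm

/-- A 1-form is smooth when its coefficients in all charts are. -/
theorem OneForm.isSmooth_of_inChart [FiniteDimensional ℝ E] {lam : OneForm I N}
    (h : ∀ (x₀ : N) (v : E), ContDiffOn ℝ ∞ (fun y => lam.inChart x₀ y v)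
      (extChartAt I x₀).target) : lam.IsSmooth := by
  have := isManifold_one (I := I) (N := N)
  intro x₀
  rw [contMDiffAt_hom_bundle]
  refine ⟨contMDiffAt_id, ?_⟩
  have h1 : ContDiffOn ℝ ∞ (fun y : E => ((lam ((extChartAt I x₀).symm y)).comp
      (mfderiv 𝓘(ℝ, E) I (extChartAt I x₀).symm y) : E →L[ℝ] ℝ)) (extChartAt I x₀).target :=
    contDiffOn_clm_apply.2 (h x₀)
  have h2 := h1.contMDiffOn.comp (contMDiffOn_extChartAt (I := I) (n := ∞) (x := x₀))
    (fun z hz => by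
      rw [← extChartAt_source I] at hz
      exact (extChartAt I x₀).map_source hz)
  refine (h2.contMDiffAt ((chartAt H x₀).open_source.mem_nhds
    (mem_chart_source H x₀))).congr_of_eventuallyEq ?_
  filter_upwards [(chartAt H x₀).open_source.mem_nhds (mem_chart_source H x₀)] with x hx
  have hx' : x ∈ (extChartAt I x₀).source := by rwa [extChartAt_source]
  ext v
  have h3 := symmL_eq_mfderiv (I := I) x₀ ((extChartAt I x₀).map_source hx') v
  rw [(extChartAt I x₀).left_inv hx'] at h3
  rw [ContinuousLinearMap.inCoordinates]
  have h4 : ∀ (z z' : N) (_ : z = z') (w : E), (lam z : E →L[ℝ] ℝ) w = (lam z' : E →L[ℝ] ℝ) w := by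
    rintro z _ rfl w
    rfl
  simp only [ContinuousLinearMap.comp_apply, Function.comp_apply]
  have h5 : ∀ w : ℝ, (trivializationAt ℝ (Trivial N ℝ) x₀).continuousLinearMapAt ℝ x w = w :=
    fun w => DFunLike.congr_fun (Trivial.continuousLinearMapAt_trivialization ℝ N ℝ x) w
  refine (h5 _).trans ((congrArg (lam x) h3).trans ?_)
  exact h4 _ _ ((extChartAt I x₀).left_inv hx').symm _

end FormsInCharts

/-! ### Vector fields dual to 1-forms -/

section Dual

variable {E : Type*} [NormedAddCommGroup E] [NormedSpace ℝ E]
  {H : Type*} [TopologicalSpace H] {I : ModelWithCorners ℝ E H} [I.Boundaryless]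
  {N : Type*} [TopologicalSpace N] [ChartedSpace H N] [IsManifold I ∞ N]

theorem hasFDerivAt_comp_chart_symm {f : N → ℝ} (hf : ContMDiff I 𝓘(ℝ, ℝ) ∞ f) (x₀ : N) {y : E}
    (hy : y ∈ (extChartAt I x₀).target) :
    HasFDerivAt (fun y => f ((extChartAt I x₀).symm y))
      ((mvfderiv I f ((extChartAt I x₀).symm y)).comp
        (mfderiv 𝓘(ℝ, E) I (extChartAt I x₀).symm y) : E →L[ℝ] ℝ) y :=
  ((hf.mdifferentiable (by simp) _).hasMFDerivAt.comp y
    (hasMFDerivAt_chart_symm x₀ hy)).hasFDerivAt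

theorem contDiffOn_comp_chart_symm {f : N → ℝ} (hf : ContMDiff I 𝓘(ℝ, ℝ) ∞ f) (x₀ : N) :
    ContDiffOn ℝ ∞ (fun y => f ((extChartAt I x₀).symm y)) (extChartAt I x₀).target :=
  (hf.comp_contMDiffOn (contMDiffOn_extChartAt_symm x₀)).contDiffOn

theorem contDiffOn_inChart_mvfderiv {f : N → ℝ} (hf : ContMDiff I 𝓘(ℝ, ℝ) ∞ f) (x₀ : N) (v : E) :
    ContDiffOn ℝ ∞ (fun y => OneForm.inChart (fun x => mvfderiv I f x) x₀ y v)
      (extChartAt I x₀).target := by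
  have h1 := (contDiffOn_comp_chart_symm hf x₀).fderiv_of_isOpen (m := ∞)
    (isOpen_extChartAt_target (I := I) x₀) (by simp)
  refine (h1.clm_apply (contDiffOn_const (c := v))).congr fun y hy => ?_
  rw [(hasFDerivAt_comp_chart_symm hf x₀ hy).fderiv]
  rfl

variable [FiniteDimensional ℝ E]

/-- The coefficients of a 2-form in the chart centred at `x₀`, as a continuous bilinear map. -/
noncomputable def TwoForm.chartCLM (om : TwoForm I N) (x₀ : N) (y : E) : E →L[ℝ] E →L[ℝ] ℝ :=
  TwoForm.pullback (J := 𝓘(ℝ, E)) (extChartAt I x₀).symm om y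

theorem isInvertible_of_nondegenerate {A : E →L[ℝ] E →L[ℝ] ℝ}
    (hA : ∀ u, (∀ v, A u v = 0) → u = 0) : A.IsInvertible := by
  have hinj : Function.Injective (A : E →ₗ[ℝ] E →L[ℝ] ℝ) := by
    rw [injective_iff_map_eq_zero]
    intro u hu
    exact hA u fun v => congrArg (fun L : E →L[ℝ] ℝ => L v) hu
  have hdim : Module.finrank ℝ E = Module.finrank ℝ (E →L[ℝ] ℝ) := by
    rw [← (LinearMap.toContinuousLinearMap : (E →ₗ[ℝ] ℝ) ≃ₗ[ℝ] E →L[ℝ] ℝ).finrank_eq]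
    exact (Subspace.dual_finrank_eq (K := ℝ) (V := E)).symm
  refine ⟨((A : E →ₗ[ℝ] E →L[ℝ] ℝ).linearEquivOfInjective hinj hdim).toContinuousLinearEquiv, ?_⟩
  ext u v
  simp

theorem TwoForm.chartCLM_nondegenerate {om : TwoForm I N}
    (hnd : ∀ x u, (∀ v, om x u v = 0) → u = 0) (x₀ : N) {y : E}
    (hy : y ∈ (extChartAt I x₀).target) (u : E) (hu : ∀ v, om.chartCLM x₀ y u v = 0) : u = 0 := by
  have h1 : (mfderiv 𝓘(ℝ, E) I (extChartAt I x₀).symm y : E →L[ℝ] E) u = 0 := by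
    refine hnd ((extChartAt I x₀).symm y) _ fun v => ?_
    have h2 := hu (mfderiv I 𝓘(ℝ, E) (extChartAt I x₀) ((extChartAt I x₀).symm y) v)
    have h3 := mfderiv_chart_symm_comp (I := I) x₀ hy v
    exact (congrArg (om ((extChartAt I x₀).symm y) _) h3).symm.trans h2
  have h4 := mfderiv_chart_comp_symm (I := I) x₀ hy u
  have h5 : (mfderiv I 𝓘(ℝ, E) (extChartAt I x₀) ((extChartAt I x₀).symm y) : E →L[ℝ] E)
      ((mfderiv 𝓘(ℝ, E) I (extChartAt I x₀).symm y : E →L[ℝ] E) u) = 0 := by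
    rw [h1, map_zero]
  exact h4.symm.trans h5

/-- The vector field dual to a smooth 1-form through a nondegenerate smooth 2-form is smooth. -/
theorem VectorField.isSmooth_of_dual {om : TwoForm I N}
    (hom : ∀ (x₀ : N) (u v : E), ContDiffOn ℝ ∞ (fun y => om.inChart x₀ y u v)
      (extChartAt I x₀).target)
    (hnd : ∀ x u, (∀ v, om x u v = 0) → u = 0) {lam : OneForm I N}
    (hl : ∀ (x₀ : N) (v : E), ContDiffOn ℝ ∞ (fun y => lam.inChart x₀ y v)
      (extChartAt I x₀).target)
    {V : VectorField I N} (hV : ∀ x v, om x (V x) v = lam x v) : V.IsSmooth := by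
  rw [VectorField.isSmooth_iff]
  intro x₀
  have hA : ContDiffOn ℝ ∞ (om.chartCLM x₀) (extChartAt I x₀).target :=
    contDiffOn_clm_apply.2 fun u => contDiffOn_clm_apply.2 fun v => hom x₀ u v
  have hL : ContDiffOn ℝ ∞ (fun y : E => ((lam ((extChartAt I x₀).symm y)).comp
      (mfderiv 𝓘(ℝ, E) I (extChartAt I x₀).symm y) : E →L[ℝ] ℝ)) (extChartAt I x₀).target :=
    contDiffOn_clm_apply.2 (hl x₀)
  have hinv : ContDiffOn ℝ ∞ (fun y => (om.chartCLM x₀ y).inverse) (extChartAt I x₀).target := by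
    intro y hy
    obtain ⟨e, he⟩ := isInvertible_of_nondegenerate (om.chartCLM_nondegenerate hnd x₀ hy)
    have : CompleteSpace E := FiniteDimensional.complete ℝ E
    have h1 := contDiffAt_map_inverse (n := ∞) e
    rw [he] at h1
    exact h1.comp_contDiffWithinAt y (hA y hy)
  refine (hinv.clm_apply hL).congr fun y hy => ?_
  have h2 : om.chartCLM x₀ y (V.inChart x₀ y) = ((lam ((extChartAt I x₀).symm y)).comp
      (mfderiv 𝓘(ℝ, E) I (extChartAt I x₀).symm y) : E →L[ℝ] ℝ) := by
    ext v
    have h3 := VectorField.mfderiv_inChart V x₀ hy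
    have h4 := hV ((extChartAt I x₀).symm y) (mfderiv 𝓘(ℝ, E) I (extChartAt I x₀).symm y v)
    exact (congrArg (fun w => om ((extChartAt I x₀).symm y) w _) h3).trans h4
  rw [← h2]
  exact ((isInvertible_of_nondegenerate
    (om.chartCLM_nondegenerate hnd x₀ hy)).inverse_apply_self _).symm

/-- The vector field `V` with `ω(V, ·) = λ`, for a nondegenerate 2-form `ω`; the value is junk at points
where `ω` is degenerate. -/
noncomputable def TwoForm.dual (om : TwoForm I N) (lam : OneForm I N) : VectorField I N :=
  fun x => (om x).inverse (lam x)

theorem TwoForm.dual_spec {om : TwoForm I N} (hnd : ∀ x u, (∀ v, om x u v = 0) → u = 0)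
    (lam : OneForm I N) (x : N) (v : TangentSpace I x) : om x (om.dual lam x) v = lam x v := by
  have h := (isInvertible_of_nondegenerate (E := E) (hnd x)).self_apply_inverse (lam x)
  exact congrArg (fun L : E →L[ℝ] ℝ => L v) h

theorem eq_hamiltonianVectorField {om : TwoForm I N} (hnd : ∀ x u, (∀ v, om x u v = 0) → u = 0)
    {F : N → ℝ} {x : N} {w : TangentSpace I x} (hw : ∀ v, om x w v = -mvfderiv I F x v) :
    w = hamiltonianVectorField om F x := by
  refine sub_eq_zero.1 (hnd x _ fun v => ?_)
  have h : ∀ (A : E →L[ℝ] E →L[ℝ] ℝ) (a b v : E), A a v = A b v → A (a - b) v = 0 :=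
    fun A a b v hab => by rw [map_sub, sub_apply, hab, sub_self]
  exact h (om x) w _ v ((hw v).trans (hamiltonianVectorField_spec om hnd F x v).symm)

end Dual

end Symp

/-! ### Symplectic flows -/

/-- The derivative at `s = 0` of the pull-back of a field of bilinear forms `Ω` under a family of maps `F s`
with `F 0 = id` and initial velocity `X`. -/
theorem hasDerivAt_pullback_bilinear {E : Type*} [NormedAddCommGroup E] [NormedSpace ℝ E]
    {Ω : E → E →L[ℝ] E →L[ℝ] ℝ} {F : ℝ × E → E} {X : E → E} {y₀ : E}
    (hΩ : DifferentiableAt ℝ Ω y₀) (hF : ContDiffAt ℝ ∞ F (0, y₀))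
    (h0 : ∀ᶠ y in 𝓝 y₀, F (0, y) = y)
    (hX : ∀ᶠ y in 𝓝 y₀, HasDerivAt (fun s => F (s, y)) (X y) 0) (u v : E) :
    HasDerivAt (fun s => Ω (F (s, y₀)) (fderiv ℝ F (s, y₀) (0, u)) (fderiv ℝ F (s, y₀) (0, v)))
      (fderiv ℝ Ω y₀ (X y₀) u v + Ω y₀ (fderiv ℝ X y₀ u) v + Ω y₀ u (fderiv ℝ X y₀ v)) 0 := by
  have hG : ContDiffAt ℝ 1 (fderiv ℝ F) (0, y₀) :=
    hF.fderiv_right (m := 1) (by norm_cast)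
  have hGd : HasFDerivAt (fderiv ℝ F) (fderiv ℝ (fderiv ℝ F) (0, y₀)) (0, y₀) :=
    (hG.differentiableAt (by norm_num)).hasFDerivAt
  have hsymm : IsSymmSndFDerivAt ℝ F (0, y₀) := hF.isSymmSndFDerivAt
    (by rw [minSmoothness_of_isRCLikeNormedField]; exact WithTop.coe_le_coe.2 (le_top : (2 : ℕ∞) ≤ ⊤))
  have hFd : ∀ᶠ y in 𝓝 y₀, DifferentiableAt ℝ F (0, y) := by
    have h1 : ∀ᶠ z in 𝓝 ((0 : ℝ), y₀), DifferentiableAt ℝ F z :=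
      ((hF.of_le (m := 1) (by norm_cast)).eventually (by simp)).mono fun z hz =>
        hz.differentiableAt (by norm_num)
    exact (Continuous.prodMk_right (0 : ℝ)).tendsto y₀ |>.eventually h1
  have hline : ∀ y : E, HasFDerivAt (fun y => ((0 : ℝ), y)) (ContinuousLinearMap.inr ℝ ℝ E) y :=
    fun y => hasFDerivAt_prodMk_right 0 y
  have hGX : (fun y => fderiv ℝ F (0, y) (1, 0)) =ᶠ[𝓝 y₀] X := by
    filter_upwards [hX, hFd] with y hy hd
    have h1 : HasDerivAt (fun s : ℝ => (s, y)) ((1 : ℝ), (0 : E)) 0 :=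
      (hasDerivAt_id (0 : ℝ)).prodMk (hasDerivAt_const _ _)
    exact (hd.hasFDerivAt.comp_hasDerivAt (0 : ℝ) h1).unique hy
  have hG0 : ∀ w, fderiv ℝ F (0, y₀) (0, w) = w := by
    intro w
    have h1 := hFd.self_of_nhds.hasFDerivAt.comp y₀ (hline y₀)
    have h2 : HasFDerivAt (fun y => F (0, y)) (ContinuousLinearMap.id ℝ E) y₀ :=
      (hasFDerivAt_id y₀).congr_of_eventuallyEq h0
    exact DFunLike.congr_fun (h1.unique h2) w
  have hcurve : HasDerivAt (fun s : ℝ => (s, y₀)) ((1 : ℝ), (0 : E)) 0 :=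
    (hasDerivAt_id (0 : ℝ)).prodMk (hasDerivAt_const _ _)
  have hGs : ∀ w, HasDerivAt (fun s => fderiv ℝ F (s, y₀) (0, w)) (fderiv ℝ X y₀ w) 0 := by
    intro w
    have h1 : HasDerivAt (fun s => fderiv ℝ F (s, y₀)) (fderiv ℝ (fderiv ℝ F) (0, y₀) (1, 0)) 0 :=
      hGd.comp_hasDerivAt (0 : ℝ) hcurve
    have h2 := h1.clm_apply (hasDerivAt_const (0 : ℝ) ((0 : ℝ), w))
    refine h2.congr_deriv ?_
    rw [map_zero, add_zero, hsymm.eq]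
    have h3 : HasFDerivAt (fun y => fderiv ℝ F (0, y))
        ((fderiv ℝ (fderiv ℝ F) (0, y₀)).comp (ContinuousLinearMap.inr ℝ ℝ E)) y₀ :=
      hGd.comp y₀ (hline y₀)
    have h4 := h3.clm_apply (hasFDerivAt_const ((1 : ℝ), (0 : E)) y₀)
    have h5 := (h4.congr_of_eventuallyEq hGX.symm).fderiv
    rw [h5]
    simp
  have hFs : HasDerivAt (fun s => F (s, y₀)) (X y₀) 0 := hX.self_of_nhds
  have hF0 : F (0, y₀) = y₀ := h0.self_of_nhds
  have hΩs : HasDerivAt (fun s => Ω (F (s, y₀))) (fderiv ℝ Ω y₀ (X y₀)) 0 := by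
    refine HasFDerivAt.comp_hasDerivAt (0 : ℝ) (l := Ω) ?_ hFs
    rw [hF0]
    exact hΩ.hasFDerivAt
  have h := (hΩs.clm_apply (hGs u)).clm_apply (hGs v)
  refine h.congr_deriv ?_
  simp only [hF0, hG0, add_apply]

namespace Symp

open MeasureTheory Set Bundle

section Preserve

variable {E : Type*} [NormedAddCommGroup E] [NormedSpace ℝ E] [FiniteDimensional ℝ E]
  {H : Type*} [TopologicalSpace H] {I : ModelWithCorners ℝ E H} [I.Boundaryless]
  {N : Type*} [TopologicalSpace N] [ChartedSpace H N] [IsManifold I ∞ N] [T2Space N]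

theorem TwoForm.contDiffOn_chartCLM {om : TwoForm I N}
    (hom : ∀ (x₀ : N) (u v : E), ContDiffOn ℝ ∞ (fun y => om.inChart x₀ y u v)
      (extChartAt I x₀).target) (x₀ : N) :
    ContDiffOn ℝ ∞ (om.chartCLM x₀) (extChartAt I x₀).target :=
  contDiffOn_clm_apply.2 fun u => contDiffOn_clm_apply.2 fun v => hom x₀ u v

theorem TwoForm.differentiableAt_chartCLM {om : TwoForm I N}
    (hom : ∀ (x₀ : N) (u v : E), ContDiffOn ℝ ∞ (fun y => om.inChart x₀ y u v)
      (extChartAt I x₀).target) (x₀ : N) {y : E} (hy : y ∈ (extChartAt I x₀).target) :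
    DifferentiableAt ℝ (om.chartCLM x₀) y :=
  ((TwoForm.contDiffOn_chartCLM hom x₀).contDiffAt
    ((isOpen_extChartAt_target (I := I) x₀).mem_nhds hy)).differentiableAt (by simp)

/-- Cartan's formula `L_V ω = ι_V dω + d(ι_V ω) = 0` in a chart. -/
theorem lieDerivative_inChart_eq_zero {om : TwoForm I N}
    (hom : ∀ (x₀ : N) (u v : E), ContDiffOn ℝ ∞ (fun y => om.inChart x₀ y u v)
      (extChartAt I x₀).target)
    (halt : ∀ x v, om x v v = 0) (hcl : om.IsClosed) {lam : OneForm I N} (hlc : lam.IsClosed)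
    {V : VectorField I N} (hVs : V.IsSmooth) (hV : ∀ x v, om x (V x) v = lam x v)
    (x₀ : N) {y : E} (hy : y ∈ (extChartAt I x₀).target) (u v : E) :
    fderiv ℝ (om.chartCLM x₀) y (V.inChart x₀ y) u v +
      om.chartCLM x₀ y (fderiv ℝ (V.inChart x₀) y u) v +
      om.chartCLM x₀ y u (fderiv ℝ (V.inChart x₀) y v) = 0 := by
  have hopen := (isOpen_extChartAt_target (I := I) x₀).mem_nhds hy
  have hAd := (TwoForm.differentiableAt_chartCLM hom x₀ hy).hasFDerivAt
  have hXd : HasFDerivAt (V.inChart x₀) (fderiv ℝ (V.inChart x₀) y) y :=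
    ((((V.isSmooth_iff.1 hVs x₀).contDiffAt hopen).differentiableAt (by simp))).hasFDerivAt
  have hder : ∀ a b w : E, fderiv ℝ (fun z => om.inChart x₀ z a b) y w =
      fderiv ℝ (om.chartCLM x₀) y w a b := by
    intro a b w
    have h1 := (hAd.clm_apply (hasFDerivAt_const a y)).clm_apply (hasFDerivAt_const b y)
    have h2 : HasFDerivAt (fun z => om.inChart x₀ z a b) _ y := h1
    rw [h2.fderiv]
    simp
  have hlam : ∀ b w : E, fderiv ℝ (fun z => lam.inChart x₀ z b) y w =
      fderiv ℝ (om.chartCLM x₀) y w (V.inChart x₀ y) b +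
        om.chartCLM x₀ y (fderiv ℝ (V.inChart x₀) y w) b := by
    intro b w
    have h1 := (hAd.clm_apply hXd).clm_apply (hasFDerivAt_const b y)
    have h2 : (fun z => lam.inChart x₀ z b) =ᶠ[𝓝 y]
        fun z => om.chartCLM x₀ z (V.inChart x₀ z) b := by
      filter_upwards [hopen] with z hz
      have h3 := VectorField.mfderiv_inChart V x₀ hz
      have h4 := hV ((extChartAt I x₀).symm z) (mfderiv 𝓘(ℝ, E) I (extChartAt I x₀).symm z b)
      exact ((congrArg (fun w => om ((extChartAt I x₀).symm z) w _) h3).trans h4).symm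
    rw [h2.fderiv_eq, h1.fderiv]
    simp [add_comm]
  have hskew : ∀ a b : E, om.chartCLM x₀ y a b = - om.chartCLM x₀ y b a := by
    have h0 : ∀ a : E, om.chartCLM x₀ y a a = 0 := fun a => halt _ _
    intro a b
    have h1 := h0 (a + b)
    simp only [map_add, add_apply, h0] at h1
    linarith
  have h1 := hlc x₀ y hy u v
  have h2 := hcl x₀ y hy (V.inChart x₀ y) u v
  rw [hlam, hlam] at h1
  rw [hder, hder, hder] at h2
  have h3 := hskew u (fderiv ℝ (V.inChart x₀) y v)
  linarith

/-- The flow of a vector field dual to a closed 1-form preserves the symplectic form. -/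
theorem IsFlow.preserves {om : TwoForm I N}
    (hom : ∀ (x₀ : N) (u v : E), ContDiffOn ℝ ∞ (fun y => om.inChart x₀ y u v)
      (extChartAt I x₀).target)
    (halt : ∀ x v, om x v v = 0) (hcl : om.IsClosed) {lam : OneForm I N} (hlc : lam.IsClosed)
    {V : VectorField I N} (hVs : V.IsSmooth) (hV : ∀ x v, om x (V x) v = lam x v)
    {φ : ℝ → N → N} (hφ : IsFlow V φ) (t : ℝ) (x : N) (u v : TangentSpace I x) :
    om (φ t x) (mfderiv I I (φ t) x u) (mfderiv I I (φ t) x v) = om x u v := by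
  have hsm := fun t => hφ.contMDiff_apply hVs t
  have hmd : ∀ t x, MDifferentiableAt I I (φ t) x :=
    fun t x => (hsm t).mdifferentiable (by simp) x
  -- the derivative at time zero
  have key : ∀ (x : N) (u v : E),
      HasDerivAt (fun s => om (φ s x) (mfderiv I I (φ s) x u) (mfderiv I I (φ s) x v)) 0 0 := by
    intro x u v
    have hone := isManifold_one (I := I) (N := N)
    set c := extChartAt I x with hc
    set y₀ : E := c x with hy₀
    have hy₀t : y₀ ∈ c.target := mem_extChartAt_target x
    have hcy₀ : c.symm y₀ = x := extChartAt_to_inv x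
    set F : ℝ × E → E := fun z => c (φ z.1 (c.symm z.2)) with hF
    have hφc : Continuous (fun s => φ s x) := (hφ.2 x).continuous
    have hinner : ContMDiffAt 𝓘(ℝ, ℝ × E) I ∞ (fun z : ℝ × E => φ z.1 (c.symm z.2)) (0, y₀) := by
      have h1 : ContMDiffAt 𝓘(ℝ, ℝ × E) I ∞ (fun z : ℝ × E => c.symm z.2) (0, y₀) :=
        ContMDiffAt.comp (I' := 𝓘(ℝ, E)) (0, y₀)
          ((contMDiffOn_extChartAt_symm x).contMDiffAt
            ((isOpen_extChartAt_target x).mem_nhds hy₀t)) contDiff_snd.contMDiff.contMDiffAt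
      have h2 : ContMDiffAt 𝓘(ℝ, ℝ × E) 𝓘(ℝ, ℝ) ∞ (fun z : ℝ × E => z.1) (0, y₀) :=
        contDiff_fst.contMDiff.contMDiffAt
      exact ((hφ.contMDiff hVs) _).comp (I' := 𝓘(ℝ, ℝ).prod I) (0, y₀)
        (f := fun z : ℝ × E => (z.1, c.symm z.2)) (h2.prodMk h1)
    have hF00 : φ (0 : ℝ) (c.symm y₀) = x := by rw [hφ.1, hcy₀]
    have hFs : ContDiffAt ℝ ∞ F (0, y₀) := by
      have h1 : ContMDiffAt I 𝓘(ℝ, E) ∞ c (φ (0 : ℝ) (c.symm y₀)) := by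
        rw [hF00]
        exact contMDiffAt_extChartAt
      exact (ContMDiffAt.comp (0, y₀) (f := fun z : ℝ × E => φ z.1 (c.symm z.2)) h1
        hinner).contDiffAt
    have hF0 : ∀ᶠ y in 𝓝 y₀, F (0, y) = y := by
      filter_upwards [(isOpen_extChartAt_target x).mem_nhds hy₀t] with y hy
      simp only [hF]
      rw [hφ.1, c.right_inv hy]
    have hFX : ∀ᶠ y in 𝓝 y₀, HasDerivAt (fun s => F (s, y)) (V.inChart x y) 0 := by
      filter_upwards [(isOpen_extChartAt_target x).mem_nhds hy₀t] with y hy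
      have h1 := hφ.2 (c.symm y) 0
      have hs : φ 0 (c.symm y) ∈ (chartAt H x).source := by
        rw [hφ.1, ← extChartAt_source I]
        exact c.map_target hy
      let a : E := V (φ 0 (c.symm y))
      let A : E →L[ℝ] E := mfderiv I 𝓘(ℝ, E) c (φ 0 (c.symm y))
      have h2 : HasFDerivAt (fun s => F (s, y)) (A.comp ((1 : ℝ →L[ℝ] ℝ).smulRight a)) 0 :=
        ((mdifferentiableAt_extChartAt (I := I) hs).hasMFDerivAt.comp (0 : ℝ) h1).hasFDerivAt
      refine h2.hasDerivAt.congr_deriv ?_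
      have h3 : ∀ (z z' : N) (_ : z = z'), (mfderiv I 𝓘(ℝ, E) c z : E →L[ℝ] E) ((1 : ℝ) • (V z : E)) =
          (mfderiv I 𝓘(ℝ, E) c z' : E →L[ℝ] E) (V z') := by
        rintro z _ rfl
        exact congrArg (mfderiv I 𝓘(ℝ, E) c z : E →L[ℝ] E) (one_smul ℝ (V z : E))
      exact h3 _ _ (hφ.1 _)
    have h := hasDerivAt_pullback_bilinear (TwoForm.differentiableAt_chartCLM hom x hy₀t) hFs hF0 hFX u v
    rw [lieDerivative_inChart_eq_zero hom halt hcl hlc hVs hV x hy₀t u v] at h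
    refine h.congr_of_eventuallyEq ?_
    have hsrc : ∀ᶠ s in 𝓝 (0 : ℝ), φ s x ∈ c.source := by
      refine hφc.continuousAt.eventually ((isOpen_extChartAt_source x).mem_nhds ?_)
      exact ((hφ.1 x).symm ▸ mem_extChartAt_source x : φ 0 x ∈ (extChartAt I x).source)
    have hFd : ∀ᶠ s in 𝓝 (0 : ℝ), DifferentiableAt ℝ F (s, y₀) := by
      have h1 : ∀ᶠ z in 𝓝 ((0 : ℝ), y₀), DifferentiableAt ℝ F z :=
        ((hFs.of_le (m := 1) (by norm_cast)).eventually (by simp)).mono fun z hz =>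
          hz.differentiableAt (by norm_num)
      exact (Continuous.prodMk_left y₀).tendsto (0 : ℝ) |>.eventually h1
    filter_upwards [hsrc, hFd] with s hs hFds
    have hs' : φ s x ∈ (chartAt H x).source := by rwa [← extChartAt_source I]
    have hDF : ∀ w : E, fderiv ℝ F (s, y₀) (0, w) =
        (mfderiv I 𝓘(ℝ, E) c (φ s x) : E →L[ℝ] E) ((mfderiv I I (φ s) x : E →L[ℝ] E) w) := by
      intro w
      have h1 : MDifferentiableAt I 𝓘(ℝ, E) c (φ s (c.symm y₀)) := by
        rw [hcy₀]
        exact mdifferentiableAt_extChartAt hs'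
      have h2 : HasFDerivAt (fun y => F (s, y))
          ((mfderiv I 𝓘(ℝ, E) c (φ s (c.symm y₀)) : E →L[ℝ] E).comp
            ((mfderiv I I (φ s) (c.symm y₀) : E →L[ℝ] E).comp
              (mfderiv 𝓘(ℝ, E) I c.symm y₀ : E →L[ℝ] E))) y₀ :=
        (h1.hasMFDerivAt.comp y₀ ((hmd s _).hasMFDerivAt.comp y₀
          (hasMFDerivAt_chart_symm x hy₀t))).hasFDerivAt
      have h3 : HasFDerivAt (fun y => F (s, y))
          ((fderiv ℝ F (s, y₀)).comp (ContinuousLinearMap.inr ℝ ℝ E)) y₀ :=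
        hFds.hasFDerivAt.comp y₀ (hasFDerivAt_prodMk_right s y₀)
      have h4 : (mfderiv 𝓘(ℝ, E) I c.symm y₀ : E →L[ℝ] E) w = w := mfderiv_chart_symm_self x w
      have h5 : ∀ (z : N) (_ : z = x), (mfderiv I 𝓘(ℝ, E) c (φ s z) : E →L[ℝ] E)
          ((mfderiv I I (φ s) z : E →L[ℝ] E) w) =
          (mfderiv I 𝓘(ℝ, E) c (φ s x) : E →L[ℝ] E) ((mfderiv I I (φ s) x : E →L[ℝ] E) w) := by
        rintro _ rfl
        rfl
      refine (DFunLike.congr_fun (h3.unique h2) w).trans ?_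
      refine Eq.trans ?_ (h5 _ hcy₀)
      exact congrArg (fun a : E => (mfderiv I 𝓘(ℝ, E) c (φ s (c.symm y₀)) : E →L[ℝ] E)
          ((mfderiv I I (φ s) (c.symm y₀) : E →L[ℝ] E) a)) h4
    have hback : ∀ w : E, (mfderiv 𝓘(ℝ, E) I c.symm (c (φ s x)) : E →L[ℝ] E)
        ((mfderiv I 𝓘(ℝ, E) c (φ s x) : E →L[ℝ] E) w) = w := by
      intro w
      have h1 := mfderiv_chart_symm_comp (I := I) x (c.map_source hs)
      have h2 : ∀ (z : N) (_ : z = φ s x), (mfderiv 𝓘(ℝ, E) I c.symm (c (φ s x)) : E →L[ℝ] E)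
          ((mfderiv I 𝓘(ℝ, E) c z : E →L[ℝ] E) w) = w →
          (mfderiv 𝓘(ℝ, E) I c.symm (c (φ s x)) : E →L[ℝ] E)
          ((mfderiv I 𝓘(ℝ, E) c (φ s x) : E →L[ℝ] E) w) = w := by
        rintro _ rfl h
        exact h
      exact h2 _ (c.left_inv hs) (h1 w)
    have h6 : ∀ (z z' : N) (_ : z = z') (a a' b b' : E), a = a' → b = b' →
        (om z : E →L[ℝ] E →L[ℝ] ℝ) a b = (om z' : E →L[ℝ] E →L[ℝ] ℝ) a' b' := by
      rintro z _ rfl a _ b _ rfl rfl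
      rfl
    have hFsy : F (s, y₀) = c (φ s x) := by simp only [hF, hcy₀]
    rw [hDF, hDF, hFsy]
    exact h6 _ _ (c.left_inv hs).symm _ _ _ _ (hback _).symm (hback _).symm
  have hall : ∀ t, HasDerivAt
      (fun s => om (φ s x) (mfderiv I I (φ s) x u) (mfderiv I I (φ s) x v)) 0 t := by
    intro t
    have h1 := key (φ t x) (mfderiv I I (φ t) x u) (mfderiv I I (φ t) x v)
    have h2 : HasDerivAt (fun s => om (φ (s - t) (φ t x))
        (mfderiv I I (φ (s - t)) (φ t x) (mfderiv I I (φ t) x u))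
        (mfderiv I I (φ (s - t)) (φ t x) (mfderiv I I (φ t) x v))) 0 t := by
      rw [← sub_self t] at h1
      simpa using h1.comp_sub_const t t
    refine h2.congr_of_eventuallyEq (Filter.Eventually.of_forall fun s => ?_)
    have h3 : φ s = φ (s - t) ∘ φ t := by
      funext z
      rw [Function.comp_apply, ← hφ.add hVs, sub_add_cancel]
    have h4 : ∀ f : N → N, f = φ (s - t) ∘ φ t → om (f x) (mfderiv I I f x u)
        (mfderiv I I f x v) = om (φ (s - t) (φ t x))
        (mfderiv I I (φ (s - t)) (φ t x) (mfderiv I I (φ t) x u))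
        (mfderiv I I (φ (s - t)) (φ t x) (mfderiv I I (φ t) x v)) := by
      rintro _ rfl
      rw [mfderiv_comp x (hmd _ _) (hmd _ _)]
      rfl
    exact h4 _ h3
  have hconst := is_const_of_deriv_eq_zero (fun t => (hall t).differentiableAt)
    (fun t => (hall t).deriv) t 0
  refine hconst.trans ?_
  have h0 : φ 0 = id := funext hφ.1
  have h4 : ∀ f : N → N, f = id → om (f x) (mfderiv I I f x u) (mfderiv I I f x v) = om x u v := by
    rintro _ rfl
    rw [mfderiv_id]
    rfl
  exact h4 _ h0

end Preserve

/-! ### Displacement by a pair of flows -/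

section Displacement

variable {E : Type*} [NormedAddCommGroup E] [NormedSpace ℝ E] [FiniteDimensional ℝ E]
  {H : Type*} [TopologicalSpace H] {I : ModelWithCorners ℝ E H} [I.Boundaryless]
  {N : Type*} [TopologicalSpace N] [ChartedSpace H N] [IsManifold I ∞ N] [T2Space N]

/-- The flow of `V` leaves `V` invariant. -/
theorem IsFlow.mfderiv_apply_self {V : VectorField I N} (hV : V.IsSmooth) {S : ℝ → N → N}
    (hS : IsFlow V S) (t : ℝ) (z : N) : mfderiv I I (S t) z (V z) = V (S t z) := by
  have h1 : HasMFDerivAt 𝓘(ℝ, ℝ) I (fun s => S s (S t z)) 0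
      ((1 : ℝ →L[ℝ] ℝ).smulRight (V (S 0 (S t z)))) := hS.2 (S t z) 0
  have h2 := ((hS.contMDiff_apply hV t).mdifferentiable (by simp) (S 0 z)).hasMFDerivAt.comp
    (0 : ℝ) (hS.2 z 0)
  have h3 : (fun s => S s (S t z)) = S t ∘ fun s => S s z := by
    funext s
    rw [Function.comp_apply, ← hS.add hV, ← hS.add hV, add_comm]
  rw [h3] at h1
  have h4 : ((1 : ℝ) • V (S 0 (S t z)) : E) =
      (mfderiv I I (S t) (S 0 z) : E →L[ℝ] E) ((1 : ℝ) • (V (S 0 z) : E)) :=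
    DFunLike.congr_fun (hasMFDerivAt_unique h1 h2) (1 : ℝ)
  rw [one_smul, one_smul] at h4
  have h5 : ∀ (a b : N) (_ : a = z) (_ : b = S t z), (V b : E) =
      (mfderiv I I (S t) a : E →L[ℝ] E) (V a) → (mfderiv I I (S t) z : E →L[ℝ] E) (V z) =
      V (S t z) := by
    rintro _ _ rfl rfl h
    exact h.symm
  exact h5 _ _ (hS.1 _) (hS.1 _) h4

/-- If the flow `S` preserves `ω` and `ω(W, ·) = df`, then the transport of `W` by `S (-b)` is dual to
`d(f ∘ S b)`. -/
theorem transport_dual {om : TwoForm I N} {V W : VectorField I N} (hV : V.IsSmooth)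
    {S : ℝ → N → N} (hS : IsFlow V S)
    (hpres : ∀ t x (u v : TangentSpace I x),
      om (S t x) (mfderiv I I (S t) x u) (mfderiv I I (S t) x v) = om x u v)
    {f : N → ℝ} (hf : ContMDiff I 𝓘(ℝ, ℝ) ∞ f) (hW : ∀ x v, om x (W x) v = mvfderiv I f x v)
    (b : ℝ) (z : N) : ∀ v : TangentSpace I (S (-b) z),
      om (S (-b) z) (mfderiv I I (S (-b)) z (W z)) v =
        mvfderiv I (fun y => f (S b y)) (S (-b) z) v := by
  set G := S (-b) z with hG
  intro v
  have hz : S b G = z := hS.apply_neg hV b z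
  have hmd : ∀ t x, MDifferentiableAt I I (S t) x :=
    fun t x => (hS.contMDiff_apply hV t).mdifferentiable (by simp) x
  have h1 : (mfderiv I I (S b) G : E →L[ℝ] E) ((mfderiv I I (S (-b)) z : E →L[ℝ] E) (W z)) =
      W z := by
    have h2 := (hmd b G).hasMFDerivAt.comp z (hmd (-b) z).hasMFDerivAt
    have h3 : S b ∘ S (-b) = id := funext fun y => hS.apply_neg hV b y
    rw [h3] at h2
    exact DFunLike.congr_fun (hasMFDerivAt_unique h2 (hasMFDerivAt_id z)) (W z)
  have h2 := hpres b G (mfderiv I I (S (-b)) z (W z)) v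
  have h3 : mvfderiv I (fun y => f (S b y)) G v =
      mvfderiv I f (S b G) (mfderiv I I (S b) G v) := by
    have h4 : HasMFDerivAt I 𝓘(ℝ, ℝ) (fun y => f (S b y)) G _ :=
      (hf.mdifferentiable (by simp) (S b G)).hasMFDerivAt.comp G (hmd b G).hasMFDerivAt
    exact DFunLike.congr_fun h4.mfderiv v
  rw [h3, ← h2]
  have h5 : ∀ (y : N) (_ : y = z) (a a' c : E), a = a' → a' = W z →
      (om y : E →L[ℝ] E →L[ℝ] ℝ) a c = (mvfderiv I f y : E →L[ℝ] ℝ) c := by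
    rintro _ rfl _ _ c rfl rfl
    exact hW _ c
  exact h5 _ hz _ _ _ rfl h1

/-- The curves `b ↦ S (-b) (Φ b x)`, for the flows `S` of `V` and `Φ` of `V + W`, are those of the
Hamiltonian isotopy of `-f ∘ S b`, where `ω(W, ·) = df`. -/
theorem hasMFDerivAt_flow_comp {om : TwoForm I N} (hnd : ∀ x u, (∀ v, om x u v = 0) → u = 0)
    {V W : VectorField I N} (hV : V.IsSmooth) {S Φ : ℝ → N → N} (hS : IsFlow V S)
    (hΦ : IsFlow (fun x => V x + W x) Φ)
    (hpres : ∀ t x (u v : TangentSpace I x),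
      om (S t x) (mfderiv I I (S t) x u) (mfderiv I I (S t) x v) = om x u v)
    {f : N → ℝ} (hf : ContMDiff I 𝓘(ℝ, ℝ) ∞ f) (hW : ∀ x v, om x (W x) v = mvfderiv I f x v)
    (x : N) (b : ℝ) :
    HasMFDerivAt 𝓘(ℝ, ℝ) I (fun b => S (-b) (Φ b x)) b ((1 : ℝ →L[ℝ] ℝ).smulRight
      (hamiltonianVectorField om (fun y => -f (S b y)) (S (-b) (Φ b x)))) := by
  set z := Φ b x with hz
  have hw : mfderiv I I (S (-b)) z (W z) =
      hamiltonianVectorField om (fun y => -f (S b y)) (S (-b) z) := by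
    refine eq_hamiltonianVectorField hnd fun v => ?_
    rw [transport_dual hV hS hpres hf hW]
    have h1 : MDifferentiableAt I 𝓘(ℝ, ℝ) (fun y => f (S b y)) (S (-b) z) :=
      (hf.comp (hS.contMDiff_apply hV b)).mdifferentiable (by simp) _
    have h2 : HasMFDerivAt I 𝓘(ℝ, ℝ) (fun y => -f (S b y)) (S (-b) z) _ := h1.hasMFDerivAt.neg
    have h3 := DFunLike.congr_fun h2.mfderiv v
    exact (neg_eq_iff_eq_neg.2 h3).symm
  have hU := (hS.contMDiff hV).mdifferentiable (by simp) (-b, z)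
  have hneg : HasMFDerivAt 𝓘(ℝ, ℝ) 𝓘(ℝ, ℝ) (fun b : ℝ => -b) b (-1 : ℝ →L[ℝ] ℝ) :=
    (hasFDerivAt_id b).neg.hasMFDerivAt
  have h1 := hU.hasMFDerivAt.comp b (hneg.prodMk (hΦ.2 x b))
  refine h1.congr_mfderiv ?_
  ext
  rw [← hw]
  let a : E := V z
  let r : E := W z
  have h2 := mfderiv_prod_eq_add_apply hU (v := ((-1 : ℝ), (1 : ℝ) • (a + r)))
  have h3 := (hS.2 z (-b)).mfderiv
  have h4 := hS.mfderiv_apply_self hV (-b) z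
  have h5 : ∀ (A : ℝ →L[ℝ] E) (B : E →L[ℝ] E) (a w r c : E),
      A = (1 : ℝ →L[ℝ] ℝ).smulRight a → B w = a → c = A (-1) + B ((1 : ℝ) • (w + r)) →
        c = (1 : ℝ) • B r := by
    rintro _ B _ w r _ rfl rfl rfl
    simp
  exact h5 _ _ _ _ _ _ h3 h4 h2

theorem hamiltonianVectorField_const_mul (om : TwoForm I N) (c : ℝ) {h : N → ℝ} {x : N}
    (hh : MDifferentiableAt I 𝓘(ℝ, ℝ) h x) :
    hamiltonianVectorField om (fun y => c * h y) x = c • hamiltonianVectorField om h x := by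
  have h1 : mvfderiv I (fun y => c * h y) x = c • mvfderiv I h x := by
    have h2 : HasMFDerivAt I 𝓘(ℝ, ℝ) (fun y => c * h y) x _ := hh.hasMFDerivAt.const_smul c
    exact h2.mfderiv
  have h3 : ∀ (A : (E →L[ℝ] ℝ) →L[ℝ] E) (a b : E →L[ℝ] ℝ), a = c • b → A (-a) = c • A (-b) := by
    rintro A _ b rfl
    rw [map_neg, map_neg, map_smul, smul_neg]
  exact h3 (om x).inverse _ _ h1

/-- Let `S` be the flow of `V`, preserving `ω`, and `Φ` the flow of `V + W`, where `ω(W, ·) = df`. The maps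
`S (-b) ∘ Φ b` form a Hamiltonian isotopy, generated by `-f ∘ S b`, so a set displaced by one of them is
displaceable. The isotopy is reparametrized to make its generating function periodic in time. -/
theorem displaceable_of_flows {om : TwoForm I N} (hnd : ∀ x u, (∀ v, om x u v = 0) → u = 0)
    {V W : VectorField I N} (hV : V.IsSmooth) (hWs : W.IsSmooth) {S Φ : ℝ → N → N}
    (hS : IsFlow V S) (hΦ : IsFlow (fun x => V x + W x) Φ)
    (hpres : ∀ t x (u v : TangentSpace I x),
      om (S t x) (mfderiv I I (S t) x u) (mfderiv I I (S t) x v) = om x u v)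
    {f : N → ℝ} (hf : ContMDiff I 𝓘(ℝ, ℝ) ∞ f) (hfc : HasCompactSupport f)
    (hW : ∀ x v, om x (W x) v = mvfderiv I f x v) {Y : Set N} (τ : ℝ)
    (hdisj : Disjoint (closure Y) ((fun y => S (-τ) (Φ τ y)) '' Y)) : Displaceable om Y := by
  have hVW := hV.add hWs
  -- the time is reparametrized so that the isotopy is at rest near the integers
  set β : ℝ → ℝ := fun s => τ * Real.smoothTransition (3 * s - 1) with hβ
  have hβs : ContDiff ℝ ∞ β := contDiff_const.mul
    (Real.smoothTransition.contDiff.comp ((contDiff_const.mul contDiff_id).sub contDiff_const))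
  have hβ0 : ∀ s ≤ 1 / 3, β s = 0 := fun s hs => by
    simp only [hβ]
    rw [Real.smoothTransition.zero_of_nonpos (by linarith), mul_zero]
  have hβ1 : ∀ s ≥ 2 / 3, β s = τ := fun s hs => by
    simp only [hβ]
    rw [Real.smoothTransition.one_of_one_le (by linarith), mul_one]
  have hdβ0 : ∀ s < 1 / 3, deriv β s = 0 := fun s hs => by
    have h1 : β =ᶠ[𝓝 s] fun _ => 0 := by
      filter_upwards [Iio_mem_nhds hs] with r hr
      exact hβ0 r (le_of_lt hr)
    rw [h1.deriv_eq, deriv_const]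
  have hdβ1 : ∀ s > 2 / 3, deriv β s = 0 := fun s hs => by
    have h1 : β =ᶠ[𝓝 s] fun _ => τ := by
      filter_upwards [Ioi_mem_nhds hs] with r hr
      exact hβ1 r (le_of_lt hr)
    rw [h1.deriv_eq, deriv_const]
  have hdβs : ContDiff ℝ ∞ (deriv β) := (contDiff_infty_iff_deriv.1 hβs).2
  set k : ℝ → N → ℝ := fun s x => deriv β s * -f (S (β s) x) with hk
  have hks : ContMDiff (𝓘(ℝ, ℝ).prod I) 𝓘(ℝ, ℝ) ∞ (fun z : ℝ × N => k z.1 z.2) := by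
    have h1 : ContMDiff (𝓘(ℝ, ℝ).prod I) (𝓘(ℝ, ℝ).prod I) ∞
        (fun z : ℝ × N => (β z.1, z.2)) :=
      (hβs.contMDiff.comp contMDiff_fst).prodMk contMDiff_snd
    exact (hdβs.contMDiff.comp contMDiff_fst).mul
      (hf.comp ((hS.contMDiff hV).comp h1)).neg
  let G : Equiv.Perm N :=
    { toFun := fun x => S (-τ) (Φ τ x)
      invFun := fun x => Φ (-τ) (S τ x)
      left_inv := fun x => by
        dsimp only
        rw [hS.apply_neg hV, hΦ.neg_apply hVW]
      right_inv := fun x => by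
        dsimp only
        rw [hΦ.apply_neg hVW, hS.neg_apply hV] }
  set g : ℝ → N → N := fun b x => S (-b) (Φ b x) with hg
  have hg0 : ∀ x, g 0 x = x := fun x => by simp only [hg, neg_zero]; rw [hS.1, hΦ.1]
  have hgτ : ∀ x, g τ x = G x := fun x => rfl
  have hgd : ∀ x s, HasMFDerivAt 𝓘(ℝ, ℝ) I (fun s => g (β s) x) s
      ((1 : ℝ →L[ℝ] ℝ).smulRight (hamiltonianVectorField om (k s) (g (β s) x))) := by
    intro x s
    have h1 := hasMFDerivAt_flow_comp hnd hV hS hΦ hpres hf hW x (β s)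
    have h2 : HasMFDerivAt 𝓘(ℝ, ℝ) 𝓘(ℝ, ℝ) β s ((1 : ℝ →L[ℝ] ℝ).smulRight (deriv β s)) :=
      ((hβs.differentiable (by simp) s).hasDerivAt.hasFDerivAt).hasMFDerivAt
    refine (h1.comp s h2).congr_mfderiv ?_
    have h3 := hamiltonianVectorField_const_mul om (deriv β s)
      (((hf.comp (hS.contMDiff_apply hV (β s))).neg).mdifferentiable (by simp) (g (β s) x))
    have h4 : ∀ (c : ℝ) (a a' : E), a' = c • a → ((1 : ℝ →L[ℝ] ℝ).smulRight a).comp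
        ((1 : ℝ →L[ℝ] ℝ).smulRight c) = (1 : ℝ →L[ℝ] ℝ).smulRight a' := by
      rintro c a _ rfl
      ext
      simp
    exact h4 _ _ _ h3
  have hfloor : ∀ t₀ : ℝ, Ioo ((⌊t₀⌋ : ℝ) - 1 / 3) (⌊t₀⌋ + 4 / 3) ∈ 𝓝 t₀ := fun t₀ =>
    Ioo_mem_nhds (by linarith [Int.floor_le t₀]) (by linarith [Int.lt_floor_add_one t₀])
  have hcases : ∀ (m : ℤ) (t : ℝ), t ∈ Ioo ((m : ℝ) - 1 / 3) (m + 4 / 3) →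
      (⌊t⌋ = m - 1 ∧ t - m < 0) ∨ (⌊t⌋ = m ∧ 0 ≤ t - m) ∨ (⌊t⌋ = m + 1 ∧ 1 ≤ t - m) := by
    intro m t ht
    rcases lt_or_ge t m with h | h
    · refine Or.inl ⟨?_, by linarith⟩
      rw [Int.floor_eq_iff]
      push_cast
      constructor <;> linarith [ht.1]
    · rcases lt_or_ge t (m + 1) with h' | h'
      · refine Or.inr (Or.inl ⟨?_, by linarith⟩)
        rw [Int.floor_eq_iff]
        exact ⟨h, h'⟩
      · refine Or.inr (Or.inr ⟨?_, by linarith⟩)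
        rw [Int.floor_eq_iff]
        push_cast
        constructor <;> linarith [ht.2]
  have hF : ∀ (m : ℤ) (t : ℝ), t ∈ Ioo ((m : ℝ) - 1 / 3) (m + 4 / 3) →
      k (t - ⌊t⌋) = k (t - m) := by
    intro m t ht
    funext x
    simp only [hk]
    rcases hcases m t ht with ⟨h, h'⟩ | ⟨h, h'⟩ | ⟨h, h'⟩ <;> rw [h] <;> push_cast
    · rw [hdβ0 (t - m) (by linarith), hdβ1 (t - (m - 1)) (by linarith [ht.1])]
      simp
    · rw [hdβ1 (t - m) (by linarith), hdβ0 (t - (m + 1)) (by linarith [ht.2])]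
      simp
  have hφ : ∀ (m : ℤ) (t : ℝ), t ∈ Ioo ((m : ℝ) - 1 / 3) (m + 4 / 3) → ∀ x,
      g (β (t - ⌊t⌋)) ((G ^ ⌊t⌋) x) = g (β (t - m)) ((G ^ m) x) := by
    intro m t ht x
    rcases hcases m t ht with ⟨h, h'⟩ | ⟨h, h'⟩ | ⟨h, h'⟩ <;> rw [h] <;> push_cast
    · rw [hβ0 (t - m) (by linarith), hβ1 (t - (m - 1)) (by linarith [ht.1]), hg0, hgτ,
        ← Equiv.Perm.mul_apply, ← zpow_one_add]
      congr 2
      ring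
    · rw [hβ1 (t - m) (by linarith), hβ0 (t - (m + 1)) (by linarith [ht.2]), hg0, hgτ,
        ← Equiv.Perm.mul_apply, ← zpow_one_add]
      congr 2
      ring
  refine ⟨fun t x => k (t - ⌊t⌋) x, fun t x => g (β (t - ⌊t⌋)) ((G ^ ⌊t⌋) x), ?_, ?_, ?_, ?_, ?_,
    ?_⟩
  · rintro ⟨t₀, x₀⟩
    have h1 : ContMDiff (𝓘(ℝ, ℝ).prod I) 𝓘(ℝ, ℝ) ∞ (fun z : ℝ × N => k (z.1 - ⌊t₀⌋) z.2) := by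
      have h2 : ContMDiff (𝓘(ℝ, ℝ).prod I) (𝓘(ℝ, ℝ).prod I) ∞
          (fun z : ℝ × N => (z.1 - ⌊t₀⌋, z.2)) :=
        (contMDiff_fst.sub contMDiff_const).prodMk contMDiff_snd
      exact hks.comp h2
    refine (h1 (t₀, x₀)).congr_of_eventuallyEq ?_
    filter_upwards [continuousAt_fst.preimage_mem_nhds (hfloor t₀)] with z hz
    exact congrFun (hF _ _ hz) _
  · intro t x
    dsimp only
    rw [Int.floor_add_one]
    push_cast
    rw [add_sub_add_right_eq_sub]
  · refine ⟨(fun z : ℝ × N => S z.1 z.2) '' (Icc (-|τ|) |τ| ×ˢ tsupport f),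
      (isCompact_Icc.prod hfc).image (hS.continuous hV), fun t x hx => ?_⟩
    simp only [hk]
    have h1 : f (S (β (t - ⌊t⌋)) x) = 0 := by
      by_contra hne
      refine hx ⟨(-β (t - ⌊t⌋), S (β (t - ⌊t⌋)) x), ⟨abs_le.1 ?_, subset_tsupport _ hne⟩,
        hS.neg_apply hV _ _⟩
      rw [abs_neg]
      simp only [hβ]
      rw [abs_mul, abs_of_nonneg (Real.smoothTransition.nonneg _)]
      exact mul_le_of_le_one_right (abs_nonneg _) (Real.smoothTransition.le_one _)
    rw [h1]
    simp
  · intro x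
    dsimp only
    rw [Int.floor_zero, zpow_zero]
    simp only [Int.cast_zero, sub_zero, Equiv.Perm.coe_one, id]
    rw [hβ0 0 (by norm_num), hg0]
  · intro x t₀
    have h1 := hgd ((G ^ ⌊t₀⌋) x) (t₀ - ⌊t₀⌋)
    have h2 : HasMFDerivAt 𝓘(ℝ, ℝ) 𝓘(ℝ, ℝ) (fun t : ℝ => t - ⌊t₀⌋) t₀ (1 : ℝ →L[ℝ] ℝ) :=
      ((hasFDerivAt_id t₀).sub_const _).hasMFDerivAt
    refine ((h1.comp t₀ h2).congr_of_eventuallyEq ?_)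
    filter_upwards [hfloor t₀] with t ht
    exact hφ _ _ ht x
  · have h1 : (fun x => g (β ((1 : ℝ) - ⌊(1 : ℝ)⌋)) ((G ^ ⌊(1 : ℝ)⌋) x)) =
        fun y => S (-τ) (Φ τ y) := by
      funext x
      rw [Int.floor_one, zpow_one, Int.cast_one, sub_self, hβ0 0 (by norm_num), hg0]
      rfl
    dsimp only
    rw [h1]
    exact hdisj

end Displacement

/-! ### The manifold `M × (B × Tⁿ)` in product charts -/

section Charts

variable {E : Type*} [NormedAddCommGroup E] [NormedSpace ℝ E]
  {H : Type*} [TopologicalSpace H] {I : ModelWithCorners ℝ E H} [I.Boundaryless]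
  {N : Type*} [TopologicalSpace N] [ChartedSpace H N] [IsManifold I ∞ N]

theorem mfderiv_extChartAt_self (x₀ : N) (v : TangentSpace I x₀) :
    mfderiv I 𝓘(ℝ, E) (extChartAt I x₀) x₀ v = v := by
  have hy := mem_extChartAt_target (I := I) x₀
  have h1 := mfderiv_chart_comp_symm (I := I) x₀ hy v
  have h2 := mfderiv_chart_symm_self (I := I) x₀ v
  have h3 : ∀ (z : N) (_ : z = x₀) (B : E →L[ℝ] E) (v : E), B v = v →
      (mfderiv I 𝓘(ℝ, E) (extChartAt I x₀) z : E →L[ℝ] E) (B v) = v →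
      (mfderiv I 𝓘(ℝ, E) (extChartAt I x₀) x₀ : E →L[ℝ] E) v = v := by
    rintro _ rfl B v hB h
    rwa [hB] at h
  exact h3 _ (extChartAt_to_inv x₀) _ _ h2 h1

theorem contMDiff_of_inChart {f : N → ℝ}
    (h : ∀ x₀ : N, ContDiffOn ℝ ∞ (fun y => f ((extChartAt I x₀).symm y))
      (extChartAt I x₀).target) : ContMDiff I 𝓘(ℝ, ℝ) ∞ f := by
  intro x₀
  have h2 := (h x₀).contMDiffOn.comp (contMDiffOn_extChartAt (I := I) (n := ∞) (x := x₀))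
    (fun z hz => by
      rw [← extChartAt_source I] at hz
      exact (extChartAt I x₀).map_source hz)
  have hn := (chartAt H x₀).open_source.mem_nhds (mem_chart_source H x₀)
  refine (h2.contMDiffAt hn).congr_of_eventuallyEq ?_
  filter_upwards [hn] with x hx
  rw [← extChartAt_source I] at hx
  rw [Function.comp_apply, (extChartAt I x₀).left_inv hx]

/-- A map `f : E → N` that is a translation in the preferred chart of `N` at `f y` has derivative the
identity at `y`, in the identification of `T_{f y} N` with `E` through that chart. -/
theorem hasMFDerivAt_of_eventuallyEq_add {f : E → N} {y c : E} (hc : ContinuousAt f y)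
    (h : ∀ᶠ z in 𝓝 y, extChartAt I (f y) (f z) = z + c) :
    HasMFDerivAt 𝓘(ℝ, E) I f y (ContinuousLinearMap.id ℝ E) := by
  refine ⟨hc, ?_⟩
  have h1 : HasFDerivAt (fun z : E => z + c) (ContinuousLinearMap.id ℝ E) y :=
    (hasFDerivAt_id y).add_const c
  have h2 : writtenInExtChartAt 𝓘(ℝ, E) I y f = fun z => extChartAt I (f y) (f z) := by
    rfl
  rw [h2]
  exact (h1.congr_of_eventuallyEq h).hasFDerivWithinAt

end Charts

section Torus

variable {n : ℕ}

theorem Torus.extChartAt_symm_apply (q₀ : Torus n) (y : Fin n → ℝ) :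
    (extChartAt 𝓘(ℝ, Fin n → ℝ) q₀).symm y = Torus.proj n y := by
  have h := (Torus.isLocalHomeomorph_proj n).localInverseAt_symm
    (x := (Torus.proj_surjective n q₀).choose)
  exact congrFun h y

theorem Torus.proj_extChartAt (q₀ : Torus n) {q : Torus n}
    (hq : q ∈ (extChartAt 𝓘(ℝ, Fin n → ℝ) q₀).source) :
    Torus.proj n (extChartAt 𝓘(ℝ, Fin n → ℝ) q₀ q) = q := by
  rw [← Torus.extChartAt_symm_apply q₀, (extChartAt _ q₀).left_inv hq]

theorem Torus.proj_add (a b : Fin n → ℝ) :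
    Torus.proj n (a + b) = Torus.proj n a + Torus.proj n b := rfl

theorem Torus.proj_sub (a b : Fin n → ℝ) :
    Torus.proj n (a - b) = Torus.proj n a - Torus.proj n b := rfl

theorem Torus.proj_intCast (k : Fin n → ℤ) : Torus.proj n (fun i => (k i : ℝ)) = 0 := by
  funext i
  exact (AddCircle.coe_eq_zero_iff 1).2 ⟨k i, by simp⟩

theorem Torus.exists_intCast_of_proj_eq {a b : Fin n → ℝ} (h : Torus.proj n a = Torus.proj n b) :
    ∃ k : Fin n → ℤ, a = b + fun i => (k i : ℝ) := by
  have h1 : ∀ i, ∃ k : ℤ, a i = b i + k := by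
    intro i
    have h2 := congrFun h i
    simp only [Torus.proj] at h2
    rw [← sub_eq_zero, ← AddCircle.coe_sub, AddCircle.coe_eq_zero_iff] at h2
    obtain ⟨k, hk⟩ := h2
    exact ⟨k, by simp at hk; linarith⟩
  choose k hk using h1
  exact ⟨k, funext hk⟩

theorem Torus.continuous_proj (n : ℕ) : Continuous (Torus.proj n) :=
  (Torus.isLocalHomeomorph_proj n).continuous

/-- In the charts of the torus, the covering projection is locally a translation. -/
theorem Torus.hasMFDerivAt_proj (y : Fin n → ℝ) :
    HasMFDerivAt 𝓘(ℝ, Fin n → ℝ) 𝓘(ℝ, Fin n → ℝ) (Torus.proj n) y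
      (ContinuousLinearMap.id ℝ (Fin n → ℝ)) := by
  set q₀ := Torus.proj n y with hq₀
  set c := extChartAt 𝓘(ℝ, Fin n → ℝ) q₀ q₀ with hc
  have hct : c ∈ (extChartAt 𝓘(ℝ, Fin n → ℝ) q₀).target := mem_extChartAt_target q₀
  have hpc : Torus.proj n c = q₀ := Torus.proj_extChartAt q₀ (mem_extChartAt_source q₀)
  refine hasMFDerivAt_of_eventuallyEq_add (c := c - y)
    (Torus.continuous_proj n).continuousAt ?_
  have h1 : ContinuousAt (fun z : Fin n → ℝ => z + (c - y)) y := by fun_prop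
  have h2 : (extChartAt 𝓘(ℝ, Fin n → ℝ) q₀).target ∈ 𝓝 (y + (c - y)) := by
    rw [add_sub_cancel]
    exact (isOpen_extChartAt_target q₀).mem_nhds hct
  filter_upwards [h1.preimage_mem_nhds h2] with z hz
  have h3 : Torus.proj n z = Torus.proj n (z + (c - y)) := by
    rw [Torus.proj_add, Torus.proj_sub, hpc, sub_self, add_zero]
  have h4 := (extChartAt 𝓘(ℝ, Fin n → ℝ) q₀).right_inv hz
  rw [Torus.extChartAt_symm_apply] at h4
  rw [h3]
  exact h4

theorem Torus.hasMFDerivAt_chart_symm (q₀ : Torus n) (y : Fin n → ℝ) :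
    HasMFDerivAt 𝓘(ℝ, Fin n → ℝ) 𝓘(ℝ, Fin n → ℝ) (extChartAt 𝓘(ℝ, Fin n → ℝ) q₀).symm y
      (ContinuousLinearMap.id ℝ (Fin n → ℝ)) := by
  have h : ((extChartAt 𝓘(ℝ, Fin n → ℝ) q₀).symm : (Fin n → ℝ) → Torus n) =
      Torus.proj n := funext (Torus.extChartAt_symm_apply q₀)
  rw [h]
  exact Torus.hasMFDerivAt_proj y

theorem Torus.dq_apply (i : Fin n) (q : Torus n) (w : Fin n → ℝ) : Torus.dq i q w = w i := by
  have := isManifold_one (I := 𝓘(ℝ, Fin n → ℝ)) (N := Torus n)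
  have h1 : MDifferentiableAt 𝓘(ℝ, Fin n → ℝ) 𝓘(ℝ, Fin n → ℝ)
      (extChartAt 𝓘(ℝ, Fin n → ℝ) q) q := mdifferentiableAt_extChartAt (mem_chart_source _ q)
  have h2 : HasMFDerivAt 𝓘(ℝ, Fin n → ℝ) 𝓘(ℝ, ℝ)
      (fun q' => chartAt (Fin n → ℝ) q q' i) q _ :=
    ((ContinuousLinearMap.proj (R := ℝ) (φ := fun _ : Fin n => ℝ) i).hasFDerivAt.hasMFDerivAt).comp
      q h1.hasMFDerivAt
  have h3 := DFunLike.congr_fun h2.mfderiv w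
  refine h3.trans ?_
  exact congrFun (mfderiv_extChartAt_self (I := 𝓘(ℝ, Fin n → ℝ)) q w) i

end Torus

section Product

variable {E : Type*} [NormedAddCommGroup E] [NormedSpace ℝ E]
  {H : Type*} [TopologicalSpace H] {I : ModelWithCorners ℝ E H} [I.Boundaryless]
  {M : Type*} [TopologicalSpace M] [ChartedSpace H M] [IsManifold I ∞ M]
  {n : ℕ} {B : Type*} [TopologicalSpace B] [ChartedSpace (Fin n → ℝ) B]
  [IsManifold 𝓘(ℝ, Fin n → ℝ) ∞ B] {p : B → Fin n → ℝ}

theorem hasMFDerivAt_coordinate (hp : ∀ b z, extChartAt 𝓘(ℝ, Fin n → ℝ) b z = p z) (b : B) :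
    HasMFDerivAt 𝓘(ℝ, Fin n → ℝ) 𝓘(ℝ, Fin n → ℝ) p b (ContinuousLinearMap.id ℝ (Fin n → ℝ)) := by
  have := isManifold_one (I := 𝓘(ℝ, Fin n → ℝ)) (N := B)
  have h1 : MDifferentiableAt 𝓘(ℝ, Fin n → ℝ) 𝓘(ℝ, Fin n → ℝ)
      (extChartAt 𝓘(ℝ, Fin n → ℝ) b) b := mdifferentiableAt_extChartAt (mem_chart_source _ b)
  have h2 : (extChartAt 𝓘(ℝ, Fin n → ℝ) b : B → Fin n → ℝ) = p := funext (hp b)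
  have h3 := h1.hasMFDerivAt
  have h4 : (mfderiv 𝓘(ℝ, Fin n → ℝ) 𝓘(ℝ, Fin n → ℝ) (extChartAt 𝓘(ℝ, Fin n → ℝ) b) b :
      (Fin n → ℝ) →L[ℝ] Fin n → ℝ) = ContinuousLinearMap.id ℝ (Fin n → ℝ) :=
    ContinuousLinearMap.ext fun v => mfderiv_extChartAt_self (I := 𝓘(ℝ, Fin n → ℝ)) b v
  have h5 := h3.congr_mfderiv h4
  rwa [h2] at h5

theorem coordinate_chart_symm (hp : ∀ b z, extChartAt 𝓘(ℝ, Fin n → ℝ) b z = p z) (b : B)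
    {y : Fin n → ℝ} (hy : y ∈ (extChartAt 𝓘(ℝ, Fin n → ℝ) b).target) :
    p ((extChartAt 𝓘(ℝ, Fin n → ℝ) b).symm y) = y := by
  rw [← hp b, (extChartAt 𝓘(ℝ, Fin n → ℝ) b).right_inv hy]

theorem hasMFDerivAt_coordinate_chart_symm
    (hp : ∀ b z, extChartAt 𝓘(ℝ, Fin n → ℝ) b z = p z) (b : B)
    {y : Fin n → ℝ} (hy : y ∈ (extChartAt 𝓘(ℝ, Fin n → ℝ) b).target) :
    HasMFDerivAt 𝓘(ℝ, Fin n → ℝ) 𝓘(ℝ, Fin n → ℝ) (extChartAt 𝓘(ℝ, Fin n → ℝ) b).symm y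
      (ContinuousLinearMap.id ℝ (Fin n → ℝ)) := by
  refine hasMFDerivAt_of_eventuallyEq_add (c := 0)
    (hasMFDerivAt_chart_symm (I := 𝓘(ℝ, Fin n → ℝ)) b hy).continuousAt ?_
  filter_upwards [(isOpen_extChartAt_target b).mem_nhds hy] with z hz
  rw [hp, coordinate_chart_symm hp b hz, add_zero]

/-- The derivative of a product chart: only the chart of `M` contributes a nontrivial part. -/
theorem mfderiv_prod_chart_symm (hp : ∀ b z, extChartAt 𝓘(ℝ, Fin n → ℝ) b z = p z)
    (x₀ : M × (B × Torus n)) {y : E × ((Fin n → ℝ) × (Fin n → ℝ))}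
    (hy : y ∈ (extChartAt (I.prod (phaseModel n)) x₀).target)
    (u : E × ((Fin n → ℝ) × (Fin n → ℝ))) :
    mfderiv 𝓘(ℝ, E × ((Fin n → ℝ) × (Fin n → ℝ))) (I.prod (phaseModel n))
      (extChartAt (I.prod (phaseModel n)) x₀).symm y u =
      ((mfderiv 𝓘(ℝ, E) I (extChartAt I x₀.1).symm y.1 : E →L[ℝ] E) u.1, u.2) := by
  rw [extChartAt_prod, extChartAt_prod] at hy
  have h1 : HasMFDerivAt 𝓘(ℝ, E × ((Fin n → ℝ) × (Fin n → ℝ))) I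
      (fun z : E × ((Fin n → ℝ) × (Fin n → ℝ)) => (extChartAt I x₀.1).symm z.1) y _ :=
    (hasMFDerivAt_chart_symm x₀.1 hy.1).comp y (hasFDerivAt_fst (𝕜 := ℝ)).hasMFDerivAt
  have h2 : HasMFDerivAt 𝓘(ℝ, E × ((Fin n → ℝ) × (Fin n → ℝ))) 𝓘(ℝ, Fin n → ℝ)
      (fun z : E × ((Fin n → ℝ) × (Fin n → ℝ)) =>
        (extChartAt 𝓘(ℝ, Fin n → ℝ) x₀.2.1).symm z.2.1) y _ :=
    (hasMFDerivAt_coordinate_chart_symm hp x₀.2.1 hy.2.1).comp y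
      (((hasFDerivAt_fst (𝕜 := ℝ)).comp y (hasFDerivAt_snd (𝕜 := ℝ))).hasMFDerivAt)
  have h3 : HasMFDerivAt 𝓘(ℝ, E × ((Fin n → ℝ) × (Fin n → ℝ))) 𝓘(ℝ, Fin n → ℝ)
      (fun z : E × ((Fin n → ℝ) × (Fin n → ℝ)) =>
        (extChartAt 𝓘(ℝ, Fin n → ℝ) x₀.2.2).symm z.2.2) y _ :=
    (Torus.hasMFDerivAt_chart_symm x₀.2.2 y.2.2).comp y
      (((hasFDerivAt_snd (𝕜 := ℝ)).comp y (hasFDerivAt_snd (𝕜 := ℝ))).hasMFDerivAt)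
  have h5 := h1.prodMk (h2.prodMk h3)
  have h6 := DFunLike.congr_fun h5.mfderiv u
  rw [extChartAt_prod, extChartAt_prod]
  exact h6

theorem canonicalForm_apply (hp : ∀ b z, extChartAt 𝓘(ℝ, Fin n → ℝ) b z = p z) (z : B × Torus n)
    (u v : (Fin n → ℝ) × (Fin n → ℝ)) :
    canonicalForm p z u v = ∑ i, (u.1 i * v.2 i - v.1 i * u.2 i) := by
  have h1 : ∀ (i : Fin n) (u : (Fin n → ℝ) × (Fin n → ℝ)),
      mvfderiv (phaseModel n) (fun z' : B × Torus n => p z'.1 i) z u = u.1 i := by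
    intro i u
    have h2 : HasMFDerivAt (phaseModel n) 𝓘(ℝ, ℝ) (fun z' : B × Torus n => p z'.1 i) z _ :=
      ((ContinuousLinearMap.proj (R := ℝ) (φ := fun _ : Fin n => ℝ)
        i).hasFDerivAt.hasMFDerivAt).comp z ((hasMFDerivAt_coordinate hp z.1).comp z
          (hasMFDerivAt_fst z))
    exact DFunLike.congr_fun h2.mfderiv u
  have h2 : ∀ (i : Fin n) (u : (Fin n → ℝ) × (Fin n → ℝ)),
      (Torus.dq i z.2).comp (mfderiv (phaseModel n) 𝓘(ℝ, Fin n → ℝ) Prod.snd z) u = u.2 i := by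
    intro i u
    refine Eq.trans ?_ (Torus.dq_apply i z.2 u.2)
    exact congrArg (Torus.dq i z.2) (DFunLike.congr_fun (hasMFDerivAt_snd z).mfderiv u)
  have h3 : ∀ (s : Finset (Fin n)) (F : Fin n → TwoForm (phaseModel n) (B × Torus n)),
      (∑ i ∈ s, F i) z u v = ∑ i ∈ s, F i z u v := by
    intro s F
    rw [Finset.sum_apply]
    have h4 : ∀ G : Fin n → (((Fin n → ℝ) × (Fin n → ℝ)) →L[ℝ]
        ((Fin n → ℝ) × (Fin n → ℝ)) →L[ℝ] ℝ), (∑ i ∈ s, G i) u v = ∑ i ∈ s, G i u v := by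
      intro G
      simp
    exact h4 fun i => F i z
  rw [canonicalForm, h3]
  refine Finset.sum_congr rfl fun i _ => ?_
  have h4 : ∀ (a b : ((Fin n → ℝ) × (Fin n → ℝ)) →L[ℝ] ℝ), (∀ u, a u = u.1 i) →
      (∀ u, b u = u.2 i) → (a.smulRight b - b.smulRight a) u v =
        u.1 i * v.2 i - v.1 i * u.2 i := by
    intro a b ha hb
    simp [ha, hb, mul_comm]
  exact h4 _ _ (h1 i) (h2 i)

theorem stabilizedForm_apply (om : SymplecticForm I M)
    (hp : ∀ b z, extChartAt 𝓘(ℝ, Fin n → ℝ) b z = p z) (z : M × (B × Torus n))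
    (u v : E × ((Fin n → ℝ) × (Fin n → ℝ))) :
    stabilizedForm om p z u v = (om.form z.1 : E →L[ℝ] E →L[ℝ] ℝ) u.1 v.1 +
      ∑ i, (u.2.1 i * v.2.2 i - v.2.1 i * u.2.2 i) := by
  have h1 : ∀ u : E × ((Fin n → ℝ) × (Fin n → ℝ)),
      mfderiv (I.prod (phaseModel n)) I (Prod.fst : M × (B × Torus n) → M) z u = u.1 :=
    fun u => DFunLike.congr_fun (hasMFDerivAt_fst z).mfderiv u
  have h2 : ∀ u : E × ((Fin n → ℝ) × (Fin n → ℝ)),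
      mfderiv (I.prod (phaseModel n)) (phaseModel n) (Prod.snd : M × (B × Torus n) → _) z u =
        u.2 :=
    fun u => DFunLike.congr_fun (hasMFDerivAt_snd z).mfderiv u
  have h3 : TwoForm.pullback (J := I.prod (phaseModel n)) Prod.fst om.form z u v =
      (om.form z.1 : E →L[ℝ] E →L[ℝ] ℝ) u.1 v.1 :=
    congrArg₂ (fun a b => (om.form z.1 : E →L[ℝ] E →L[ℝ] ℝ) a b) (h1 u) (h1 v)
  have h4 : TwoForm.pullback (J := I.prod (phaseModel n)) Prod.snd (canonicalForm p) z u v =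
      ∑ i, (u.2.1 i * v.2.2 i - v.2.1 i * u.2.2 i) :=
    (congrArg₂ (fun a b => canonicalForm p z.2 a b) (h2 u) (h2 v)).trans
      (canonicalForm_apply hp z.2 u.2 v.2)
  exact congrArg₂ (· + ·) h3 h4

end Product

section ProductForms

variable {E : Type*} [NormedAddCommGroup E] [NormedSpace ℝ E]
  {H : Type*} [TopologicalSpace H] {I : ModelWithCorners ℝ E H} [I.Boundaryless]
  {M : Type*} [TopologicalSpace M] [ChartedSpace H M] [IsManifold I ∞ M]
  {n : ℕ} {B : Type*} [TopologicalSpace B] [ChartedSpace (Fin n → ℝ) B]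
  [IsManifold 𝓘(ℝ, Fin n → ℝ) ∞ B] {p : B → Fin n → ℝ}

theorem stabilizedForm_alternating (om : SymplecticForm I M)
    (hp : ∀ b z, extChartAt 𝓘(ℝ, Fin n → ℝ) b z = p z) (z : M × (B × Torus n))
    (v : TangentSpace (I.prod (phaseModel n)) z) : stabilizedForm om p z v v = 0 := by
  refine (stabilizedForm_apply om hp z v v).trans ?_
  have h : (om.form z.1 : E →L[ℝ] E →L[ℝ] ℝ) v.1 v.1 = 0 := om.alternating z.1 v.1
  rw [h]
  simp

theorem stabilizedForm_nondegenerate (om : SymplecticForm I M)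
    (hp : ∀ b z, extChartAt 𝓘(ℝ, Fin n → ℝ) b z = p z) (z : M × (B × Torus n))
    (u : TangentSpace (I.prod (phaseModel n)) z) (hu : ∀ v, stabilizedForm om p z u v = 0) :
    u = 0 := by
  have h1 : ∀ v : E × ((Fin n → ℝ) × (Fin n → ℝ)),
      (om.form z.1 : E →L[ℝ] E →L[ℝ] ℝ) u.1 v.1 +
        ∑ i, (u.2.1 i * v.2.2 i - v.2.1 i * u.2.2 i) = 0 :=
    fun v => (stabilizedForm_apply om hp z u v).symm.trans (hu v)
  have h2 : u.1 = 0 := om.nondegenerate z.1 u.1 fun v => by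
    have h := h1 (v, 0)
    simp only [Prod.fst_zero, Prod.snd_zero, Pi.zero_apply, mul_zero, zero_mul, sub_self,
      Finset.sum_const_zero, add_zero] at h
    exact h
  have h5 : ∀ w : (Fin n → ℝ) × (Fin n → ℝ), ∑ i, (u.2.1 i * w.2 i - w.1 i * u.2.2 i) = 0 := by
    intro w
    have h0 : (om.form z.1 : E →L[ℝ] E →L[ℝ] ℝ) u.1 0 = 0 := map_zero _
    exact (zero_add _).symm.trans ((congrArg (· + _) h0.symm).trans (h1 (0, w)))
  have h3 : u.2.1 = 0 := funext fun i => by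
    have h := h5 (0, Pi.single i 1)
    simpa [Pi.single_apply] using h
  have h4 : u.2.2 = 0 := funext fun i => by
    have h := h5 (Pi.single i 1, 0)
    simpa [Pi.single_apply] using h
  exact Prod.ext h2 (Prod.ext h3 h4)

theorem stabilizedForm_inChart (om : SymplecticForm I M)
    (hp : ∀ b z, extChartAt 𝓘(ℝ, Fin n → ℝ) b z = p z) (x₀ : M × (B × Torus n))
    {y : E × ((Fin n → ℝ) × (Fin n → ℝ))}
    (hy : y ∈ (extChartAt (I.prod (phaseModel n)) x₀).target)
    (u v : E × ((Fin n → ℝ) × (Fin n → ℝ))) :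
    (stabilizedForm om p).inChart x₀ y u v = om.form.inChart x₀.1 y.1 u.1 v.1 +
      ∑ i, (u.2.1 i * v.2.2 i - v.2.1 i * u.2.2 i) := by
  have h1 := mfderiv_prod_chart_symm hp x₀ hy u
  have h2 := mfderiv_prod_chart_symm hp x₀ hy v
  refine (congrArg₂ (fun a b => stabilizedForm om p
    ((extChartAt (I.prod (phaseModel n)) x₀).symm y) a b) h1 h2).trans ?_
  exact stabilizedForm_apply om hp _ _ _

theorem mem_target_fst {x₀ : M × (B × Torus n)} {y : E × ((Fin n → ℝ) × (Fin n → ℝ))}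
    (hy : y ∈ (extChartAt (I.prod (phaseModel n)) x₀).target) :
    y.1 ∈ (extChartAt I x₀.1).target := by
  rw [extChartAt_prod] at hy
  exact hy.1

theorem stabilizedForm_contDiffOn_inChart (om : SymplecticForm I M)
    (hp : ∀ b z, extChartAt 𝓘(ℝ, Fin n → ℝ) b z = p z) (x₀ : M × (B × Torus n))
    (u v : E × ((Fin n → ℝ) × (Fin n → ℝ))) :
    ContDiffOn ℝ ∞ (fun y => (stabilizedForm om p).inChart x₀ y u v)
      (extChartAt (I.prod (phaseModel n)) x₀).target := by
  have h1 := om.smooth.contDiffOn_inChart x₀.1 u.1 v.1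
  have h2 : ContDiffOn ℝ ∞ (fun y : E × ((Fin n → ℝ) × (Fin n → ℝ)) =>
      om.form.inChart x₀.1 y.1 u.1 v.1) (extChartAt (I.prod (phaseModel n)) x₀).target :=
    h1.comp contDiff_fst.contDiffOn fun y hy => mem_target_fst hy
  exact (h2.add (contDiffOn_const (c := ∑ i, (u.2.1 i * v.2.2 i - v.2.1 i * u.2.2 i)))).congr
    fun y hy => stabilizedForm_inChart om hp x₀ hy u v

/-- The derivative of a function of the first coordinate. -/
theorem fderiv_eq_of_eventuallyEq_fst_add_const {F G : Type*} [NormedAddCommGroup F]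
    [NormedSpace ℝ F] [NormedAddCommGroup G] [NormedSpace ℝ G] {f : F × G → ℝ} {g : F → ℝ} {c : ℝ}
    {y : F × G} (hg : DifferentiableAt ℝ g y.1) (h : f =ᶠ[𝓝 y] fun z => g z.1 + c) (u : F × G) :
    fderiv ℝ f y u = fderiv ℝ g y.1 u.1 := by
  have h1 : HasFDerivAt (fun z : F × G => g z.1 + c)
      ((fderiv ℝ g y.1).comp (ContinuousLinearMap.fst ℝ F G)) y :=
    (hg.hasFDerivAt.comp y hasFDerivAt_fst).add_const c
  rw [h.fderiv_eq, h1.fderiv]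
  rfl

theorem stabilizedForm_isClosed (om : SymplecticForm I M)
    (hp : ∀ b z, extChartAt 𝓘(ℝ, Fin n → ℝ) b z = p z) :
    (stabilizedForm om p).IsClosed := by
  intro x₀ y hy u v w
  have hn := (isOpen_extChartAt_target x₀).mem_nhds hy
  have h1 : ∀ a b c : E × ((Fin n → ℝ) × (Fin n → ℝ)),
      fderiv ℝ (fun z => (stabilizedForm om p).inChart x₀ z a b) y c =
        fderiv ℝ (fun z => om.form.inChart x₀.1 z a.1 b.1) y.1 c.1 := by
    intro a b c
    refine fderiv_eq_of_eventuallyEq_fst_add_const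
      (c := ∑ i, (a.2.1 i * b.2.2 i - b.2.1 i * a.2.2 i)) ?_ ?_ c
    · exact ((om.smooth.contDiffOn_inChart x₀.1 a.1 b.1).contDiffAt
        ((isOpen_extChartAt_target x₀.1).mem_nhds (mem_target_fst hy))).differentiableAt (by simp)
    · filter_upwards [hn] with z hz
      exact stabilizedForm_inChart om hp x₀ hz a b
  rw [h1, h1, h1]
  exact om.closed x₀.1 y.1 (mem_target_fst hy) u.1 v.1 w.1

/-- The 1-form `pr_M^* λ + ∑ aᵢ dqᵢ` on `M × (B × Tⁿ)`. -/
noncomputable def productForm (lam : OneForm I M) (a : Fin n → ℝ) :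
    OneForm (I.prod (phaseModel n)) (M × (B × Torus n)) :=
  fun z => ((lam z.1 : E →L[ℝ] ℝ).comp (ContinuousLinearMap.fst ℝ E _) +
    ∑ i, a i • (((ContinuousLinearMap.proj i).comp (ContinuousLinearMap.snd ℝ _ _)).comp
      (ContinuousLinearMap.snd ℝ E _)) : E × ((Fin n → ℝ) × (Fin n → ℝ)) →L[ℝ] ℝ)

theorem productForm_apply (lam : OneForm I M) (a : Fin n → ℝ) (z : M × (B × Torus n))
    (u : E × ((Fin n → ℝ) × (Fin n → ℝ))) :
    productForm lam a z u = (lam z.1 : E →L[ℝ] ℝ) u.1 + ∑ i, a i * u.2.2 i := by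
  have h : ∀ L : E →L[ℝ] ℝ, (L.comp (ContinuousLinearMap.fst ℝ E _) +
    ∑ i, a i • (((ContinuousLinearMap.proj i).comp (ContinuousLinearMap.snd ℝ _ _)).comp
      (ContinuousLinearMap.snd ℝ E _)) : E × ((Fin n → ℝ) × (Fin n → ℝ)) →L[ℝ] ℝ) u =
      L u.1 + ∑ i, a i * u.2.2 i := by
    intro L
    simp
  exact h _

theorem productForm_inChart (hp : ∀ b z, extChartAt 𝓘(ℝ, Fin n → ℝ) b z = p z)
    (lam : OneForm I M) (a : Fin n → ℝ) (x₀ : M × (B × Torus n))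
    {y : E × ((Fin n → ℝ) × (Fin n → ℝ))}
    (hy : y ∈ (extChartAt (I.prod (phaseModel n)) x₀).target)
    (u : E × ((Fin n → ℝ) × (Fin n → ℝ))) :
    (productForm lam a : OneForm (I.prod (phaseModel n)) (M × (B × Torus n))).inChart x₀ y u =
      lam.inChart x₀.1 y.1 u.1 + ∑ i, a i * u.2.2 i := by
  have h1 := mfderiv_prod_chart_symm hp x₀ hy u
  refine (congrArg (productForm lam a ((extChartAt (I.prod (phaseModel n)) x₀).symm y)) h1).trans ?_
  exact productForm_apply lam a _ _

theorem productForm_contDiffOn_inChart (hp : ∀ b z, extChartAt 𝓘(ℝ, Fin n → ℝ) b z = p z)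
    {lam : OneForm I M} (hl : lam.IsSmooth) (a : Fin n → ℝ) (x₀ : M × (B × Torus n))
    (u : E × ((Fin n → ℝ) × (Fin n → ℝ))) :
    ContDiffOn ℝ ∞ (fun y => (productForm lam a :
        OneForm (I.prod (phaseModel n)) (M × (B × Torus n))).inChart x₀ y u)
      (extChartAt (I.prod (phaseModel n)) x₀).target := by
  have h2 : ContDiffOn ℝ ∞ (fun y : E × ((Fin n → ℝ) × (Fin n → ℝ)) =>
      lam.inChart x₀.1 y.1 u.1) (extChartAt (I.prod (phaseModel n)) x₀).target :=
    (hl.contDiffOn_inChart x₀.1 u.1).comp contDiff_fst.contDiffOn fun y hy => mem_target_fst hy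
  exact (h2.add (contDiffOn_const (c := ∑ i, a i * u.2.2 i))).congr
    fun y hy => productForm_inChart hp lam a x₀ hy u

theorem productForm_isClosed (hp : ∀ b z, extChartAt 𝓘(ℝ, Fin n → ℝ) b z = p z)
    {lam : OneForm I M} (hl : lam.IsSmooth) (hlc : lam.IsClosed) (a : Fin n → ℝ) :
    (productForm lam a : OneForm (I.prod (phaseModel n)) (M × (B × Torus n))).IsClosed := by
  intro x₀ y hy u v
  have hn := (isOpen_extChartAt_target x₀).mem_nhds hy
  have h1 : ∀ b c : E × ((Fin n → ℝ) × (Fin n → ℝ)),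
      fderiv ℝ (fun z => (productForm lam a :
        OneForm (I.prod (phaseModel n)) (M × (B × Torus n))).inChart x₀ z b) y c =
        fderiv ℝ (fun z => lam.inChart x₀.1 z b.1) y.1 c.1 := by
    intro b c
    refine fderiv_eq_of_eventuallyEq_fst_add_const (c := ∑ i, a i * b.2.2 i) ?_ ?_ c
    · exact ((hl.contDiffOn_inChart x₀.1 b.1).contDiffAt
        ((isOpen_extChartAt_target x₀.1).mem_nhds (mem_target_fst hy))).differentiableAt (by simp)
    · filter_upwards [hn] with z hz
      exact productForm_inChart hp lam a x₀ hz b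
  rw [h1, h1]
  exact hlc x₀.1 y.1 (mem_target_fst hy) u.1 v.1

theorem productForm_isSmooth [FiniteDimensional ℝ E]
    (hp : ∀ b z, extChartAt 𝓘(ℝ, Fin n → ℝ) b z = p z) {lam : OneForm I M} (hl : lam.IsSmooth)
    (a : Fin n → ℝ) :
    (productForm lam a : OneForm (I.prod (phaseModel n)) (M × (B × Torus n))).IsSmooth :=
  OneForm.isSmooth_of_inChart fun x₀ v => productForm_contDiffOn_inChart hp hl a x₀ v

/-- The vector field on `M × (B × Tⁿ)` dual to `pr_M^* λ + ∑ aᵢ dqᵢ`: the dual of `λ` on `M`, the constant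
field `a` on `B`, and zero on `Tⁿ`. -/
noncomputable def productField (om : SymplecticForm I M) (lam : OneForm I M) (a : Fin n → ℝ) :
    VectorField (I.prod (phaseModel n)) (M × (B × Torus n)) :=
  fun z => ((om.form.dual lam z.1, (a, 0)) : E × ((Fin n → ℝ) × (Fin n → ℝ)))

theorem productField_dual [FiniteDimensional ℝ E] (om : SymplecticForm I M)
    (hp : ∀ b z, extChartAt 𝓘(ℝ, Fin n → ℝ) b z = p z) (lam : OneForm I M) (a : Fin n → ℝ)
    (z : M × (B × Torus n)) (v : TangentSpace (I.prod (phaseModel n)) z) :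
    stabilizedForm om p z (productField om lam a z) v = productForm lam a z v := by
  refine (stabilizedForm_apply om hp z _ v).trans (Eq.trans ?_ (productForm_apply lam a z v).symm)
  have h1 : (om.form z.1 : E →L[ℝ] E →L[ℝ] ℝ) (om.form.dual lam z.1) v.1 =
      (lam z.1 : E →L[ℝ] ℝ) v.1 := TwoForm.dual_spec om.nondegenerate lam z.1 v.1
  have h2 : ∀ v : E × ((Fin n → ℝ) × (Fin n → ℝ)),
      ∑ i, (a i * v.2.2 i - v.2.1 i * (0 : Fin n → ℝ) i) = ∑ i, a i * v.2.2 i := by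
    intro v
    simp
  exact congrArg₂ (· + ·) h1 (h2 v)

theorem productField_isSmooth [FiniteDimensional ℝ E] (om : SymplecticForm I M)
    (hp : ∀ b z, extChartAt 𝓘(ℝ, Fin n → ℝ) b z = p z) {lam : OneForm I M} (hl : lam.IsSmooth)
    (a : Fin n → ℝ) :
    (productField om lam a :
      VectorField (I.prod (phaseModel n)) (M × (B × Torus n))).IsSmooth :=
  VectorField.isSmooth_of_dual (stabilizedForm_contDiffOn_inChart om hp)
    (stabilizedForm_nondegenerate om hp) (productForm_contDiffOn_inChart hp hl a)
    (productField_dual om hp lam a)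

/-- On `M × (ℝⁿ × Tⁿ)` the field `productField` is complete, and its flow translates the momentum. -/
theorem productField_isFlow (om : SymplecticForm I M) (lam : OneForm I M) (a : Fin n → ℝ)
    {ψ : ℝ → M → M} (hψ : IsFlow (om.form.dual lam) ψ) :
    IsFlow (productField om lam a :
        VectorField (I.prod (phaseModel n)) (M × ((Fin n → ℝ) × Torus n)))
      fun t z => (ψ t z.1, (z.2.1 + t • a, z.2.2)) := by
  refine ⟨fun z => ?_, fun z t => ?_⟩
  · dsimp only
    rw [hψ.1, zero_smul, add_zero]
  · have h1 : HasMFDerivAt 𝓘(ℝ, ℝ) 𝓘(ℝ, Fin n → ℝ) (fun t : ℝ => z.2.1 + t • a) t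
        ((1 : ℝ →L[ℝ] ℝ).smulRight a) := by
      have h2 : HasFDerivAt (fun t : ℝ => z.2.1 + t • a) ((1 : ℝ →L[ℝ] ℝ).smulRight a) t :=
        ((1 : ℝ →L[ℝ] ℝ).smulRight a).hasFDerivAt.const_add z.2.1
      exact h2.hasMFDerivAt
    have h3 := (hψ.2 z.1 t).prodMk (h1.prodMk
      (hasMFDerivAt_const (I := 𝓘(ℝ, ℝ)) (I' := 𝓘(ℝ, Fin n → ℝ)) z.2.2 t))
    refine h3.congr_mfderiv ?_
    have h4 : ∀ w : E, (((1 : ℝ →L[ℝ] ℝ).smulRight w).prod (((1 : ℝ →L[ℝ] ℝ).smulRight a).prod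
        (0 : ℝ →L[ℝ] (Fin n → ℝ)))) = (1 : ℝ →L[ℝ] ℝ).smulRight (w, (a, (0 : Fin n → ℝ))) := by
      intro w
      ext <;> simp
    exact h4 _

end ProductForms

section Coordinates

variable {n : ℕ}

theorem extChartAt_id_apply (b z : Fin n → ℝ) : extChartAt 𝓘(ℝ, Fin n → ℝ) b z = id z := rfl

theorem extChartAt_openBox_apply {R : Fin n → ℝ} (b z : openBox R) :
    extChartAt 𝓘(ℝ, Fin n → ℝ) b z = (z : Fin n → ℝ) := rfl

theorem mem_extChartAt_openBox_target {R : Fin n → ℝ} (b : openBox R) {y : Fin n → ℝ}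
    (hy : y ∈ openBox R) : y ∈ (extChartAt 𝓘(ℝ, Fin n → ℝ) b).target := by
  have h : (⟨y, hy⟩ : openBox R) ∈ (extChartAt 𝓘(ℝ, Fin n → ℝ) b).source := by
    rw [extChartAt_source]
    simp [TopologicalSpace.Opens.chartAt_eq, chartAt_self_eq]
  exact (extChartAt 𝓘(ℝ, Fin n → ℝ) b).map_source h

theorem extChartAt_openBox_symm {R : Fin n → ℝ} (b : openBox R) {y : Fin n → ℝ}
    (hy : y ∈ openBox R) : (extChartAt 𝓘(ℝ, Fin n → ℝ) b).symm y = ⟨y, hy⟩ :=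
  Subtype.ext (coordinate_chart_symm (fun b z => extChartAt_openBox_apply b z) b
    (mem_extChartAt_openBox_target b hy))

theorem mem_openBox_of_mem_target {R : Fin n → ℝ} (b : openBox R) {y : Fin n → ℝ}
    (hy : y ∈ (extChartAt 𝓘(ℝ, Fin n → ℝ) b).target) : y ∈ openBox R := by
  have h := coordinate_chart_symm (fun b z => extChartAt_openBox_apply b z) b hy
  rw [← h]
  exact ((extChartAt 𝓘(ℝ, Fin n → ℝ) b).symm y).2

end Coordinates

end Symp

/-! ### The first cohomology of `M × (I_R^n × Tⁿ)` -/

section Poincare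

open MeasureTheory Set

variable {E V : Type*} [NormedAddCommGroup E] [NormedSpace ℝ E] [FiniteDimensional ℝ E]
  [NormedAddCommGroup V] [NormedSpace ℝ V] [FiniteDimensional ℝ V] {U : Set E} {Ω : Set V}
  {L : E × V → (E × V →L[ℝ] ℝ)}

set_option maxHeartbeats 1000000 in
/-- The Poincaré lemma along star-shaped fibres: integration of a closed 1-form along the rays of the
fibres gives a function whose differential is the form minus its restriction to the zero section. -/
theorem fiberwise_poincare (hU : IsOpen U) (hΩ : IsOpen Ω)
    (hstar : ∀ x ∈ Ω, ∀ s ∈ Icc (0 : ℝ) 1, s • x ∈ Ω) (hL : ContDiffOn ℝ ∞ L (U ×ˢ Ω))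
    (hsymm : ∀ z ∈ U ×ˢ Ω, ∀ u v, fderiv ℝ L z u v = fderiv ℝ L z v u) :
    ContDiffOn ℝ ∞ (fun z : E × V => ∫ s in (0 : ℝ)..1, L (z.1, s • z.2) (0, z.2)) (U ×ˢ Ω) ∧
      ∀ z ∈ U ×ˢ Ω, ∀ u,
        fderiv ℝ (fun z : E × V => ∫ s in (0 : ℝ)..1, L (z.1, s • z.2) (0, z.2)) z u =
          L z u - L (z.1, 0) (u.1, 0) := by
  set P : (E × V) × ℝ → E × V := fun w => (w.1.1, w.2 • w.1.2) with hP
  have hPs : ContDiff ℝ ∞ P := by fun_prop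
  set W : Set ((E × V) × ℝ) := P ⁻¹' (U ×ˢ Ω) with hW
  have hUΩ : IsOpen (U ×ˢ Ω) := hU.prod hΩ
  have hWo : IsOpen W := hUΩ.preimage hPs.continuous
  set f : (E × V) × ℝ → ℝ := fun w => L (P w) (0, w.1.2) with hf
  have hfs : ContDiffOn ℝ ∞ f W :=
    (hL.comp hPs.contDiffOn fun _ h => h).clm_apply (by fun_prop)
  have hmem : ∀ z ∈ U ×ˢ Ω, ∀ s ∈ uIcc (0 : ℝ) 1, (z, s) ∈ W := by
    intro z hz s hs
    rw [uIcc_of_le zero_le_one] at hs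
    exact ⟨hz.1, hstar _ hz.2 s hs⟩
  refine ⟨contDiffOn_intervalIntegral_param hWo hfs hUΩ hmem, fun z hz u => ?_⟩
  have h1 := hasFDerivAt_intervalIntegral_param hWo (hfs.of_le (by simp)) (hmem z hz)
  have hLd : ∀ s ∈ uIcc (0 : ℝ) 1, HasFDerivAt L (fderiv ℝ L (P (z, s))) (P (z, s)) := by
    intro s hs
    exact ((hL.contDiffAt (hUΩ.mem_nhds (hmem z hz s hs))).differentiableAt (by simp)).hasFDerivAt
  have hfd : ∀ s ∈ uIcc (0 : ℝ) 1, fderiv ℝ f (z, s) (u, 0) =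
      fderiv ℝ L (P (z, s)) (0, z.2) (u.1, s • u.2) + L (P (z, s)) (0, u.2) := by
    intro s hs
    have h2 : HasFDerivAt f (fderiv ℝ f (z, s)) (z, s) :=
      ((hfs.contDiffAt (hWo.mem_nhds (hmem z hz s hs))).differentiableAt (by simp)).hasFDerivAt
    have hz0 : (z + (0 : ℝ) • u, s) = (z, s) := by simp
    have h3 : HasDerivAt (fun t : ℝ => (z + t • u, s)) (u, (0 : ℝ)) 0 := by
      have := (((hasDerivAt_id (0 : ℝ)).smul_const u).const_add z).prodMk (hasDerivAt_const 0 s)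
      simpa using this
    have h4 := (hz0.symm ▸ h2 : HasFDerivAt f (fderiv ℝ f (z, s))
      ((fun t : ℝ => (z + t • u, s)) 0)).comp_hasDerivAt (0 : ℝ) h3
    have h5 : HasDerivAt (fun t : ℝ => P (z + t • u, s)) (u.1, s • u.2) 0 := by
      have h6 : HasDerivAt (fun t : ℝ => z.1 + t • u.1) u.1 0 := by
        simpa using ((hasDerivAt_id (0 : ℝ)).smul_const u.1).const_add z.1
      have h7 : HasDerivAt (fun t : ℝ => s • (z.2 + t • u.2)) (s • u.2) 0 := by
        have h8 : HasDerivAt (fun t : ℝ => z.2 + t • u.2) u.2 0 := by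
          simpa using ((hasDerivAt_id (0 : ℝ)).smul_const u.2).const_add z.2
        exact h8.const_smul s
      exact h6.prodMk h7
    have h6 : HasDerivAt (fun t : ℝ => ((0 : E), z.2 + t • u.2)) (0, u.2) 0 := by
      have h7 : HasDerivAt (fun t : ℝ => z.2 + t • u.2) u.2 0 := by
        simpa using ((hasDerivAt_id (0 : ℝ)).smul_const u.2).const_add z.2
      exact (hasDerivAt_const _ _).prodMk h7
    have h7 : HasDerivAt (fun t : ℝ => L (P (z + t • u, s)))
        (fderiv ℝ L (P (z, s)) (u.1, s • u.2)) 0 := (hz0.symm ▸ hLd s hs : HasFDerivAt L (fderiv ℝ L (P (z, s)))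
      ((fun t : ℝ => P (z + t • u, s)) 0)).comp_hasDerivAt (0 : ℝ) h5
    have h8 := h7.clm_apply h6
    have h9 := h4.unique h8
    rw [h9]
    simp only [zero_smul, add_zero]
    rw [hsymm _ (hmem z hz s hs)]
  have hcont : ContinuousOn (fun s => (fderiv ℝ f (z, s)).comp
      (ContinuousLinearMap.inl ℝ (E × V) ℝ)) (uIcc 0 1) := by
    have h2 : ContinuousOn (fderiv ℝ f) W :=
      (hfs.fderiv_of_isOpen (m := ∞) hWo (by simp)).continuousOn
    exact (h2.comp (by fun_prop) (hmem z hz)).clm_comp continuousOn_const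
  have hder : ∀ s ∈ uIcc (0 : ℝ) 1, HasDerivAt (fun s => L (P (z, s)) (u.1, s • u.2))
      (fderiv ℝ f (z, s) (u, 0)) s := by
    intro s hs
    rw [hfd s hs]
    have h2 : HasDerivAt (fun s : ℝ => P (z, s)) (0, z.2) s :=
      (hasDerivAt_const s z.1).prodMk (by simpa using (hasDerivAt_id s).smul_const z.2)
    have h3 : HasDerivAt (fun s : ℝ => (u.1, s • u.2)) (0, u.2) s :=
      (hasDerivAt_const s u.1).prodMk (by simpa using (hasDerivAt_id s).smul_const u.2)
    have h4 : HasDerivAt (fun s => L (P (z, s))) (fderiv ℝ L (P (z, s)) (0, z.2)) s :=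
      (hLd s hs).comp_hasDerivAt s h2
    exact h4.clm_apply h3
  have hcalc : ∫ s in (0 : ℝ)..1, fderiv ℝ f (z, s) (u, 0) = L z u - L (z.1, 0) (u.1, 0) := by
    have h2 : ContinuousOn (fun s => fderiv ℝ f (z, s) (u, 0)) (uIcc 0 1) :=
      hcont.clm_apply (continuousOn_const (c := u))
    refine (intervalIntegral.integral_eq_sub_of_hasDerivAt hder h2.intervalIntegrable).trans ?_
    simp only [hP, one_smul, zero_smul]
  rw [h1.fderiv, ContinuousLinearMap.intervalIntegral_apply hcont.intervalIntegrable, ← hcalc]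
  rfl

end Poincare

namespace Symp

open MeasureTheory Set Bundle

section Cohomology

variable {E : Type*} [NormedAddCommGroup E] [NormedSpace ℝ E] [FiniteDimensional ℝ E]
  {H : Type*} [TopologicalSpace H] {I : ModelWithCorners ℝ E H} [I.Boundaryless]

/-- The coefficient covector of a 1-form in the chart centred at `x₀`. -/
noncomputable def OneForm.chartCLM {N : Type*} [TopologicalSpace N] [ChartedSpace H N]
    (lam : OneForm I N) (x₀ : N) (y : E) : E →L[ℝ] ℝ :=
  (lam ((extChartAt I x₀).symm y)).comp (mfderiv 𝓘(ℝ, E) I (extChartAt I x₀).symm y)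

theorem OneForm.chartCLM_self {N : Type*} [TopologicalSpace N] [ChartedSpace H N]
    [IsManifold I ∞ N] (lam : OneForm I N) (x₀ : N) (u : E) :
    lam.chartCLM x₀ (extChartAt I x₀ x₀) u = (lam x₀ : E →L[ℝ] ℝ) u := by
  have h1 := mfderiv_chart_symm_self (I := I) x₀ u
  have h2 : ∀ (z : N) (_ : z = x₀) (a b : E), a = b →
      (lam z : E →L[ℝ] ℝ) a = (lam x₀ : E →L[ℝ] ℝ) b := by
    rintro _ rfl a _ rfl
    rfl
  exact h2 _ (extChartAt_to_inv x₀) _ _ h1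

theorem OneForm.IsSmooth.contDiffOn_chartCLM {N : Type*} [TopologicalSpace N] [ChartedSpace H N]
    [IsManifold I ∞ N] {lam : OneForm I N} (hl : lam.IsSmooth) (x₀ : N) :
    ContDiffOn ℝ ∞ (lam.chartCLM x₀) (extChartAt I x₀).target :=
  contDiffOn_clm_apply.2 fun v => hl.contDiffOn_inChart x₀ v

theorem OneForm.fderiv_chartCLM {N : Type*} [TopologicalSpace N] [ChartedSpace H N]
    [IsManifold I ∞ N] {lam : OneForm I N} (hl : lam.IsSmooth) (x₀ : N) {y : E}
    (hy : y ∈ (extChartAt I x₀).target) (u v : E) :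
    fderiv ℝ (lam.chartCLM x₀) y u v = fderiv ℝ (fun z => lam.inChart x₀ z v) y u := by
  have h1 := ((hl.contDiffOn_chartCLM x₀).contDiffAt
    ((isOpen_extChartAt_target (I := I) x₀).mem_nhds hy)).differentiableAt (by simp)
  have h2 : HasFDerivAt (fun z => lam.inChart x₀ z v) _ y :=
    h1.hasFDerivAt.clm_apply (hasFDerivAt_const v y)
  rw [h2.fderiv]
  simp

variable {M : Type*} [TopologicalSpace M] [ChartedSpace H M] [IsManifold I ∞ M]
  {n : ℕ} {R : Fin n → ℝ}

/-- The covering `ℝⁿ × ℝⁿ → I_R^n × Tⁿ`, with junk values outside `I_R^n × ℝⁿ`. -/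
noncomputable def boxCover (hR : ∀ i, 0 < R i) (x : (Fin n → ℝ) × (Fin n → ℝ)) :
    openBox R × Torus n :=
  ((extChartAt 𝓘(ℝ, Fin n → ℝ) (openBox.zero hR)).symm x.1, Torus.proj n x.2)

/-- The coefficients of a 1-form on `M × (I_R^n × Tⁿ)`, lifted to the covering `M × (I_R^n × ℝⁿ)`, in a
chart of `M`. -/
noncomputable def liftedCoeff (hR : ∀ i, 0 < R i)
    (lam : OneForm (I.prod (phaseModel n)) (M × (openBox R × Torus n))) (m₀ : M)
    (z : E × ((Fin n → ℝ) × (Fin n → ℝ))) : E × ((Fin n → ℝ) × (Fin n → ℝ)) →L[ℝ] ℝ :=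
  (lam ((extChartAt I m₀).symm z.1, boxCover hR z.2) :
    E × ((Fin n → ℝ) × (Fin n → ℝ)) →L[ℝ] ℝ).comp
      ((mfderiv 𝓘(ℝ, E) I (extChartAt I m₀).symm z.1 : E →L[ℝ] E).prodMap
        (ContinuousLinearMap.id ℝ _))

theorem boxCover_add (hR : ∀ i, 0 < R i) (x : (Fin n → ℝ) × (Fin n → ℝ)) {k : Fin n → ℝ}
    (hk : Torus.proj n k = 0) : boxCover hR (x + (0, k)) = boxCover hR x := by
  simp only [boxCover, Prod.fst_add, Prod.snd_add, add_zero]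
  rw [Torus.proj_add, hk, add_zero]

theorem liftedCoeff_add (hR : ∀ i, 0 < R i)
    (lam : OneForm (I.prod (phaseModel n)) (M × (openBox R × Torus n))) (m₀ : M)
    (z : E × ((Fin n → ℝ) × (Fin n → ℝ))) {k : Fin n → ℝ} (hk : Torus.proj n k = 0) :
    liftedCoeff hR lam m₀ (z + (0, (0, k))) = liftedCoeff hR lam m₀ z := by
  have h : z + (0, (0, k)) = (z.1, z.2 + (0, k)) := by
    ext <;> simp
  rw [h]
  simp only [liftedCoeff]
  rw [boxCover_add hR z.2 hk]

theorem liftedCoeff_eq_chartCLM (hR : ∀ i, 0 < R i)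
    (lam : OneForm (I.prod (phaseModel n)) (M × (openBox R × Torus n)))
    (x₀ : M × (openBox R × Torus n)) {y : E × ((Fin n → ℝ) × (Fin n → ℝ))}
    (hy : y ∈ (extChartAt (I.prod (phaseModel n)) x₀).target) :
    liftedCoeff hR lam x₀.1 y = lam.chartCLM x₀ y := by
  have hy' := hy
  rw [extChartAt_prod, extChartAt_prod] at hy'
  have hb : y.2.1 ∈ openBox R := mem_openBox_of_mem_target x₀.2.1 hy'.2.1
  refine ContinuousLinearMap.ext fun u => ?_
  have h1 := mfderiv_prod_chart_symm (p := fun p : openBox R => (p : Fin n → ℝ))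
    (fun b z => extChartAt_openBox_apply b z) x₀ hy u
  have h2 : (extChartAt (I.prod (phaseModel n)) x₀).symm y =
      ((extChartAt I x₀.1).symm y.1, boxCover hR y.2) := by
    rw [extChartAt_prod, extChartAt_prod]
    refine Prod.ext rfl (Prod.ext ?_ ?_)
    · refine (extChartAt_openBox_symm x₀.2.1 hb).trans ?_
      exact (extChartAt_openBox_symm (openBox.zero hR) hb).symm
    · exact Torus.extChartAt_symm_apply x₀.2.2 y.2.2
  have h3 : ∀ (z z' : M × (openBox R × Torus n)) (_ : z = z')
      (a b : E × ((Fin n → ℝ) × (Fin n → ℝ))), a = b →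
      (lam z' : E × ((Fin n → ℝ) × (Fin n → ℝ)) →L[ℝ] ℝ) b =
        (lam z : E × ((Fin n → ℝ) × (Fin n → ℝ)) →L[ℝ] ℝ) a := by
    rintro z _ rfl a _ rfl
    rfl
  exact h3 _ _ h2 _ _ h1

/-- Near every point of the covering the lifted coefficients are, up to a deck transformation, those of a
chart. -/
theorem exists_liftedCoeff_eventuallyEq (hR : ∀ i, 0 < R i)
    (lam : OneForm (I.prod (phaseModel n)) (M × (openBox R × Torus n))) (m₀ : M)
    {z : E × ((Fin n → ℝ) × (Fin n → ℝ))} (hz : z.1 ∈ (extChartAt I m₀).target)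
    (hzR : z.2.1 ∈ openBox R) :
    ∃ (x₀ : M × (openBox R × Torus n)) (κ : E × ((Fin n → ℝ) × (Fin n → ℝ))),
      z + κ ∈ (extChartAt (I.prod (phaseModel n)) x₀).target ∧
      liftedCoeff hR lam m₀ =ᶠ[𝓝 z] fun y => lam.chartCLM x₀ (y + κ) := by
  set q₀ := Torus.proj n z.2.2 with hq₀
  set c := extChartAt 𝓘(ℝ, Fin n → ℝ) q₀ q₀ with hc
  have hpc : Torus.proj n c = q₀ := Torus.proj_extChartAt q₀ (mem_extChartAt_source q₀)
  have hk : Torus.proj n (c - z.2.2) = 0 := by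
    rw [Torus.proj_sub, hpc, sub_self]
  set x₀ : M × (openBox R × Torus n) := (m₀, (openBox.zero hR, q₀)) with hx₀
  have hmem : z + (0, (0, c - z.2.2)) ∈ (extChartAt (I.prod (phaseModel n)) x₀).target := by
    rw [extChartAt_prod, extChartAt_prod]
    refine ⟨?_, ?_, ?_⟩
    · simpa using hz
    · simpa using mem_extChartAt_openBox_target (openBox.zero hR) hzR
    · change z.2.2 + (c - z.2.2) ∈ _
      rw [add_sub_cancel]
      exact mem_extChartAt_target q₀
  refine ⟨x₀, (0, (0, c - z.2.2)), hmem, ?_⟩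
  have hcont : ContinuousAt (fun y : E × ((Fin n → ℝ) × (Fin n → ℝ)) =>
      y + (0, (0, c - z.2.2))) z := by fun_prop
  filter_upwards [hcont.preimage_mem_nhds ((isOpen_extChartAt_target x₀).mem_nhds hmem)] with y hy
  rw [← liftedCoeff_add hR lam m₀ y hk]
  exact liftedCoeff_eq_chartCLM hR lam x₀ hy

theorem contDiffOn_liftedCoeff (hR : ∀ i, 0 < R i)
    {lam : OneForm (I.prod (phaseModel n)) (M × (openBox R × Torus n))} (hl : lam.IsSmooth)
    (m₀ : M) : ContDiffOn ℝ ∞ (liftedCoeff hR lam m₀)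
      ((extChartAt I m₀).target ×ˢ ((openBox R : Set (Fin n → ℝ)) ×ˢ univ)) := by
  intro z hz
  obtain ⟨x₀, κ, hκ, hev⟩ := exists_liftedCoeff_eventuallyEq hR lam m₀ hz.1 hz.2.1
  have h1 := (hl.contDiffOn_chartCLM x₀).contDiffAt ((isOpen_extChartAt_target x₀).mem_nhds hκ)
  have h2 : ContDiffAt ℝ ∞ (fun y => lam.chartCLM x₀ (y + κ)) z :=
    h1.comp z (contDiffAt_id.add contDiffAt_const)
  exact (h2.congr_of_eventuallyEq hev).contDiffWithinAt

theorem fderiv_liftedCoeff_symm (hR : ∀ i, 0 < R i)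
    {lam : OneForm (I.prod (phaseModel n)) (M × (openBox R × Torus n))} (hl : lam.IsSmooth)
    (hc : lam.IsClosed) (m₀ : M) {z : E × ((Fin n → ℝ) × (Fin n → ℝ))}
    (hz : z ∈ (extChartAt I m₀).target ×ˢ ((openBox R : Set (Fin n → ℝ)) ×ˢ univ))
    (u v : E × ((Fin n → ℝ) × (Fin n → ℝ))) :
    fderiv ℝ (liftedCoeff hR lam m₀) z u v = fderiv ℝ (liftedCoeff hR lam m₀) z v u := by
  obtain ⟨x₀, κ, hκ, hev⟩ := exists_liftedCoeff_eventuallyEq hR lam m₀ hz.1 hz.2.1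
  rw [hev.fderiv_eq, fderiv_comp_add_right, OneForm.fderiv_chartCLM hl x₀ hκ,
    OneForm.fderiv_chartCLM hl x₀ hκ]
  exact hc x₀ _ hκ u v

end Cohomology

section Decomposition

variable {E : Type*} [NormedAddCommGroup E] [NormedSpace ℝ E] [FiniteDimensional ℝ E]
  {H : Type*} [TopologicalSpace H] {I : ModelWithCorners ℝ E H} [I.Boundaryless]
  {M : Type*} [TopologicalSpace M] [ChartedSpace H M] [IsManifold I ∞ M]
  {n : ℕ} {R : Fin n → ℝ}

/-- The integral of a 1-form on `M × (I_R^n × Tⁿ)` along the image of the ray from `(m, 0, 0)` to `(m, x)`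
in the covering. -/
noncomputable def rayIntegral (hR : ∀ i, 0 < R i)
    (lam : OneForm (I.prod (phaseModel n)) (M × (openBox R × Torus n))) (m : M)
    (x : (Fin n → ℝ) × (Fin n → ℝ)) : ℝ :=
  ∫ s in (0 : ℝ)..1, (lam (m, boxCover hR (s • x)) :
    E × ((Fin n → ℝ) × (Fin n → ℝ)) →L[ℝ] ℝ) (0, x)

theorem openBox.smul_mem {p : Fin n → ℝ} (hp : p ∈ openBox R) {s : ℝ} (hs : s ∈ Icc (0 : ℝ) 1) :
    s • p ∈ openBox R := by
  intro i
  have h : |p i| < R i := hp i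
  rw [Pi.smul_apply, smul_eq_mul, abs_mul, abs_of_nonneg hs.1]
  exact (mul_le_of_le_one_left (abs_nonneg _) hs.2).trans_lt h

theorem openBox.convex : Convex ℝ (openBox R : Set (Fin n → ℝ)) := by
  have h : (openBox R : Set (Fin n → ℝ)) = univ.pi fun i => Ioo (-R i) (R i) := by
    ext p
    simp [openBox, mem_pi, abs_lt]
  rw [h]
  exact convex_pi fun i _ => convex_Ioo _ _

theorem rayIntegral_chart_symm (hR : ∀ i, 0 < R i)
    (lam : OneForm (I.prod (phaseModel n)) (M × (openBox R × Torus n))) (m₀ : M)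
    (z : E × ((Fin n → ℝ) × (Fin n → ℝ))) :
    rayIntegral hR lam ((extChartAt I m₀).symm z.1) z.2 =
      ∫ s in (0 : ℝ)..1, liftedCoeff hR lam m₀ (z.1, s • z.2) (0, z.2) := by
  refine intervalIntegral.integral_congr fun s _ => ?_
  have h : ∀ (A : E →L[ℝ] E) (L : E × ((Fin n → ℝ) × (Fin n → ℝ)) →L[ℝ] ℝ), L (0, z.2) =
      (L.comp (A.prodMap (ContinuousLinearMap.id ℝ _))) (0, z.2) := by
    intro A L
    simp
  exact h _ _

theorem rayIntegral_spec (hR : ∀ i, 0 < R i)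
    {lam : OneForm (I.prod (phaseModel n)) (M × (openBox R × Torus n))} (hl : lam.IsSmooth)
    (hc : lam.IsClosed) (m₀ : M) :
    ContDiffOn ℝ ∞ (fun z : E × ((Fin n → ℝ) × (Fin n → ℝ)) =>
      rayIntegral hR lam ((extChartAt I m₀).symm z.1) z.2)
      ((extChartAt I m₀).target ×ˢ ((openBox R : Set (Fin n → ℝ)) ×ˢ univ)) ∧
    ∀ z ∈ (extChartAt I m₀).target ×ˢ ((openBox R : Set (Fin n → ℝ)) ×ˢ univ), ∀ u,
      fderiv ℝ (fun z : E × ((Fin n → ℝ) × (Fin n → ℝ)) =>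
        rayIntegral hR lam ((extChartAt I m₀).symm z.1) z.2) z u =
        liftedCoeff hR lam m₀ z u - liftedCoeff hR lam m₀ (z.1, 0) (u.1, 0) := by
  have h := fiberwise_poincare (Ω := (openBox R : Set (Fin n → ℝ)) ×ˢ (univ : Set (Fin n → ℝ)))
    (isOpen_extChartAt_target (I := I) m₀)
    ((openBox R).isOpen.prod isOpen_univ)
    (fun x hx s hs => ⟨openBox.smul_mem hx.1 hs, mem_univ _⟩) (contDiffOn_liftedCoeff hR hl m₀)
    fun z hz u v => fderiv_liftedCoeff_symm hR hl hc m₀ hz u v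
  have h1 : (fun z : E × ((Fin n → ℝ) × (Fin n → ℝ)) =>
      rayIntegral hR lam ((extChartAt I m₀).symm z.1) z.2) =
      fun z => ∫ s in (0 : ℝ)..1, liftedCoeff hR lam m₀ (z.1, s • z.2) (0, z.2) :=
    funext (rayIntegral_chart_symm hR lam m₀)
  rw [h1]
  exact h

/-- Under a deck transformation the ray integral of a closed form changes by a constant. -/
theorem rayIntegral_add_sub (hR : ∀ i, 0 < R i) [ConnectedSpace M]
    {lam : OneForm (I.prod (phaseModel n)) (M × (openBox R × Torus n))} (hl : lam.IsSmooth)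
    (hc : lam.IsClosed) {k : Fin n → ℝ} (hk : Torus.proj n k = 0) :
    ∃ c : ℝ, ∀ (m : M) (x : (Fin n → ℝ) × (Fin n → ℝ)), x.1 ∈ openBox R →
      rayIntegral hR lam m (x + (0, k)) = rayIntegral hR lam m x + c := by
  set D : M → (Fin n → ℝ) × (Fin n → ℝ) → ℝ := fun m x =>
    rayIntegral hR lam m (x + (0, k)) - rayIntegral hR lam m x with hD
  have h0 : (0 : Fin n → ℝ) ∈ openBox R := (openBox.zero hR).2
  have hloc : ∀ m₀ : M, ∃ V ∈ 𝓝 m₀, ∀ m ∈ V, ∀ x : (Fin n → ℝ) × (Fin n → ℝ),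
      x.1 ∈ openBox R → D m x = D m₀ 0 := by
    intro m₀
    set y₀ := extChartAt I m₀ m₀ with hy₀
    obtain ⟨r, hr, hball⟩ := Metric.isOpen_iff.1 (isOpen_extChartAt_target (I := I) m₀) y₀
      (mem_extChartAt_target m₀)
    set G : E × ((Fin n → ℝ) × (Fin n → ℝ)) → ℝ := fun z =>
      rayIntegral hR lam ((extChartAt I m₀).symm z.1) z.2 with hG
    obtain ⟨hGs, hGd⟩ := rayIntegral_spec hR hl hc m₀
    set T := (extChartAt I m₀).target ×ˢ ((openBox R : Set (Fin n → ℝ)) ×ˢ (univ : Set (Fin n → ℝ)))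
      with hT
    set S := Metric.ball y₀ r ×ˢ ((openBox R : Set (Fin n → ℝ)) ×ˢ (univ : Set (Fin n → ℝ))) with hS
    have hTo : IsOpen T :=
      (isOpen_extChartAt_target (I := I) m₀).prod ((openBox R).isOpen.prod isOpen_univ)
    have hSo : IsOpen S := Metric.isOpen_ball.prod ((openBox R).isOpen.prod isOpen_univ)
    have hSc : IsPreconnected S :=
      ((convex_ball y₀ r).prod (openBox.convex.prod convex_univ)).isPreconnected
    set κ : E × ((Fin n → ℝ) × (Fin n → ℝ)) := (0, (0, k)) with hκ
    have hST : ∀ z ∈ S, z ∈ T ∧ z + κ ∈ T := by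
      intro z hz
      refine ⟨⟨hball hz.1, hz.2⟩, ?_, ?_, mem_univ _⟩
      · simpa [hκ] using hball hz.1
      · simpa [hκ] using hz.2.1
    have hGdiff : ∀ z ∈ T, DifferentiableAt ℝ G z := fun z hz =>
      (hGs.contDiffAt (hTo.mem_nhds hz)).differentiableAt (by simp)
    have hGκ : ∀ z ∈ S, HasFDerivAt (fun z => G (z + κ)) (fderiv ℝ G (z + κ)) z := by
      intro z hz
      have h1 := (hGdiff _ (hST z hz).2).hasFDerivAt.comp z ((hasFDerivAt_id z).add_const κ)
      exact h1
    have hder : ∀ z ∈ S, HasFDerivAt (fun z => G (z + κ) - G z) (0 : _ →L[ℝ] ℝ) z := by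
      intro z hz
      refine ((hGκ z hz).sub (hGdiff z (hST z hz).1).hasFDerivAt).congr_fderiv ?_
      refine ContinuousLinearMap.ext fun u => ?_
      rw [sub_apply, hGd _ (hST z hz).2, hGd _ (hST z hz).1, liftedCoeff_add hR lam m₀ z hk]
      simp [hκ]
    refine ⟨(extChartAt I m₀).source ∩ extChartAt I m₀ ⁻¹' Metric.ball y₀ r, ?_, ?_⟩
    · exact Filter.inter_mem (extChartAt_source_mem_nhds m₀)
        ((continuousAt_extChartAt m₀).preimage_mem_nhds (Metric.ball_mem_nhds y₀ hr))
    · intro m hm x hx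
      have hz : (extChartAt I m₀ m, x) ∈ S := ⟨hm.2, hx, mem_univ _⟩
      have hz₀ : (y₀, (0 : (Fin n → ℝ) × (Fin n → ℝ))) ∈ S :=
        ⟨Metric.mem_ball_self hr, h0, mem_univ _⟩
      have h1 := hSo.is_const_of_fderiv_eq_zero hSc
        (fun z hz => (hder z hz).differentiableAt.differentiableWithinAt)
        (fun z hz => (hder z hz).fderiv) hz hz₀
      have h2 : ∀ (z : E) (m : M) (_ : (extChartAt I m₀).symm z = m)
          (x : (Fin n → ℝ) × (Fin n → ℝ)), G ((z, x) + κ) - G (z, x) = D m x := by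
        rintro z _ rfl x
        simp only [hG, hD, hκ, Prod.mk_add_mk, add_zero]
      rw [h2 _ m ((extChartAt I m₀).left_inv hm.1), h2 _ m₀ (extChartAt_to_inv m₀)] at h1
      exact h1
  have hconst : IsLocallyConstant fun m => D m 0 := by
    rw [IsLocallyConstant.iff_eventually_eq]
    intro m₀
    obtain ⟨V, hV, h⟩ := hloc m₀
    filter_upwards [hV] with m hm
    exact h m hm 0 h0
  obtain ⟨m₁⟩ := (inferInstance : Nonempty M)
  refine ⟨D m₁ 0, fun m x hx => ?_⟩
  obtain ⟨V, hV, h⟩ := hloc m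
  have h1 := h m (mem_of_mem_nhds hV) x hx
  rw [hconst.apply_eq_of_preconnectedSpace m m₁] at h1
  rw [← h1]
  simp only [hD]
  ring

/-- The periods of a closed form along the loops of the torus factor are given by a vector `a`. -/
theorem exists_rayIntegral_add (hR : ∀ i, 0 < R i) [ConnectedSpace M]
    {lam : OneForm (I.prod (phaseModel n)) (M × (openBox R × Torus n))} (hl : lam.IsSmooth)
    (hc : lam.IsClosed) :
    ∃ a : Fin n → ℝ, ∀ (m : M) (x : (Fin n → ℝ) × (Fin n → ℝ)) (k : Fin n → ℤ),
      x.1 ∈ openBox R → rayIntegral hR lam m (x + (0, fun i => (k i : ℝ))) =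
        rayIntegral hR lam m x + ∑ i, a i * k i := by
  have h0 : (0 : Fin n → ℝ) ∈ openBox R := (openBox.zero hR).2
  choose c hcs using fun k : Fin n → ℤ => rayIntegral_add_sub hR hl hc (Torus.proj_intCast k)
  obtain ⟨m₁⟩ := (inferInstance : Nonempty M)
  have hadd : ∀ k l, c (k + l) = c k + c l := by
    intro k l
    have h1 := hcs (k + l) m₁ 0 h0
    have h2 := hcs k m₁ 0 h0
    have h3 := hcs l m₁ (0 + (0, fun i => (k i : ℝ))) (by simpa using h0)
    have h4 : ((0 : (Fin n → ℝ) × (Fin n → ℝ)) + (0, fun i => (k i : ℝ))) +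
        (0, fun i => (l i : ℝ)) = 0 + (0, fun i => (((k + l) i : ℤ) : ℝ)) := by
      ext i <;> simp
    rw [h4] at h3
    linarith
  let C : (Fin n → ℤ) →ₗ[ℤ] ℝ := (AddMonoidHom.mk' c hadd).toIntLinearMap
  refine ⟨fun i => c fun j => if i = j then 1 else 0, fun m x k hx => ?_⟩
  rw [hcs k m x hx]
  have h1 : C k = ∑ i, k i • C (fun j => if i = j then 1 else 0) := LinearMap.pi_apply_eq_sum_univ C k
  have h2 : ∀ k, C k = c k := fun k => rfl
  rw [h2] at h1
  rw [h1]
  congr 1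
  refine Finset.sum_congr rfl fun i _ => ?_
  rw [h2, zsmul_eq_mul, mul_comm]

/-- A closed 1-form on `M × (I_R^n × Tⁿ)` is cohomologous to a sum of a closed 1-form on `M` and a
combination of the `dqᵢ`. -/
theorem exists_cohomologous_productForm (hR : ∀ i, 0 < R i) [ConnectedSpace M]
    {lam : OneForm (I.prod (phaseModel n)) (M × (openBox R × Torus n))} (hl : lam.IsSmooth)
    (hc : lam.IsClosed) :
    ∃ (lamM : OneForm I M) (a : Fin n → ℝ) (f : M × (openBox R × Torus n) → ℝ),
      lamM.IsSmooth ∧ lamM.IsClosed ∧ ContMDiff (I.prod (phaseModel n)) 𝓘(ℝ, ℝ) ∞ f ∧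
      ∀ z u, lam z u = productForm lamM a z u + mvfderiv (I.prod (phaseModel n)) f z u := by
  have h0 : (0 : Fin n → ℝ) ∈ openBox R := (openBox.zero hR).2
  have hp : ∀ b z : openBox R, extChartAt 𝓘(ℝ, Fin n → ℝ) b z = (z : Fin n → ℝ) :=
    fun b z => extChartAt_openBox_apply b z
  obtain ⟨a, ha⟩ := exists_rayIntegral_add hR hl hc
  let lamM : OneForm I M := fun m => (lam (m, boxCover hR 0) :
    E × ((Fin n → ℝ) × (Fin n → ℝ)) →L[ℝ] ℝ).comp (ContinuousLinearMap.inl ℝ E _)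
  have hlamM : ∀ (m₀ : M) (y v : E), lamM.inChart m₀ y v = liftedCoeff hR lam m₀ (y, 0) (v, 0) := by
    intro m₀ y v
    have h : ∀ (A : E →L[ℝ] E) (L : E × ((Fin n → ℝ) × (Fin n → ℝ)) →L[ℝ] ℝ),
        L.comp (ContinuousLinearMap.inl ℝ E _) (A v) =
          (L.comp (A.prodMap (ContinuousLinearMap.id ℝ _))) (v, 0) := by
      intro A L
      simp
    exact h _ _
  have hslice : ∀ (m₀ : M) {y : E}, y ∈ (extChartAt I m₀).target →
      ((y, 0) : E × ((Fin n → ℝ) × (Fin n → ℝ))) ∈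
        (extChartAt I m₀).target ×ˢ ((openBox R : Set (Fin n → ℝ)) ×ˢ univ) :=
    fun m₀ y hy => ⟨hy, h0, mem_univ _⟩
  have hopen : ∀ m₀ : M, IsOpen ((extChartAt I m₀).target ×ˢ
      ((openBox R : Set (Fin n → ℝ)) ×ˢ (univ : Set (Fin n → ℝ)))) := fun m₀ =>
    (isOpen_extChartAt_target (I := I) m₀).prod ((openBox R).isOpen.prod isOpen_univ)
  have hlamMs : lamM.IsSmooth := by
    refine OneForm.isSmooth_of_inChart fun m₀ v => ?_
    have h1 : ContDiffOn ℝ ∞ (fun y : E => liftedCoeff hR lam m₀ (y, 0))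
        (extChartAt I m₀).target :=
      (contDiffOn_liftedCoeff hR hl m₀).comp (by fun_prop) fun y hy => hslice m₀ hy
    exact (h1.clm_apply (contDiffOn_const (c := (v, 0)))).congr fun y _ => hlamM m₀ y v
  have hlamMc : lamM.IsClosed := by
    intro m₀ y hy u v
    have h1 := ((contDiffOn_liftedCoeff hR hl m₀).contDiffAt
      ((hopen m₀).mem_nhds (hslice m₀ hy))).differentiableAt (by simp)
    have h2 : ∀ u v : E, fderiv ℝ (fun z => lamM.inChart m₀ z v) y u =
        fderiv ℝ (liftedCoeff hR lam m₀) (y, 0) (u, 0) (v, 0) := by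
      intro u v
      have h3 : HasFDerivAt (fun z : E => liftedCoeff hR lam m₀ (z, 0))
          ((fderiv ℝ (liftedCoeff hR lam m₀) (y, 0)).comp (ContinuousLinearMap.inl ℝ E _)) y :=
        HasFDerivAt.comp (g := liftedCoeff hR lam m₀) (f := fun z : E => (z, 0)) y
          h1.hasFDerivAt (hasFDerivAt_prodMk_left y (0 : (Fin n → ℝ) × (Fin n → ℝ)))
      have h4 := h3.clm_apply (hasFDerivAt_const ((v, 0) : E × ((Fin n → ℝ) × (Fin n → ℝ))) y)
      have h5 : (fun z => lamM.inChart m₀ z v) = fun z => liftedCoeff hR lam m₀ (z, 0) (v, 0) :=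
        funext fun z => hlamM m₀ z v
      rw [h5, h4.fderiv]
      simp
    rw [h2, h2]
    exact fderiv_liftedCoeff_symm hR hl hc m₀ (hslice m₀ hy) _ _
  let f : M × (openBox R × Torus n) → ℝ := fun z =>
    rayIntegral hR lam z.1 ((z.2.1 : Fin n → ℝ), (Torus.proj_surjective n z.2.2).choose) -
      ∑ i, a i * (Torus.proj_surjective n z.2.2).choose i
  have hf : ∀ (m : M) (b : openBox R) (q : Fin n → ℝ), f (m, (b, Torus.proj n q)) =
      rayIntegral hR lam m ((b : Fin n → ℝ), q) - ∑ i, a i * q i := by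
    intro m b q
    obtain ⟨k, hk⟩ := Torus.exists_intCast_of_proj_eq
      (Torus.proj_surjective n (Torus.proj n q)).choose_spec
    simp only [f]
    rw [hk]
    have h1 := ha m ((b : Fin n → ℝ), q) k b.2
    simp only [Prod.mk_add_mk, add_zero] at h1
    rw [h1]
    simp only [Pi.add_apply, mul_add, Finset.sum_add_distrib]
    ring
  have hmem : ∀ (x₀ : M × (openBox R × Torus n)) {y : E × ((Fin n → ℝ) × (Fin n → ℝ))},
      y ∈ (extChartAt (I.prod (phaseModel n)) x₀).target →
      y ∈ (extChartAt I x₀.1).target ×ˢ ((openBox R : Set (Fin n → ℝ)) ×ˢ univ) := by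
    intro x₀ y hy
    rw [extChartAt_prod, extChartAt_prod] at hy
    exact ⟨hy.1, mem_openBox_of_mem_target x₀.2.1 hy.2.1, mem_univ _⟩
  have hfchart : ∀ (x₀ : M × (openBox R × Torus n)),
      ∀ y ∈ (extChartAt (I.prod (phaseModel n)) x₀).target,
      f ((extChartAt (I.prod (phaseModel n)) x₀).symm y) =
        rayIntegral hR lam ((extChartAt I x₀.1).symm y.1) y.2 - ∑ i, a i * y.2.2 i := by
    intro x₀ y hy
    have hb := (hmem x₀ hy).2.1
    have h2 : (extChartAt (I.prod (phaseModel n)) x₀).symm y =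
        ((extChartAt I x₀.1).symm y.1, (⟨y.2.1, hb⟩, Torus.proj n y.2.2)) := by
      rw [extChartAt_prod, extChartAt_prod]
      exact Prod.ext rfl (Prod.ext (extChartAt_openBox_symm x₀.2.1 hb)
        (Torus.extChartAt_symm_apply x₀.2.2 y.2.2))
    rw [h2, hf]
  have hlin : ContDiff ℝ ∞ (fun y : E × ((Fin n → ℝ) × (Fin n → ℝ)) => ∑ i, a i * y.2.2 i) := by
    fun_prop
  have hfs : ContMDiff (I.prod (phaseModel n)) 𝓘(ℝ, ℝ) ∞ f := by
    refine contMDiff_of_inChart fun x₀ => ?_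
    have h1 := (rayIntegral_spec hR hl hc x₀.1).1.mono fun y hy => hmem x₀ hy
    exact (h1.sub hlin.contDiffOn).congr fun y hy => hfchart x₀ y hy
  refine ⟨lamM, a, f, hlamMs, hlamMc, hfs, fun z u => ?_⟩
  set y := extChartAt (I.prod (phaseModel n)) z z with hy
  have hyt : y ∈ (extChartAt (I.prod (phaseModel n)) z).target := mem_extChartAt_target z
  have hyT := hmem z hyt
  have e1 : lam z u = liftedCoeff hR lam z.1 y u :=
    (lam.chartCLM_self z u).symm.trans
      (DFunLike.congr_fun (liftedCoeff_eq_chartCLM hR lam z hyt) u).symm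
  have e2 : productForm lamM a z u = liftedCoeff hR lam z.1 (y.1, 0) (u.1, 0) +
      ∑ i, a i * u.2.2 i := by
    rw [← hlamM]
    exact ((productForm lamM a).chartCLM_self z u).symm.trans
      (productForm_inChart hp lamM a z hyt u)
  have e3 : mvfderiv (I.prod (phaseModel n)) f z u = liftedCoeff hR lam z.1 y u -
      liftedCoeff hR lam z.1 (y.1, 0) (u.1, 0) - ∑ i, a i * u.2.2 i := by
    have h1 := (OneForm.chartCLM_self (fun z => mvfderiv (I.prod (phaseModel n)) f z) z u).symm
    refine h1.trans ?_
    have h2 := hasFDerivAt_comp_chart_symm hfs z hyt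
    have h3 := rayIntegral_spec hR hl hc z.1
    have h4 := ((h3.1.contDiffAt ((hopen z.1).mem_nhds hyT)).differentiableAt (by simp)).hasFDerivAt
    have h5 : HasFDerivAt (fun y : E × ((Fin n → ℝ) × (Fin n → ℝ)) => ∑ i, a i * y.2.2 i)
        (∑ i, a i • (((ContinuousLinearMap.proj i).comp (ContinuousLinearMap.snd ℝ _ _)).comp
          (ContinuousLinearMap.snd ℝ E _)) : E × ((Fin n → ℝ) × (Fin n → ℝ)) →L[ℝ] ℝ) y := by
      have h6 := (∑ i, a i • (((ContinuousLinearMap.proj i).comp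
        (ContinuousLinearMap.snd ℝ _ _)).comp
          (ContinuousLinearMap.snd ℝ E _)) :
          E × ((Fin n → ℝ) × (Fin n → ℝ)) →L[ℝ] ℝ).hasFDerivAt (x := y)
      refine h6.congr_of_eventuallyEq (Filter.Eventually.of_forall fun w => ?_)
      simp
    have h7 : HasFDerivAt (fun y => f ((extChartAt (I.prod (phaseModel n)) z).symm y)) _ y :=
      (h4.sub h5).congr_of_eventuallyEq (by
        filter_upwards [(isOpen_extChartAt_target z).mem_nhds hyt] with w hw
        exact hfchart z w hw)
    refine (DFunLike.congr_fun (h2.unique h7) u).trans ?_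
    have h8 := h3.2 y hyT u
    have h9 : ∀ (A B : E × ((Fin n → ℝ) × (Fin n → ℝ)) →L[ℝ] ℝ) (u), (A - B) u = A u - B u :=
      fun A B u => rfl
    refine (h9 _ _ u).trans ?_
    have h10 : ∀ u : E × ((Fin n → ℝ) × (Fin n → ℝ)),
        (∑ i, a i • (((ContinuousLinearMap.proj i).comp (ContinuousLinearMap.snd ℝ _ _)).comp
          (ContinuousLinearMap.snd ℝ E _)) : E × ((Fin n → ℝ) × (Fin n → ℝ)) →L[ℝ] ℝ) u =
          ∑ i, a i * u.2.2 i := by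
      intro u
      simp
    exact congrArg₂ (· - ·) h8 (h10 u)
  rw [e1, e2, e3]
  ring

end Decomposition

end Symp

/-! ### The lower bound -/

section Functions

open MeasureTheory Set

/-- A smooth approximation of the tent function `s ↦ A (1 - |s|)₊`. -/
theorem exists_smooth_tent {K A : ℝ} (hK : 0 < K) (hKA : K < A) :
    ∃ (h : ℝ → ℝ) (δ B : ℝ), 0 < δ ∧ δ < 1 ∧ ContDiff ℝ ∞ h ∧ K ≤ h 0 ∧ B < A ∧
      (∀ s, |deriv h s| ≤ B) ∧ ∀ s, 1 - δ ≤ |s| → h s = 0 := by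
  set B := (K + A) / 2 with hB
  have hB0 : 0 < B := by rw [hB]; linarith
  set δ := (B - K) / (3 * B) with hδ
  have hδ0 : 0 < δ := div_pos (by rw [hB]; linarith) (by linarith)
  have hδB : 3 * δ * B = B - K := by rw [hδ]; field_simp
  have hδ1 : δ < 1 / 3 := by
    rw [hδ, div_lt_iff₀ (by linarith)]
    linarith
  -- a smooth approximation of `u ↦ max u 0`
  set w : ℝ → ℝ := fun t => Real.smoothTransition (t / δ) with hw
  have hws : ContDiff ℝ ∞ w := Real.smoothTransition.contDiff.comp (contDiff_id.div_const δ)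
  have hwi : ∀ a b, IntervalIntegrable w volume a b := fun a b =>
    hws.continuous.intervalIntegrable a b
  set ψ : ℝ → ℝ := fun u => ∫ t in (0 : ℝ)..u, w t with hψ
  have hψd : ∀ u, HasDerivAt ψ (w u) u := fun u =>
    intervalIntegral.integral_hasDerivAt_right (hwi _ _)
      (hws.continuous.stronglyMeasurableAtFilter _ _) hws.continuous.continuousAt
  have hψs : ContDiff ℝ ∞ ψ := by
    rw [contDiff_infty_iff_deriv]
    refine ⟨fun u => (hψd u).differentiableAt, ?_⟩
    have : deriv ψ = w := funext fun u => (hψd u).deriv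
    rwa [this]
  have hψ0 : ∀ u ≤ 0, ψ u = 0 := by
    intro u hu
    have h1 : ∫ t in (0 : ℝ)..u, w t = ∫ t in (0 : ℝ)..u, (0 : ℝ) := by
      refine intervalIntegral.integral_congr fun t ht => ?_
      rw [uIcc_of_ge hu] at ht
      exact Real.smoothTransition.zero_of_nonpos (div_nonpos_of_nonpos_of_nonneg ht.2 hδ0.le)
    simp only [hψ, h1, intervalIntegral.integral_zero]
  have hψ1 : ∀ u, δ ≤ u → u - δ ≤ ψ u := by
    intro u hu
    have h1 : ∫ t in δ..u, w t = ∫ t in δ..u, (1 : ℝ) := by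
      refine intervalIntegral.integral_congr fun t ht => ?_
      rw [uIcc_of_le hu] at ht
      exact Real.smoothTransition.one_of_one_le ((one_le_div hδ0).2 ht.1)
    have h2 : 0 ≤ ∫ t in (0 : ℝ)..δ, w t :=
      intervalIntegral.integral_nonneg hδ0.le fun t _ => Real.smoothTransition.nonneg _
    have h3 := intervalIntegral.integral_add_adjacent_intervals (hwi 0 δ) (hwi δ u)
    rw [h1, intervalIntegral.integral_const, smul_eq_mul, mul_one] at h3
    simp only [hψ]
    linarith
  have hpos : ∀ s : ℝ, 0 < s ^ 2 + δ ^ 2 := fun s => by positivity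
  have hsq : ∀ s : ℝ, |s| ≤ √(s ^ 2 + δ ^ 2) := fun s =>
    Real.abs_le_sqrt (by linarith [sq_nonneg δ])
  set r : ℝ → ℝ := fun s => 1 - δ - √(s ^ 2 + δ ^ 2) with hr
  have hrs : ContDiff ℝ ∞ r := by
    refine contDiff_const.sub (ContDiff.sqrt (by fun_prop) fun s => (hpos s).ne')
  have hrd : ∀ s, HasDerivAt r (-(s / √(s ^ 2 + δ ^ 2))) s := by
    intro s
    have h1 : HasDerivAt (fun s : ℝ => s ^ 2 + δ ^ 2) (2 * s) s := by
      simpa using (hasDerivAt_pow 2 s).add_const (δ ^ 2)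
    refine ((h1.sqrt (hpos s).ne').const_sub (1 - δ)).congr_deriv ?_
    have := (Real.sqrt_pos.2 (hpos s)).ne'
    field_simp
  refine ⟨fun s => B * ψ (r s), δ, B, hδ0, by linarith, contDiff_const.mul (hψs.comp hrs), ?_,
    by rw [hB]; linarith, ?_, ?_⟩
  · have h1 : r 0 = 1 - 2 * δ := by
      simp only [hr]
      rw [zero_pow two_ne_zero, zero_add, Real.sqrt_sq hδ0.le]
      ring
    have h2 := hψ1 (r 0) (by linarith)
    have h3 := mul_le_mul_of_nonneg_left h2 hB0.le
    rw [h1] at h3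
    dsimp only
    rw [h1]
    nlinarith
  · intro s
    have h1 := (((hψd (r s)).comp s (hrd s)).const_mul B).deriv
    have h2 : deriv (fun s => B * ψ (r s)) s = B * (w (r s) * -(s / √(s ^ 2 + δ ^ 2))) := h1
    rw [h2, abs_mul, abs_of_pos hB0, abs_mul, abs_neg]
    refine mul_le_of_le_one_right hB0.le (mul_le_one₀ ?_ (abs_nonneg _) ?_)
    · rw [abs_of_nonneg (Real.smoothTransition.nonneg _)]
      exact Real.smoothTransition.le_one _
    · rw [abs_div, abs_of_nonneg (Real.sqrt_nonneg _)]
      exact div_le_one_of_le₀ (hsq s) (Real.sqrt_nonneg _)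
  · intro s hs
    dsimp only
    rw [hψ0 _ (by simp only [hr]; linarith [hsq s]), mul_zero]

/-- For `a` in the closed box and any `K < A`, there is a function supported inside the open box with value at
least `K` at the origin and derivative in the direction `a` smaller than `A`: a tent of height `A` along
the line `ℝ a`, smoothed and cut off in the transverse directions. -/
theorem exists_box_function {n : ℕ} {R a : Fin n → ℝ} (hR : ∀ i, 0 < R i) (ha : ∀ i, |a i| ≤ R i)
    {i₀ : Fin n} (hi₀ : a i₀ ≠ 0) {K A : ℝ} (hK : 0 < K) (hKA : K < A) :
    ∃ (φ : (Fin n → ℝ) → ℝ) (C : Set (Fin n → ℝ)) (B : ℝ), ContDiff ℝ ∞ φ ∧ K ≤ φ 0 ∧ B < A ∧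
      (∀ p, |fderiv ℝ φ p a| ≤ B) ∧ IsCompact C ∧ C ⊆ {p | ∀ i, |p i| < R i} ∧
      ∀ p ∉ C, φ p = 0 := by
  obtain ⟨h, δ, B, hδ0, hδ1, hs, hK0, hBA, hB, hsupp⟩ := exists_smooth_tent hK hKA
  have : Nonempty (Fin n) := ⟨i₀⟩
  obtain ⟨j, hj⟩ := Finite.exists_min R
  have hr : 0 < δ / 2 * R j := mul_pos (by linarith) (hR j)
  let χ : ContDiffBump (0 : Fin n → ℝ) := ⟨δ / 2 * R j / 2, δ / 2 * R j, by linarith, by linarith⟩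
  let σ : (Fin n → ℝ) → ℝ := fun p => p i₀ / a i₀
  have hσs : ContDiff ℝ ∞ σ := by fun_prop
  have hχs : ContDiff ℝ ∞ χ := χ.contDiff
  set φ : (Fin n → ℝ) → ℝ := fun p => h (σ p) * χ (p - σ p • a) with hφ
  have hφs : ContDiff ℝ ∞ φ :=
    (hs.comp hσs).mul (hχs.comp (contDiff_id.sub (hσs.smul contDiff_const)))
  refine ⟨φ, univ.pi fun i => Icc (-((1 - δ / 2) * R i)) ((1 - δ / 2) * R i), B, hφs, ?_, hBA, ?_,
    isCompact_univ_pi fun i => isCompact_Icc, ?_, ?_⟩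
  · have h1 : χ (0 : Fin n → ℝ) = 1 := 
      χ.one_of_mem_closedBall (Metric.mem_closedBall_self χ.rIn_pos.le)
    simp only [hφ, σ, Pi.zero_apply, zero_div, zero_smul, sub_zero, h1, mul_one]
    exact hK0
  · intro p
    have h1 : HasDerivAt (fun t : ℝ => p + t • a) a 0 := by
      simpa using ((hasDerivAt_id (0 : ℝ)).smul_const a).const_add p
    have h2 : HasFDerivAt φ (fderiv ℝ φ p) (p + (0 : ℝ) • a) := by
      rw [zero_smul, add_zero]
      exact (hφs.differentiable (by simp) p).hasFDerivAt
    have h3 := h2.comp_hasDerivAt (0 : ℝ) h1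
    have h4 : ∀ t : ℝ, σ (p + t • a) = σ p + t := by
      intro t
      simp only [σ, Pi.add_apply, Pi.smul_apply, smul_eq_mul]
      field_simp
    have h5 : HasDerivAt (fun t : ℝ => h (σ p + t) * χ (p - σ p • a))
        (deriv h (σ p) * χ (p - σ p • a)) 0 := by
      have h6 : HasDerivAt h (deriv h (σ p)) (σ p + 0) := by
        rw [add_zero]
        exact (hs.differentiable (by simp) _).hasDerivAt
      exact ((h6.comp_const_add (σ p) 0)).mul_const _
    have h7 : (φ ∘ fun t : ℝ => p + t • a) = fun t : ℝ => h (σ p + t) * χ (p - σ p • a) := by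
      funext t
      simp only [Function.comp_apply, hφ, h4]
      congr 2
      rw [add_smul]
      abel
    rw [h7] at h3
    rw [h3.unique h5, abs_mul]
    refine (mul_le_of_le_one_right (abs_nonneg _) ?_).trans (hB _)
    rw [abs_of_nonneg χ.nonneg]
    exact χ.le_one
  · intro p hp i
    have h1 := abs_le.2 (hp i (mem_univ i))
    have := hR i
    nlinarith
  · intro p hp
    by_contra hne
    refine hp fun i _ => ?_
    have h1 : h (σ p) ≠ 0 := left_ne_zero_of_mul hne
    have h2 : χ (p - σ p • a) ≠ 0 := right_ne_zero_of_mul hne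
    have h3 : |σ p| < 1 - δ := by
      by_contra hge
      exact h1 (hsupp _ (not_lt.1 hge))
    have h4 : ‖p - σ p • a‖ < δ / 2 * R j := by
      by_contra hge
      refine h2 (χ.zero_of_le_dist ?_)
      rw [dist_zero_right]
      exact not_lt.1 hge
    have h5 := (norm_le_pi_norm (p - σ p • a) i).trans_lt h4
    rw [Real.norm_eq_abs, Pi.sub_apply, Pi.smul_apply, smul_eq_mul] at h5
    have h6 : |σ p * a i| ≤ (1 - δ) * R i := by
      rw [abs_mul]
      exact mul_le_mul h3.le (ha i) (abs_nonneg _) (by linarith)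
    have h7 : δ / 2 * R j ≤ δ / 2 * R i := mul_le_mul_of_nonneg_left (hj i) (by linarith)
    refine abs_le.1 ?_
    have h8 : |p i| ≤ |p i - σ p * a i| + |σ p * a i| := by
      simpa using abs_add_le (p i - σ p * a i) (σ p * a i)
    nlinarith

end Functions

namespace Symp

open MeasureTheory Set Bundle

section LowerBound

variable {E : Type*} [NormedAddCommGroup E] [NormedSpace ℝ E] [FiniteDimensional ℝ E]
  {H : Type*} [TopologicalSpace H] {I : ModelWithCorners ℝ E H} [I.Boundaryless]
  {M : Type*} [TopologicalSpace M] [ChartedSpace H M] [IsManifold I ∞ M]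
  {n : ℕ} {R : Fin n → ℝ}

theorem standardLoop_velocity (x₀ : M) (hR : ∀ i, 0 < R i) (e : Fin n → ℤ) (t : ℝ) :
    (standardLoop I x₀ hR e).velocity t =
      ((0, (0, fun i => (e i : ℝ))) : E × ((Fin n → ℝ) × (Fin n → ℝ))) := by
  have h1 : HasMFDerivAt 𝓘(ℝ, ℝ) 𝓘(ℝ, Fin n → ℝ) (fun t : ℝ => fun i => t * (e i : ℝ)) t
      ((1 : ℝ →L[ℝ] ℝ).smulRight fun i => (e i : ℝ)) := by
    have h2 : HasFDerivAt (fun t : ℝ => fun i => t * (e i : ℝ))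
        ((1 : ℝ →L[ℝ] ℝ).smulRight fun i => (e i : ℝ)) t :=
      ((1 : ℝ →L[ℝ] ℝ).smulRight fun i => (e i : ℝ)).hasFDerivAt
    exact h2.hasMFDerivAt
  have h2 := (hasMFDerivAt_const (I := 𝓘(ℝ, ℝ)) (I' := I) x₀ t).prodMk
    ((hasMFDerivAt_const (I := 𝓘(ℝ, ℝ)) (I' := 𝓘(ℝ, Fin n → ℝ)) (openBox.zero hR) t).prodMk
      ((Torus.hasMFDerivAt_proj _).comp t h1))
  have h3 : mfderiv 𝓘(ℝ, ℝ) (I.prod (phaseModel n)) (standardLoop I x₀ hR e).toFun t = _ :=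
    h2.mfderiv
  refine (DFunLike.congr_fun h3 (1 : ℝ)).trans ?_
  have h4 : (((1 : ℝ →L[ℝ] ℝ).smulRight fun i => (e i : ℝ)) (1 : ℝ) : Fin n → ℝ) =
      fun i => (e i : ℝ) := by
    ext
    simp
  exact congrArg (fun w : Fin n → ℝ => ((0 : E), ((0 : Fin n → ℝ), w))) h4

/-- The period of `pr_M^* λ + ∑ aᵢ dqᵢ + df` on the standard loop is `∑ aᵢ eᵢ`. -/
theorem period_standardLoop (x₀ : M) (hR : ∀ i, 0 < R i) (e : Fin n → ℤ)
    (lam : closedOneForms (I.prod (phaseModel n)) (M × (openBox R × Torus n)))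
    {lamM : OneForm I M} (a : Fin n → ℝ) {f : M × (openBox R × Torus n) → ℝ}
    (hf : ContMDiff (I.prod (phaseModel n)) 𝓘(ℝ, ℝ) ∞ f)
    (h : ∀ z u, lam.1 z u = productForm lamM a z u + mvfderiv (I.prod (phaseModel n)) f z u) :
    (standardLoop I x₀ hR e).period (Submodule.Quotient.mk lam) = ∑ i, a i * e i := by
  have hp : ∀ b z : openBox R, extChartAt 𝓘(ℝ, Fin n → ℝ) b z = (z : Fin n → ℝ) :=
    fun b z => extChartAt_openBox_apply b z
  have h1 : (standardLoop I x₀ hR e).period (Submodule.Quotient.mk lam) =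
      ∫ t in (0 : ℝ)..1, lam.1 ((standardLoop I x₀ hR e).toFun t)
        ((standardLoop I x₀ hR e).velocity t) := rfl
  have h2 : ∀ t, productForm lamM a ((standardLoop I x₀ hR e).toFun t)
      ((standardLoop I x₀ hR e).velocity t) = ∑ i, a i * e i := by
    intro t
    refine (congrArg _ (standardLoop_velocity x₀ hR e t)).trans
      ((productForm_apply lamM a _ _).trans ?_)
    have h3 : (lamM ((standardLoop I x₀ hR e).toFun t).1 : E →L[ℝ] ℝ) 0 = 0 := map_zero _
    exact (congrArg (· + _) h3).trans (zero_add _)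
  let mu : OneForm (I.prod (phaseModel n)) (M × (openBox R × Torus n)) :=
    fun z => mvfderiv (I.prod (phaseModel n)) f z
  have hmu : mu.IsSmooth := OneForm.isSmooth_of_inChart (contDiffOn_inChart_mvfderiv hf)
  have h4 := (standardLoop I x₀ hR e).integral_exact hmu hf fun z => rfl
  rw [h1]
  have h5 : ∀ t, lam.1 ((standardLoop I x₀ hR e).toFun t) ((standardLoop I x₀ hR e).velocity t) =
      (∑ i, a i * (e i : ℝ)) + mu ((standardLoop I x₀ hR e).toFun t)
        ((standardLoop I x₀ hR e).velocity t) := fun t =>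
    (h _ _).trans (congrArg (· + _) (h2 t))
  simp_rw [h5]
  rw [intervalIntegral.integral_add intervalIntegrable_const
    (((standardLoop I x₀ hR e).continuous_apply hmu).intervalIntegrable _ _), h4]
  simp

/-- For a function `φ` of the momentum, the form `∑ aᵢ dqᵢ` takes the value `dφ(a)` on the Hamiltonian
vector field of `φ`. -/
theorem productForm_hamiltonianVectorField {B : Type*} [TopologicalSpace B]
    [ChartedSpace (Fin n → ℝ) B] [IsManifold 𝓘(ℝ, Fin n → ℝ) ∞ B] {p : B → Fin n → ℝ}
    (om : SymplecticForm I M) (hp : ∀ b z, extChartAt 𝓘(ℝ, Fin n → ℝ) b z = p z)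
    {φ : (Fin n → ℝ) → ℝ} (hφ : ContDiff ℝ ∞ φ) (a : Fin n → ℝ) (z : M × (B × Torus n)) :
    productForm (0 : OneForm I M) a z (hamiltonianVectorField (stabilizedForm om p)
      (fun z => φ (p z.2.1)) z) = fderiv ℝ φ (p z.2.1) a := by
  set X : E × ((Fin n → ℝ) × (Fin n → ℝ)) :=
    hamiltonianVectorField (stabilizedForm om p) (fun z => φ (p z.2.1)) z with hX
  have h1 := hamiltonianVectorField_spec (stabilizedForm om p) (stabilizedForm_nondegenerate om hp)
    (fun z => φ (p z.2.1)) z ((0, (a, 0)) : E × ((Fin n → ℝ) × (Fin n → ℝ)))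
  have h2 := stabilizedForm_apply om hp z X (0, (a, 0))
  have h3 : mvfderiv (I.prod (phaseModel n)) (fun z : M × (B × Torus n) => φ (p z.2.1)) z
      ((0, (a, 0)) : E × ((Fin n → ℝ) × (Fin n → ℝ))) = fderiv ℝ φ (p z.2.1) a := by
    have h4 : HasMFDerivAt (I.prod (phaseModel n)) 𝓘(ℝ, ℝ)
        (fun z : M × (B × Torus n) => φ (p z.2.1)) z _ :=
      ((hφ.differentiable (by simp) (p z.2.1)).hasFDerivAt.hasMFDerivAt).comp z
        ((hasMFDerivAt_coordinate hp z.2.1).comp z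
          ((hasMFDerivAt_fst z.2).comp z (hasMFDerivAt_snd z)))
    exact DFunLike.congr_fun h4.mfderiv ((0, (a, 0)) : E × ((Fin n → ℝ) × (Fin n → ℝ)))
  have h4 : (om.form z.1 : E →L[ℝ] E →L[ℝ] ℝ) X.1 0 = 0 := map_zero _
  have h5 : (0 : ℝ) + ∑ i, (X.2.1 i * 0 - a i * X.2.2 i) = -fderiv ℝ φ (p z.2.1) a :=
    (congrArg (fun c : ℝ => c + ∑ i, (X.2.1 i * 0 - a i * X.2.2 i)) h4).symm.trans
      (h2.symm.trans (h1.trans (congrArg Neg.neg h3)))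
  have h6 := productForm_apply (0 : OneForm I M) a z X
  refine h6.trans ?_
  have h7 : ((0 : OneForm I M) z.1 : E →L[ℝ] ℝ) X.1 = 0 := rfl
  rw [h7]
  simp only [mul_zero, zero_sub, zero_add, Finset.sum_neg_distrib, neg_inj] at h5
  rw [zero_add]
  exact h5

variable [T2Space M] [MeasurableSpace M] [BorelSpace M]

/-- The class of `∑ aᵢ dqᵢ`, where `aᵢ` is `Rᵢ` with the sign of `eᵢ`, has period `∑ Rᵢ |eᵢ|`; functions of the
momentum larger than `K` at the origin can have all rotations against it smaller than this. -/
theorem sum_le_measureCapacity [CompactSpace M] (om : SymplecticForm I M) (X : Set M)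
    (e : Fin n → ℤ) (hR : ∀ i, 0 < R i) (x₀ : M) :
    ((∑ i, R i * |(e i : ℝ)| : ℝ) : EReal) ≤ measureCapacity om X hR e x₀ := by
  have hp : ∀ b z : openBox R, extChartAt 𝓘(ℝ, Fin n → ℝ) b z = (z : Fin n → ℝ) :=
    fun b z => extChartAt_openBox_apply b z
  set A := ∑ i, R i * |(e i : ℝ)| with hA
  set a : Fin n → ℝ := fun i => R i * SignType.sign (e i : ℝ) with ha
  have h0 : (0 : OneForm I M) ∈ closedOneForms I M := zero_mem _
  let lam : closedOneForms (I.prod (phaseModel n)) (M × (openBox R × Torus n)) :=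
    ⟨productForm 0 a, productForm_isSmooth hp h0.1 a, productForm_isClosed hp h0.1 h0.2 a⟩
  have hper : (standardLoop I x₀ hR e).period (Submodule.Quotient.mk lam) = A := by
    rw [period_standardLoop x₀ hR e lam (lamM := 0) a (f := fun _ => 0) contMDiff_const]
    · refine Finset.sum_congr rfl fun i _ => ?_
      rw [ha, mul_assoc, sign_mul_self]
    · intro z u
      rw [mvfderiv_const]
      exact (add_zero _).symm
  refine le_trans ?_ (le_iSup _ (Submodule.Quotient.mk lam))
  refine le_sInf ?_
  rintro _ ⟨K, ⟨hK, hF⟩, rfl⟩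
  rw [EReal.coe_le_coe_iff]
  by_contra hlt
  rw [not_le] at hlt
  obtain ⟨i₀, hi₀⟩ : ∃ i, e i ≠ 0 := by
    by_contra hall
    push Not at hall
    have : A = 0 := Finset.sum_eq_zero fun i _ => by simp [hall i]
    linarith
  have ha0 : a i₀ ≠ 0 := by
    simp only [ha]
    refine mul_ne_zero (hR i₀).ne' fun h => hi₀ ?_
    have h1 := sign_mul_self (e i₀ : ℝ)
    rw [h, zero_mul] at h1
    exact_mod_cast abs_eq_zero.1 h1.symm
  have haR : ∀ i, |a i| ≤ R i := by
    intro i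
    simp only [ha]
    rw [abs_mul, abs_of_pos (hR i)]
    refine mul_le_of_le_one_right (hR i).le ?_
    rcases SignType.sign (e i : ℝ) with _ | _ | _ <;> simp
  obtain ⟨φ, C, B, hφ, hφ0, hBA, hB, hC, hCR, hCφ⟩ := exists_box_function hR haR ha0 hK hlt
  let F : M × (openBox R × Torus n) → ℝ := fun z => φ (z.2.1 : Fin n → ℝ)
  have hval : ContMDiff 𝓘(ℝ, Fin n → ℝ) 𝓘(ℝ, Fin n → ℝ) ∞
      (fun p : openBox R => (p : Fin n → ℝ)) := contMDiff_subtype_val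
  have hFs : ContMDiff (I.prod (phaseModel n)) 𝓘(ℝ, ℝ) ∞ F :=
    hφ.contMDiff.comp (hval.comp (contMDiff_fst.comp contMDiff_snd))
  have hC' : IsCompact ((fun p : openBox R => (p : Fin n → ℝ)) ⁻¹' C) :=
    Topology.IsInducing.subtypeVal.isCompact_preimage_iff (by
      intro p hp
      exact ⟨⟨p, hCR hp⟩, rfl⟩) |>.2 hC
  have hFc : HasCompactSupport F := by
    refine HasCompactSupport.intro (isCompact_univ.prod (hC'.prod isCompact_univ)) fun z hz => ?_
    refine hCφ _ fun hmem => hz ⟨mem_univ _, hmem, mem_univ _⟩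
  obtain ⟨μ, hμ, hμA⟩ := hF F hFs hFc fun z hz => by
    have h1 : (z.2.1 : Fin n → ℝ) = 0 := hz.2
    simp only [F, h1]
    exact hφ0
  rw [hper] at hμA
  have hA0 : 0 < A := hK.trans hlt
  unfold rotationVector at hμA
  split_ifs at hμA with hsm
  · have h1 : |∫ z, productForm (0 : OneForm I M) a z (hamiltonianVectorField
        (stabilizedForm om fun p : openBox R => (p : Fin n → ℝ)) F z) ∂μ| ≤ B := by
      have := hμ.1
      have h2 := norm_integral_le_of_norm_le_const (μ := μ) (C := B)
        (f := fun z => productForm (0 : OneForm I M) a z (hamiltonianVectorField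
          (stabilizedForm om fun p : openBox R => (p : Fin n → ℝ)) F z))
        (Filter.Eventually.of_forall fun z => by
          rw [productForm_hamiltonianVectorField om hp hφ a z]
          exact hB _)
      simpa using h2
    exact absurd (hμA.trans h1) (not_le.2 hBA)
  · simp only [LinearMap.zero_apply, abs_zero] at hμA
    linarith

end LowerBound

/-! ### The upper bound -/

section Cutoff

variable {E : Type*} [NormedAddCommGroup E] [NormedSpace ℝ E] [FiniteDimensional ℝ E]
  {H : Type*} [TopologicalSpace H] {I : ModelWithCorners ℝ E H} [I.Boundaryless]
  {M : Type*} [TopologicalSpace M] [ChartedSpace H M] [IsManifold I ∞ M]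
  {n : ℕ} {R : Fin n → ℝ}

/-- The inverse `M × (I_R^n × Tⁿ) ← M × (ℝⁿ × Tⁿ)` of the inclusion, with junk values outside its image. -/
noncomputable def boxRestrict (hR : ∀ i, 0 < R i) (z : M × ((Fin n → ℝ) × Torus n)) :
    M × (openBox R × Torus n) :=
  (z.1, ((extChartAt 𝓘(ℝ, Fin n → ℝ) (openBox.zero hR)).symm z.2.1, z.2.2))

theorem coe_boxRestrict (hR : ∀ i, 0 < R i) {z : M × ((Fin n → ℝ) × Torus n)}
    (hz : z.2.1 ∈ openBox R) : ((boxRestrict hR z).2.1 : Fin n → ℝ) = z.2.1 := by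
  simp only [boxRestrict]
  rw [extChartAt_openBox_symm _ hz]

/-- The function `χ(p) f` on `M × (I_R^n × Tⁿ)`, extended by zero to `M × (ℝⁿ × Tⁿ)`. -/
noncomputable def cutoff (hR : ∀ i, 0 < R i) (χ : (Fin n → ℝ) → ℝ)
    (f : M × (openBox R × Torus n) → ℝ) (z : M × ((Fin n → ℝ) × Torus n)) : ℝ :=
  χ z.2.1 * f (boxRestrict hR z)

theorem isOpen_momentum_preimage {s : Set (Fin n → ℝ)} (hs : IsOpen s) :
    IsOpen {z : M × ((Fin n → ℝ) × Torus n) | z.2.1 ∈ s} :=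
  hs.preimage (continuous_fst.comp continuous_snd)

theorem hasMFDerivAt_boxRestrict (hR : ∀ i, 0 < R i) {z : M × ((Fin n → ℝ) × Torus n)}
    (hz : z.2.1 ∈ openBox R) :
    HasMFDerivAt (I.prod (phaseModel n)) (I.prod (phaseModel n)) (boxRestrict hR) z
      (ContinuousLinearMap.id ℝ (E × ((Fin n → ℝ) × (Fin n → ℝ)))) := by
  have h1 := hasMFDerivAt_coordinate_chart_symm (p := fun p : openBox R => (p : Fin n → ℝ))
    (fun b z => extChartAt_openBox_apply b z) (openBox.zero hR)
    (mem_extChartAt_openBox_target (openBox.zero hR) hz)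
  exact (hasMFDerivAt_fst (I := I) (I' := phaseModel n) z).prodMk
    ((h1.comp z ((hasMFDerivAt_fst z.2).comp z (hasMFDerivAt_snd z))).prodMk
      ((hasMFDerivAt_snd z.2).comp z (hasMFDerivAt_snd z)))

theorem contMDiffOn_boxRestrict (hR : ∀ i, 0 < R i) :
    ContMDiffOn (I.prod (phaseModel n)) (I.prod (phaseModel n)) ∞
      (boxRestrict hR : M × ((Fin n → ℝ) × Torus n) → _) {z | z.2.1 ∈ openBox R} := by
  have h1 := contMDiffOn_extChartAt_symm (I := 𝓘(ℝ, Fin n → ℝ)) (n := ∞) (openBox.zero hR)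
  have h2 : ContMDiff (I.prod (phaseModel n)) 𝓘(ℝ, Fin n → ℝ) ∞
      (fun z : M × ((Fin n → ℝ) × Torus n) => z.2.1) := contMDiff_fst.comp contMDiff_snd
  have h3 : ContMDiff (I.prod (phaseModel n)) 𝓘(ℝ, Fin n → ℝ) ∞
      (fun z : M × ((Fin n → ℝ) × Torus n) => z.2.2) := contMDiff_snd.comp contMDiff_snd
  exact contMDiff_fst.contMDiffOn.prodMk ((h1.comp h2.contMDiffOn fun z hz =>
    mem_extChartAt_openBox_target (openBox.zero hR) hz).prodMk h3.contMDiffOn)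

theorem contMDiff_cutoff (hR : ∀ i, 0 < R i) {χ : (Fin n → ℝ) → ℝ} (hχ : ContDiff ℝ ∞ χ)
    {L : Set (Fin n → ℝ)} (hL : IsClosed L) (hLR : L ⊆ openBox R) (hχL : ∀ p ∉ L, χ p = 0)
    {f : M × (openBox R × Torus n) → ℝ} (hf : ContMDiff (I.prod (phaseModel n)) 𝓘(ℝ, ℝ) ∞ f) :
    ContMDiff (I.prod (phaseModel n)) 𝓘(ℝ, ℝ) ∞ (cutoff hR χ f) := by
  have h2 : ContMDiff (I.prod (phaseModel n)) 𝓘(ℝ, Fin n → ℝ) ∞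
      (fun z : M × ((Fin n → ℝ) × Torus n) => z.2.1) := contMDiff_fst.comp contMDiff_snd
  intro z
  by_cases hz : z.2.1 ∈ openBox R
  · have h1 : ContMDiffOn (I.prod (phaseModel n)) 𝓘(ℝ, ℝ) ∞ (cutoff hR χ f)
        {z | z.2.1 ∈ openBox R} :=
      (hχ.contMDiff.comp h2).contMDiffOn.mul (hf.comp_contMDiffOn (contMDiffOn_boxRestrict hR))
    exact h1.contMDiffAt ((isOpen_momentum_preimage (openBox R).isOpen).mem_nhds hz)
  · refine (contMDiffAt_const (c := (0 : ℝ))).congr_of_eventuallyEq ?_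
    filter_upwards [(isOpen_momentum_preimage (M := M) hL.isOpen_compl).mem_nhds
      (show z.2.1 ∈ Lᶜ from fun h => hz (hLR h))] with w hw
    simp only [cutoff, hχL _ hw, zero_mul]

theorem hasCompactSupport_cutoff [CompactSpace M] (hR : ∀ i, 0 < R i) {χ : (Fin n → ℝ) → ℝ}
    {L : Set (Fin n → ℝ)} (hL : IsCompact L) (hχL : ∀ p ∉ L, χ p = 0)
    (f : M × (openBox R × Torus n) → ℝ) [T2Space M] : HasCompactSupport (cutoff hR χ f) := by
  refine HasCompactSupport.intro (isCompact_univ.prod (hL.prod isCompact_univ)) fun z hz => ?_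
  simp only [cutoff, hχL z.2.1 fun h => hz ⟨mem_univ _, h, mem_univ _⟩, zero_mul]

theorem mvfderiv_cutoff (hR : ∀ i, 0 < R i) {χ : (Fin n → ℝ) → ℝ}
    {f : M × (openBox R × Torus n) → ℝ} (hf : ContMDiff (I.prod (phaseModel n)) 𝓘(ℝ, ℝ) ∞ f)
    {z : M × ((Fin n → ℝ) × Torus n)} (hz : z.2.1 ∈ openBox R) (hχ : ∀ᶠ p in 𝓝 z.2.1, χ p = 1)
    (u : E × ((Fin n → ℝ) × (Fin n → ℝ))) :
    mvfderiv (I.prod (phaseModel n)) (cutoff hR χ f) z u =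
      mvfderiv (I.prod (phaseModel n)) f (boxRestrict hR z) u := by
  have h1 := (hf.mdifferentiable (by simp) (boxRestrict hR z)).hasMFDerivAt.comp z
    (hasMFDerivAt_boxRestrict (I := I) hR hz)
  have h2 : cutoff hR χ f =ᶠ[𝓝 z] f ∘ boxRestrict hR := by
    have hc : ContinuousAt (fun z : M × ((Fin n → ℝ) × Torus n) => z.2.1) z :=
      (continuous_fst.comp continuous_snd).continuousAt
    filter_upwards [hc.eventually hχ] with w hw
    simp only [cutoff, hw, one_mul, Function.comp_apply]
  have h3 : HasMFDerivAt (I.prod (phaseModel n)) 𝓘(ℝ, ℝ) (cutoff hR χ f) z _ :=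
    h1.congr_of_eventuallyEq h2
  exact DFunLike.congr_fun h3.mfderiv u

theorem mvfderiv_eq_zero_of_eventuallyEq {N : Type*} [TopologicalSpace N] [ChartedSpace H N]
    {f : N → ℝ} {z : N} (h : f =ᶠ[𝓝 z] fun _ => 0) : mvfderiv I f z = 0 := by
  have h1 : HasMFDerivAt I 𝓘(ℝ, ℝ) f z _ :=
    (hasMFDerivAt_const (I := I) (I' := 𝓘(ℝ, ℝ)) (0 : ℝ) z).congr_of_eventuallyEq h
  exact h1.mfderiv

end Cutoff

section UpperBound

variable {E : Type*} [NormedAddCommGroup E] [NormedSpace ℝ E] [FiniteDimensional ℝ E]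
  {H : Type*} [TopologicalSpace H] {I : ModelWithCorners ℝ E H} [I.Boundaryless]
  {M : Type*} [TopologicalSpace M] [ChartedSpace H M] [IsManifold I ∞ M] [T2Space M]
  [CompactSpace M] {n : ℕ} {R : Fin n → ℝ}

/-- The displacement argument: if the form `pr_M^* λ + ∑ aᵢ dqᵢ + dk` is bounded by `c' < ∑ aᵢ eᵢ` on the
Hamiltonian vector field of a function `F ≥ K` on `X × Tⁿ`, and `X` is stably non-displaceable, then
`K ≤ ∑ Rᵢ |eᵢ|`. -/
theorem le_sum_of_not_stablyDisplaceable (om : SymplecticForm I M) {X : Set M} (hX : IsCompact X)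
    (hnd : ¬ StablyDisplaceable om n X) (e : Fin n → ℤ) (hR : ∀ i, 0 < R i) {K : ℝ} (hK : 0 < K)
    {F : M × (openBox R × Torus n) → ℝ} (hF : ContMDiff (I.prod (phaseModel n)) 𝓘(ℝ, ℝ) ∞ F)
    (hFc : HasCompactSupport F)
    (hFK : ∀ y ∈ stabilizedSet X fun p : openBox R => (p : Fin n → ℝ), K ≤ F y)
    {lamM : OneForm I M} (hlM : lamM.IsSmooth) (hlMc : lamM.IsClosed) (a : Fin n → ℝ)
    {k : M × (openBox R × Torus n) → ℝ} (hk : ContMDiff (I.prod (phaseModel n)) 𝓘(ℝ, ℝ) ∞ k)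
    {c' : ℝ} (hc'0 : 0 ≤ c') (hc' : c' < ∑ i, a i * e i)
    (hbound : ∀ z, |productForm lamM a z (hamiltonianVectorField (stabilizedForm om
        fun p : openBox R => (p : Fin n → ℝ)) F z) + mvfderiv (I.prod (phaseModel n)) k z
      (hamiltonianVectorField (stabilizedForm om fun p : openBox R => (p : Fin n → ℝ)) F z)| ≤ c') :
    K ≤ ∑ i, R i * |(e i : ℝ)| := by
  have hp : ∀ b z : openBox R, extChartAt 𝓘(ℝ, Fin n → ℝ) b z = (z : Fin n → ℝ) :=
    fun b z => extChartAt_openBox_apply b z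
  have hid : ∀ b z : Fin n → ℝ, extChartAt 𝓘(ℝ, Fin n → ℝ) b z = id z :=
    fun b z => extChartAt_id_apply b z
  set c := ∑ i, a i * (e i : ℝ) with hc
  have hc0 : 0 < c := hc'0.trans_lt hc'
  -- the momenta in the support of `F`, and a cutoff function
  set C : Set (Fin n → ℝ) := (fun z : M × (openBox R × Torus n) => (z.2.1 : Fin n → ℝ)) ''
    tsupport F with hC
  have hCc : IsCompact C := hFc.isCompact.image
    (continuous_subtype_val.comp (continuous_fst.comp continuous_snd))
  have hCR : C ⊆ openBox R := by
    rintro _ ⟨z, -, rfl⟩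
    exact z.2.1.2
  obtain ⟨L, hLc, hCL, hLR⟩ := exists_compact_between hCc (openBox R).isOpen hCR
  obtain ⟨χ, hχ1, hχ0, -⟩ := exists_contMDiffMap_one_nhds_of_subset_interior
    (n := (⊤ : ℕ∞)) 𝓘(ℝ, Fin n → ℝ) hCc.isClosed hCL
  have hχs : ContDiff ℝ ∞ χ := χ.contMDiff.contDiff
  have hχC : ∀ p ∈ C, ∀ᶠ q in 𝓝 p, χ q = 1 := fun p hp =>
    eventually_nhdsSet_iff_forall.1 hχ1 p hp
  set F' : M × ((Fin n → ℝ) × Torus n) → ℝ := cutoff hR χ F with hF'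
  set k' : M × ((Fin n → ℝ) × Torus n) → ℝ := cutoff hR χ k with hk'
  have hF's : ContMDiff (I.prod (phaseModel n)) 𝓘(ℝ, ℝ) ∞ F' :=
    contMDiff_cutoff hR hχs hLc.isClosed hLR hχ0 hF
  have hk's : ContMDiff (I.prod (phaseModel n)) 𝓘(ℝ, ℝ) ∞ k' :=
    contMDiff_cutoff hR hχs hLc.isClosed hLR hχ0 hk
  have hk'c : HasCompactSupport k' := hasCompactSupport_cutoff hR hLc hχ0 k
  -- the vector fields and their flows
  let om' : TwoForm (I.prod (phaseModel n)) (M × ((Fin n → ℝ) × Torus n)) :=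
    stabilizedForm om (id : (Fin n → ℝ) → Fin n → ℝ)
  have hnd' : ∀ x u, (∀ v, om' x u v = 0) → u = 0 := stabilizedForm_nondegenerate om hid
  have hom' := stabilizedForm_contDiffOn_inChart om hid
  let V : VectorField (I.prod (phaseModel n)) (M × ((Fin n → ℝ) × Torus n)) :=
    productField om lamM a
  have hV : ∀ x v, om' x (V x) v = productForm lamM a x v := productField_dual om hid lamM a
  have hVs : V.IsSmooth := productField_isSmooth om hid hlM a
  let W : VectorField (I.prod (phaseModel n)) (M × ((Fin n → ℝ) × Torus n)) :=
    om'.dual fun z => mvfderiv (I.prod (phaseModel n)) k' z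
  have hW : ∀ x v, om' x (W x) v = mvfderiv (I.prod (phaseModel n)) k' x v :=
    TwoForm.dual_spec hnd' _
  have hWs : W.IsSmooth :=
    VectorField.isSmooth_of_dual hom' hnd' (contDiffOn_inChart_mvfderiv hk's) hW
  have hW0 : ∀ z ∉ tsupport k', W z = 0 := by
    intro z hz
    refine hnd' z _ fun v => (hW z v).trans ?_
    rw [mvfderiv_eq_zero_of_eventuallyEq (notMem_tsupport_iff_eventuallyEq.1 hz)]
    rfl
  obtain ⟨ψ, hψ⟩ := VectorField.IsSmooth.exists_isFlow (X := om.form.dual lamM)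
    (VectorField.isSmooth_of_dual om.smooth.contDiffOn_inChart om.nondegenerate
      hlM.contDiffOn_inChart (TwoForm.dual_spec om.nondegenerate lamM))
    isCompact_univ (fun x hx => absurd (mem_univ x) hx)
  set S : ℝ → M × ((Fin n → ℝ) × Torus n) → M × ((Fin n → ℝ) × Torus n) :=
    fun t z => (ψ t z.1, (z.2.1 + t • a, z.2.2)) with hS
  have hSf : IsFlow V S := productField_isFlow om lamM a hψ
  obtain ⟨Φ, hΦ⟩ := hSf.exists_isFlow_add hVs hWs hk'c.isCompact hW0
  have hpres := hSf.preserves hom' (stabilizedForm_alternating om hid)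
    (stabilizedForm_isClosed om hid) (productForm_isClosed hid hlM hlMc a) hVs hV
  -- the values of `F'` change slowly along the flow of `V + W`
  have hslow : ∀ z, |mvfderiv (I.prod (phaseModel n)) F' z (V z + W z)| ≤ c' := by
    intro z
    by_cases hz : z.2.1 ∈ C
    · set x : E × ((Fin n → ℝ) × (Fin n → ℝ)) := hamiltonianVectorField (stabilizedForm om
        fun p : openBox R => (p : Fin n → ℝ)) F (boxRestrict hR z) with hx
      set y : E × ((Fin n → ℝ) × (Fin n → ℝ)) := V z + W z with hy
      have h1 : mvfderiv (I.prod (phaseModel n)) F' z y =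
          mvfderiv (I.prod (phaseModel n)) F (boxRestrict hR z) y :=
        mvfderiv_cutoff hR hF (hCR hz) (hχC _ hz) y
      have h2 : stabilizedForm om (fun p : openBox R => (p : Fin n → ℝ)) (boxRestrict hR z) x y =
          -mvfderiv (I.prod (phaseModel n)) F (boxRestrict hR z) y :=
        hamiltonianVectorField_spec _ (stabilizedForm_nondegenerate om hp) F (boxRestrict hR z) y
      have h3 : om' z y x =
          -stabilizedForm om (fun p : openBox R => (p : Fin n → ℝ)) (boxRestrict hR z) x y := by
        have h5 : ∀ A : E × ((Fin n → ℝ) × (Fin n → ℝ)) →L[ℝ]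
            E × ((Fin n → ℝ) × (Fin n → ℝ)) →L[ℝ] ℝ, (∀ v, A v v = 0) → A y x = -A x y := by
          intro A hA
          have h := hA (y + x)
          simp only [map_add, add_apply, hA] at h
          linarith
        refine Eq.trans ?_ (h5 _ (stabilizedForm_alternating om hp (boxRestrict hR z)))
        exact (stabilizedForm_apply om hid z y x).trans
          (stabilizedForm_apply om hp (boxRestrict hR z) y x).symm
      have h4 : om' z y x = productForm lamM a (boxRestrict hR z) x +
          mvfderiv (I.prod (phaseModel n)) k (boxRestrict hR z) x := by
        have h5 : ∀ (A : E × ((Fin n → ℝ) × (Fin n → ℝ)) →L[ℝ]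
            E × ((Fin n → ℝ) × (Fin n → ℝ)) →L[ℝ] ℝ) (v w x : E × ((Fin n → ℝ) × (Fin n → ℝ))),
            A (v + w) x = A v x + A w x := by
          intro A v w x
          rw [map_add, add_apply]
        refine (h5 (om' z) (V z) (W z) x).trans (congrArg₂ (· + ·) ?_ ?_)
        · exact (hV z x).trans ((productForm_apply lamM a z x).trans
            (productForm_apply lamM a (boxRestrict hR z) x).symm)
        · exact (hW z x).trans (mvfderiv_cutoff hR hk (hCR hz) (hχC _ hz) x)
      have h6 : mvfderiv (I.prod (phaseModel n)) F' z y =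
          productForm lamM a (boxRestrict hR z) x +
            mvfderiv (I.prod (phaseModel n)) k (boxRestrict hR z) x := by
        rw [← h4, h3, h2, neg_neg]
        exact h1
      exact (congrArg abs h6).trans_le (hbound (boxRestrict hR z))
    · have h1 : F' =ᶠ[𝓝 z] fun _ => 0 := by
        filter_upwards [(isOpen_momentum_preimage (M := M) hCc.isClosed.isOpen_compl).mem_nhds hz]
          with w hw
        by_cases hwR : w.2.1 ∈ openBox R
        · have h2 : F (boxRestrict hR w) = 0 := by
            by_contra hne
            exact hw ⟨_, subset_tsupport F hne, coe_boxRestrict hR hwR⟩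
          simp only [hF', cutoff, h2, mul_zero]
        · simp only [hF', cutoff, hχ0 _ fun h => hwR (hLR h), zero_mul]
      rw [mvfderiv_eq_zero_of_eventuallyEq h1]
      exact abs_zero.trans_le hc'0
  -- some point of `X × Tⁿ` is not displaced
  set T := K / c with hT
  have hT0 : 0 < T := div_pos hK hc0
  have hYc : IsClosed (stabilizedSet X (id : (Fin n → ℝ) → Fin n → ℝ) :
      Set (M × ((Fin n → ℝ) × Torus n))) :=
    (hX.isClosed.preimage continuous_fst).inter
      (isClosed_eq (continuous_fst.comp continuous_snd) continuous_const)
  have hmeet : ¬ Disjoint (closure (stabilizedSet X (id : (Fin n → ℝ) → Fin n → ℝ) :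
      Set (M × ((Fin n → ℝ) × Torus n))))
      ((fun y => S (-T) (Φ T y)) '' stabilizedSet X (id : (Fin n → ℝ) → Fin n → ℝ)) :=
    fun hd => hnd (displaceable_of_flows hnd' hVs hWs hSf hΦ hpres hk's hk'c hW T hd)
  rw [hYc.closure_eq, not_disjoint_iff] at hmeet
  obtain ⟨-, hmem, ⟨y, hy, rfl⟩⟩ := hmeet
  set w := Φ T y with hw
  have hwT : w.2.1 = T • a := by
    have h1 : w.2.1 + (-T) • a = 0 := hmem.2
    rw [neg_smul, add_neg_eq_zero] at h1
    exact h1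
  have hy0 : y.2.1 = 0 := hy.2
  have h0R : y.2.1 ∈ openBox R := hy0 ▸ (openBox.zero hR).2
  have hFy : K ≤ F (boxRestrict hR y) :=
    hFK _ ⟨hy.1, (coe_boxRestrict hR h0R).trans hy0⟩
  have hF'y : K ≤ F' y := by
    have h1 : y.2.1 ∈ C :=
      ⟨_, subset_tsupport F (hK.trans_le hFy).ne', coe_boxRestrict hR h0R⟩
    have h2 : χ y.2.1 = 1 := (hχC _ h1).self_of_nhds
    simp only [hF', cutoff, h2, one_mul]
    exact hFy
  have hF'w : 0 < F' w := by
    have hder : ∀ t, HasDerivAt (fun s => F' (Φ s y))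
        (mvfderiv (I.prod (phaseModel n)) F' (Φ t y) (V (Φ t y) + W (Φ t y))) t := fun t =>
      hasDerivAt_comp_of_hasMFDerivAt (hΦ.2 y t) (hF's.mdifferentiable (by simp) _)
    have h1 := (convex_univ (𝕜 := ℝ) (E := ℝ)).norm_image_sub_le_of_norm_hasDerivWithin_le
      (f := fun s => F' (Φ s y)) (C := c') (fun t _ => (hder t).hasDerivWithinAt)
      (fun t _ => hslow _) (mem_univ 0) (mem_univ T)
    rw [Real.norm_eq_abs, sub_zero, Real.norm_of_nonneg hT0.le, hΦ.1] at h1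
    have h2 := (abs_le.1 h1).1
    have h3 : c * T = K := by rw [hT]; field_simp
    have h4 : c' * T < c * T := mul_lt_mul_of_pos_right hc' hT0
    linarith
  have hwR : w.2.1 ∈ openBox R := by
    by_contra hn
    have h1 : F' w = 0 := by simp only [hF', cutoff, hχ0 _ fun h => hn (hLR h), zero_mul]
    linarith
  calc K = T * c := by rw [hT]; field_simp
    _ = ∑ i, T * a i * e i := by
      rw [hc, Finset.mul_sum]
      exact Finset.sum_congr rfl fun i _ => by ring
    _ ≤ ∑ i, R i * |(e i : ℝ)| := by
      refine Finset.sum_le_sum fun i _ => ?_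
      have h1 : |w.2.1 i| < R i := hwR i
      rw [hwT, Pi.smul_apply, smul_eq_mul] at h1
      refine (le_abs_self _).trans ?_
      rw [abs_mul]
      exact mul_le_mul_of_nonneg_right h1.le (abs_nonneg _)

variable [ConnectedSpace M] [TopologicalSpace.MetrizableSpace M] [MeasurableSpace M] [BorelSpace M]

/-- If all rotations against `λ` are smaller than its period, then `λ` is cohomologous to a form as in
`le_sum_of_not_stablyDisplaceable`. -/
theorem measureCapacity_le_sum (om : SymplecticForm I M) {X : Set M} (hX : IsCompact X)
    (hnd : ¬ StablyDisplaceable om n X) (e : Fin n → ℤ) (hR : ∀ i, 0 < R i) (x₀ : M) :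
    measureCapacity om X hR e x₀ ≤ ((∑ i, R i * |(e i : ℝ)| : ℝ) : EReal) := by
  have hp : ∀ b z : openBox R, extChartAt 𝓘(ℝ, Fin n → ℝ) b z = (z : Fin n → ℝ) :=
    fun b z => extChartAt_openBox_apply b z
  refine iSup_le fun l => ?_
  obtain ⟨lam, rfl⟩ := Submodule.Quotient.mk_surjective _ l
  rw [← EReal.le_of_forall_lt_iff_le]
  intro K hAK
  rw [EReal.coe_lt_coe_iff] at hAK
  have hK : 0 < K := lt_of_le_of_lt
    (Finset.sum_nonneg fun i _ => mul_nonneg (hR i).le (abs_nonneg _)) hAK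
  refine sInf_le ⟨K, ⟨hK, fun F hF hFc hFK => ?_⟩, rfl⟩
  by_contra hno
  push Not at hno
  set om' : TwoForm (I.prod (phaseModel n)) (M × (openBox R × Torus n)) :=
    stabilizedForm om fun p : openBox R => (p : Fin n → ℝ) with hom'
  set Y := hamiltonianVectorField om' F with hY
  have hYs : Y.IsSmooth :=
    VectorField.isSmooth_of_dual (lam := fun z => -mvfderiv (I.prod (phaseModel n)) F z)
      (stabilizedForm_contDiffOn_inChart om hp) (stabilizedForm_nondegenerate om hp)
      (fun x₀ v => (contDiffOn_inChart_mvfderiv hF x₀ v).neg)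
      (hamiltonianVectorField_spec om' (stabilizedForm_nondegenerate om hp) F)
  have hY0 : ∀ z ∉ tsupport F, Y z = 0 := by
    intro z hz
    refine stabilizedForm_nondegenerate om hp z _ fun v => ?_
    refine (hamiltonianVectorField_spec om' (stabilizedForm_nondegenerate om hp) F z v).trans ?_
    rw [mvfderiv_eq_zero_of_eventuallyEq (notMem_tsupport_iff_eventuallyEq.1 hz)]
    exact neg_zero
  have : Nonempty (M × (openBox R × Torus n)) := ⟨(x₀, (openBox.zero hR, 0))⟩
  have hrot : ∀ μ ∈ invariantMeasures Y, |∫ z, lam.1 z (Y z) ∂μ| <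
      (standardLoop I x₀ hR e).period (Submodule.Quotient.mk lam) := by
    intro μ hμ
    have h1 := hno μ hμ
    unfold rotationVector at h1
    rw [dif_pos ⟨hYs, hμ⟩] at h1
    exact h1
  obtain ⟨g, hg, c', hc', hbound⟩ := exists_cohomologous_small hYs hFc.isCompact hY0 lam.2.1 hrot
  obtain ⟨lamM, a, f, hlM, hlMc, hf, hdec⟩ :=
    exists_cohomologous_productForm hR lam.2.1 lam.2.2
  rw [period_standardLoop x₀ hR e lam a hf hdec] at hc'
  have hk : ContMDiff (I.prod (phaseModel n)) 𝓘(ℝ, ℝ) ∞ (f + g) := hf.add hg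
  refine absurd hAK (not_lt.2 (le_sum_of_not_stablyDisplaceable om hX hnd e hR hK hF hFc hFK hlM
    hlMc a hk ((abs_nonneg _).trans (hbound (Classical.arbitrary _))) hc' fun z => ?_))
  have h1 : mvfderiv (I.prod (phaseModel n)) (f + g) z (Y z) =
      mvfderiv (I.prod (phaseModel n)) f z (Y z) + mvfderiv (I.prod (phaseModel n)) g z (Y z) := by
    rw [mvfderiv_add (hf.mdifferentiable (by simp) z) (hg.mdifferentiable (by simp) z)]
    rfl
  have h2 : productForm lamM a z (Y z) + mvfderiv (I.prod (phaseModel n)) (f + g) z (Y z) =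
      lam.1 z (Y z) + mvfderiv (I.prod (phaseModel n)) g z (Y z) := by
    rw [h1, hdec z (Y z), add_assoc]
  exact (congrArg abs h2).trans_le (hbound z)

end UpperBound

end Symp

theorem mainTheorem4 {E : Type*} [NormedAddCommGroup E] [NormedSpace ℝ E] [FiniteDimensional ℝ E]
    {M : Type*} [TopologicalSpace M] [ChartedSpace E M] [IsManifold 𝓘(ℝ, E) ∞ M] [T2Space M]
    [CompactSpace M] [ConnectedSpace M] [MeasurableSpace M] [BorelSpace M]
    (om : Symp.SymplecticForm 𝓘(ℝ, E) M) (n : ℕ) (hn : 0 < n) (X : Set M) (hX : IsCompact X)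
    (hnd : ¬ Symp.StablyDisplaceable om n X) (e : Fin n → ℤ) (R : Fin n → ℝ)
    (hR : ∀ i, 0 < R i) (x₀ : M) :
    Symp.measureCapacity om X hR e x₀ = ((∑ i, R i * |(e i : ℝ)| : ℝ) : EReal) := by
  have : SecondCountableTopology E := inferInstance
  have : SecondCountableTopology M := ChartedSpace.secondCountable_of_sigmaCompact E M
  have : TopologicalSpace.MetrizableSpace M := TopologicalSpace.metrizableSpace_of_t3_secondCountable M
  exact le_antisymm (Symp.measureCapacity_le_sum om hX hnd e hR x₀)
    (Symp.sum_le_measureCapacity om X e hR x₀)
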